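/- \textbf{Model.} Let $\beta\in(0,2]$, $L>0$, $\alpha\in(0,1)$, $\sigma>0$, and write $k=\lceil\beta\rceil-1$. For $f:[0,1]\to\mathbb R$ one observes $Y_i=f(x_i)+\varepsilon_i$, $x_i=i/n$, $i=1,\dots,n$, with i.i.d. errors $\varepsilon_i\sim N(0,\sigma^2)$, where $\sigma^2$ is unknown; $\mathbb P_f$ is the corresponding law. Let $$\Sigma(\beta,L)=\{f: |f^{(k)}(x)-f^{(k)}(y)|\le L|x-y|^{\beta-k}\ \text{for all } x,y\in[0,1]\},$$ let $\mathcal M$ be the set of monotone increasing functions on $[0,1]$, let $\widetilde\Sigma(\beta,L)=\Sigma(\beta,L)$ if $\beta\le1$ and $\widetilde\Sigma(\beta,L)=\{f\in\Sigma(\beta,L):\|f'\|_\infty\le L\}$ if $\beta>1$, and let $\mathcal F_\beta(\delta)$ be the set of $f\in\Sigma(\beta,L)$ with $\max_{0\le a<b\le1}(f(a)-f(b))\ge\delta$ if $\beta\le 1$, and with $\min_{[0,1]}f'\le-\delta$ if $\beta>1$. \textbf{Kernel and estimator.} Let $K:\mathbb R\to[0,\infty)$ be symmetric, $\int K=1$,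 $K=0$ outside $[-1,1]$, $K_{\min}\mathbf 1_{\{|u|\le\Delta\}}\le K(u)\le K_{\max}$ for some $K_{\min},\Delta>0$ and $K_{\max}<\infty$, and Lipschitz with constant $L_K\in(0,\infty)$. With $U(u)=(1,u,\dots,u^k/k!)^\top$, the local polynomial estimator with bandwidth $h$ is $\hat f_n(x;h)=\langle\hat\theta,U(0)\rangle$, where $\hat\theta\in\mathbb R^{k+1}$ minimizes $\sum_i(Y_i-\langle\theta,U(\frac{x_i-x}h)\rangle)^2K(\frac{x_i-x}h)$ (set $\hat f_n(x;h)=0$ if the minimizer is not unique). Let $\lambda_0>0$ be a constant such that, for every bandwidth sequence $h_n\downarrow0$ with $nh_n\to\infty$, the smallest eigenvalue of $\frac1{nh_n}\sum_iU(\frac{x_i-x}{h_n})U(\frac{x_i-x}{h_n})^\top K(\frac{x_i-x}{h_n})$ is at least $\lambda_0$ for all $x\in[0,1]$ and all large $n$. \textbf{Constants.} Put $C_*=8K_{\max}/\lambda_0$, $L_1=\sqrt e(L_K+K_{\max})$, $L_2=\lceil\beta\rceil(2K_{\max}+L_K)$, $\widetilde C_*=\frac{L_1}{8L_2}+\frac{\sqrt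 eK_{\max}}{\lambda_0}$, $W=4\max(C_*^2,\widetilde C_*^2)$, $q_1=C_*L/k!$, $q_2=\sigma^2\frac{16\lceil\beta\rceil}{\lambda_0^2}\int K^2$, $C_h=\bigl(\frac{q_2}{4q_1^2\beta}\bigr)^{1/(2\beta+1)}$, $h_n=C_h\bigl(\frac{\log n}n\bigr)^{1/(2\beta+1)}$, $C_n(\alpha)=-2\log(\alpha/2)h_n^{-1}$, $N_{\max}=\frac{40}{\log2}C_n(\alpha)\log^2n$, $\Delta_{\beta,n}=\bigl(\frac{\log n}n\bigr)^{(\beta-\lceil\beta\rceil+1)/(2\beta+1)}$, and $$C_\beta=\begin{cases}\bigl(\max(\tfrac{16K_{\max}}{\lambda_0},2)+4\bigr)L+\sigma\Bigl(\sqrt{4W/C_h^{2\beta+1}}+\sqrt{6W/C_h^{2\beta+1}}\Bigr),&\beta\le1,\\ 4L+\frac{16L_2\sigma}{\lambda_0}\sqrt{4W/C_h^{2\beta+1}},&\beta>1.\end{cases}$$ The critical values are $q_{i,j}=C_{i,j}+D_{i,j}$ with $$C_{i,j}=\sigma\sqrt{-2W\log(\alpha/N_{\max})}\;n^{-1/2}h_n^{-3/2}\min\Bigl(\tfrac{8L_2}{\lambda_0}|x_i-x_j|,\,h_n\Bigr),$$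 and $D_{i,j}=0$ if $x_i,x_j\in[h_n,1-h_n]$, $D_{i,j}=\max(\frac{16K_{\max}}{\lambda_0},2)Lh_n^\beta$ otherwise. \textbf{The test.} Let $\hat\sigma_n^2$ be any measurable function of $(Y_1,\dots,Y_n)$. FOMT with estimated variance is the above with $\sigma$ replaced by $\hat\sigma_n$ in $h_n$, $C_n(\alpha)$, $N_{\max}$ and $q_{i,j}$ (giving $\tilde h_n,\widetilde C_n(\alpha),\widetilde N_{\max},\tilde q_{i,j}$), with local tests $\Phi_{i,j}=\mathbf 1\{\hat f_n(x_i;\tilde h_n)-\hat f_n(x_j;\tilde h_n)\ge\tilde q_{i,j}\}$, and proceeds as follows, all draws being independent of each other and of the data. Repeat $\lfloor\widetilde C_n(\alpha)\rfloor$ times: draw $I$ uniformly from $\{1,\dots,n\}$; if $I\le n-1$, repeat $\lceil20\log n\rceil$ times: for $0\le l\le\lceil\log_2(n-I)\rceil$ draw $J$ uniformly from $\{1,\dots,\min(2^l,n-I)\}$ and reject ($\Phi=1$) if $\Phi_{I,I+J}=1$; if $I\ge2$, repeat $\lceil20\log n\rceil$ times: for $0\le l\le\lceil\log_2(I-1)\rceil$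 draw $J$ uniformly from $\{1,\dots,\min(2^l,I-1)\}$ and reject if $\Phi_{I-J,I}=1$. If no rejection occurred, $\Phi=0$. \textbf{Claim.} Suppose that $\hat\sigma_n^2$ is consistent uniformly over $\widetilde\Sigma(\beta,L)$, i.e. for every $\delta>0$, $$\sup_{f\in\widetilde\Sigma(\beta,L)}\mathbb P_f\bigl(|\hat\sigma_n^2/\sigma^2-1|\ge\delta\bigr)\to0\qquad(n\to\infty).$$ Then (i) $\displaystyle\limsup_{n\to\infty}\ \sup_{f\in\widetilde\Sigma(\beta,L)\cap\mathcal M}\mathbb P_f(\Phi=1)\le\alpha$; (ii) with $C=(3C_\beta+2L)\,C_h^{\beta-\lceil\beta\rceil+1}$, where $C_\beta$ and $C_h$ are formed with the true $\sigma$, $$\liminf_{n\to\infty}\ \inf_{f\in\mathcal F_\beta(C\Delta_{\beta,n})\cap\widetilde\Sigma(\beta,L)}\mathbb P_f(\Phi=1)\ge1-\alpha.$$ -/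

import Mathlib

open Set Filter Topology MeasureTheory ProbabilityTheory
open scoped ENNReal

noncomputable section

namespace Fomt

/-! ### Function classes on the unit interval

A function on `[0,1]` is represented by a function on `ℝ` of which only the values on
`[0,1]` are used. -/

/-- The order `⌈β⌉ - 1` of the derivative in the Hölder condition; also the order of the
local polynomial estimator. -/
def order (β : ℝ) : ℕ := ⌈β⌉₊ - 1

/-- The Hölder class of smoothness `β > 0` and radius `L` on `[0,1]`. -/
def holderClass (β L : ℝ) : Set (ℝ → ℝ) :=
  {f | ContDiffOn ℝ (order β) f (Icc 0 1) ∧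
    ∀ x ∈ Icc (0 : ℝ) 1, ∀ y ∈ Icc (0 : ℝ) 1,
      |iteratedDerivWithin (order β) f (Icc 0 1) x
          - iteratedDerivWithin (order β) f (Icc 0 1) y|
        ≤ L * |x - y| ^ (β - (order β : ℝ))}

/-- The Hölder class, with the additional bound `‖f'‖_∞ ≤ L` when `β > 1`. -/
def boundedHolderClass (β L : ℝ) : Set (ℝ → ℝ) :=
  {f | f ∈ holderClass β L ∧
    (1 < β → ∀ x ∈ Icc (0 : ℝ) 1, |derivWithin f (Icc 0 1) x| ≤ L)}

/-- Monotone increasing functions on `[0,1]`. -/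
def monotoneClass : Set (ℝ → ℝ) := {f | MonotoneOn f (Icc 0 1)}

/-- The alternatives at separation `δ > 0`: the largest decrease of `f` is at least `δ` when
`β ≤ 1`, and the smallest slope is at most `-δ` when `β > 1`. -/
def alternativeClass (β L δ : ℝ) : Set (ℝ → ℝ) :=
  {f | f ∈ holderClass β L ∧
    if β ≤ 1 then ∃ a b : ℝ, 0 ≤ a ∧ a < b ∧ b ≤ 1 ∧ δ ≤ f a - f b
    else ∃ x ∈ Icc (0 : ℝ) 1, derivWithin f (Icc 0 1) x ≤ -δ}

/-! ### The kernel and the local polynomial estimator -/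

/-- The assumptions on the kernel: a probability density supported in `[-1,1]`, bounded by
`Kmax`, bounded below by `Kmin > 0` on `[-Δ, Δ]`, Lipschitz with constant `LK`, and
symmetric. -/
structure KernelAssumptions (K : ℝ → ℝ) (Kmin Kmax Δ LK : ℝ) : Prop where
  nonneg : ∀ u, 0 ≤ K u
  integral_eq_one : ∫ u, K u = 1
  support_subset : ∀ u, 1 < |u| → K u = 0
  Kmin_pos : 0 < Kmin
  Δ_pos : 0 < Δ
  lower : ∀ u, |u| ≤ Δ → Kmin ≤ K u
  upper : ∀ u, K u ≤ Kmax
  LK_pos : 0 < LK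
  lipschitz : ∀ u v, |K u - K v| ≤ LK * |u - v|
  symm : ∀ u, K (-u) = K u

/-- The design point `x_i = i / n`, for `i = 1, …, n`. -/
def design (n i : ℕ) : ℝ := (i : ℝ) / n

/-- The vector `U(u) = (1, u, u²/2!, …, u^k/k!)`. -/
def U (k : ℕ) (u : ℝ) : Fin (k + 1) → ℝ := fun j => u ^ (j : ℕ) / ((j : ℕ).factorial : ℝ)

/-- The weighted least squares criterion of the local polynomial estimator at `x`. The
observation at the design point `x_{i+1}` is `y i`, `i : Fin n`. -/
def lpeCriterion (K : ℝ → ℝ) (k n : ℕ) (h x : ℝ) (y : Fin n → ℝ) (θ : Fin (k + 1) → ℝ) : ℝ :=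
  ∑ i : Fin n, (y i - θ ⬝ᵥ U k ((design n (i + 1) - x) / h)) ^ 2
    * K ((design n (i + 1) - x) / h)

/-- `θ` minimizes the weighted least squares criterion. -/
def IsLpeMinimizer (K : ℝ → ℝ) (k n : ℕ) (h x : ℝ) (y : Fin n → ℝ)
    (θ : Fin (k + 1) → ℝ) : Prop :=
  ∀ θ' : Fin (k + 1) → ℝ, lpeCriterion K k n h x y θ ≤ lpeCriterion K k n h x y θ'

open Classical in
/-- The local polynomial estimator of order `k` with bandwidth `h`, at the point `x`:
`⟨θ, U(0)⟩` for the unique minimizer `θ` of the criterion, and `0` by convention if the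
minimizer is not unique. -/
def lpe (K : ℝ → ℝ) (k n : ℕ) (h x : ℝ) (y : Fin n → ℝ) : ℝ :=
  if H : ∃! θ : Fin (k + 1) → ℝ, IsLpeMinimizer K k n h x y θ then
    H.choose ⬝ᵥ U k 0
  else 0

/-- The Gram matrix `B_{nx} = (nh)⁻¹ ∑ U((x_i - x)/h) U((x_i - x)/h)ᵀ K((x_i - x)/h)`. -/
def gram (K : ℝ → ℝ) (k n : ℕ) (h x : ℝ) : Matrix (Fin (k + 1)) (Fin (k + 1)) ℝ :=
  ((n : ℝ) * h)⁻¹ • ∑ i : Fin n, K ((design n (i + 1) - x) / h) •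
    Matrix.vecMulVec (U k ((design n (i + 1) - x) / h)) (U k ((design n (i + 1) - x) / h))

/-- `lam` is a positive asymptotic lower bound of the smallest eigenvalue of `B_{nx}`: for
every bandwidth sequence `h_n ↓ 0` with `n h_n → ∞`, one has `λ_min(B_{nx}) ≥ lam` for all
`x ∈ [0,1]` and all large `n`. -/
def IsEigenvalueBound (K : ℝ → ℝ) (k : ℕ) (lam : ℝ) : Prop :=
  0 < lam ∧ ∀ h : ℕ → ℝ, (∀ n, 0 < h n) → Tendsto h atTop (𝓝 0) →
    Tendsto (fun n : ℕ => (n : ℝ) * h n) atTop atTop →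
    ∃ n₀ : ℕ, ∀ n, n₀ ≤ n → ∀ x ∈ Icc (0 : ℝ) 1, ∀ v : Fin (k + 1) → ℝ,
      lam * (v ⬝ᵥ v) ≤ v ⬝ᵥ (gram K k n (h n) x).mulVec v

/-! ### Tuning constants -/

/-- The quantities, other than the noise variance, on which the procedure depends. -/
structure Params where
  β : ℝ
  L : ℝ
  K : ℝ → ℝ
  Kmax : ℝ
  LK : ℝ
  lam : ℝ

namespace Params

variable (P : Params)

def Cstar : ℝ := 8 * P.Kmax / P.lam

def q₁ : ℝ := P.Cstar * P.L / ((⌈P.β⌉₊ - 1).factorial : ℝ)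

/-- `q₂` at noise variance `v`. -/
def q₂ (v : ℝ) : ℝ := v * (16 * (⌈P.β⌉₊ : ℝ) / P.lam ^ 2) * ∫ u, P.K u ^ 2

/-- The bandwidth constant `C_h` at noise variance `v`. -/
def Ch (v : ℝ) : ℝ := (P.q₂ v / (4 * P.q₁ ^ 2 * P.β)) ^ (1 / (2 * P.β + 1))

/-- The bandwidth `h_n` at noise variance `v`. -/
def bandwidth (v : ℝ) (n : ℕ) : ℝ :=
  P.Ch v * (Real.log n / n) ^ (1 / (2 * P.β + 1))

def L₁ : ℝ := √(Real.exp 1) * P.LK + √(Real.exp 1) * P.Kmax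

def L₂ : ℝ := 2 * (⌈P.β⌉₊ : ℝ) * P.Kmax + (⌈P.β⌉₊ : ℝ) * P.LK

def CstarTilde : ℝ := P.L₁ / (8 * P.L₂) + √(Real.exp 1) * P.Kmax / P.lam

def W : ℝ := max (4 * P.Cstar ^ 2) (4 * P.CstarTilde ^ 2)

/-- The number `C_n(α) = -2 log(α/2) / h_n` of repetitions, before rounding. -/
def Cn (v α : ℝ) (n : ℕ) : ℝ := -2 * Real.log (α / 2) * (P.bandwidth v n)⁻¹

def Nmax (v α : ℝ) (n : ℕ) : ℝ := 40 / Real.log 2 * P.Cn v α n * Real.log n ^ 2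

/-- The stochastic part `C_{n,α,i,j}` of the critical value, at noise variance `v`. -/
def stochCrit (v α : ℝ) (n i j : ℕ) : ℝ :=
  √v * √(-2 * Real.log (α / P.Nmax v α n) * P.W) * (n : ℝ) ^ (-(1 / 2) : ℝ)
    * P.bandwidth v n ^ (-(3 / 2) : ℝ)
    * min (8 * P.L₂ / P.lam * |design n i - design n j|) (P.bandwidth v n)

open Classical in
/-- The deterministic part `D_{n,β,i,j}` of the critical value, at noise variance `v`. -/
def detCrit (v : ℝ) (n i j : ℕ) : ℝ :=
  if design n i ∈ Icc (P.bandwidth v n) (1 - P.bandwidth v n) ∧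
      design n j ∈ Icc (P.bandwidth v n) (1 - P.bandwidth v n) then 0
  else max (16 * P.Kmax / P.lam) 2 * P.L * P.bandwidth v n ^ P.β

/-- The critical value `q_{n,β,i,j}(α)`. -/
def critValue (v α : ℝ) (n i j : ℕ) : ℝ := P.stochCrit v α n i j + P.detCrit v n i j

/-- The constant `C_β`, at noise variance `v`. -/
def Cβ (v : ℝ) : ℝ :=
  if P.β ≤ 1 then
    (max (16 * P.Kmax / P.lam) 2 + 4) * P.L
      + √v * (√(4 * P.W / P.Ch v ^ (2 * P.β + 1)) + √(6 * P.W / P.Ch v ^ (2 * P.β + 1)))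
  else
    4 * P.L + 16 * P.L₂ * √v / P.lam * √(4 * P.W / P.Ch v ^ (2 * P.β + 1))

/-- The separation rate `Δ_{β,n}`. -/
def rate (n : ℕ) : ℝ :=
  (Real.log n / n) ^ ((P.β - (⌈P.β⌉₊ : ℝ) + 1) / (2 * P.β + 1))

/-! ### The test -/

open Classical in
/-- The local test `Φ_{i,j}` run with noise variance `v` (`true` means rejection): compare
the difference of the local polynomial estimates at `x_i` and `x_j` with the critical
value. -/
def localTest (v α : ℝ) (n : ℕ) (y : Fin n → ℝ) (i j : ℕ) : Bool :=
  decide (P.critValue v α n i j ≤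
    lpe P.K (order P.β) n (P.bandwidth v n) (design n i) y
      - lpe P.K (order P.β) n (P.bandwidth v n) (design n j) y)

end Params

/-- The uniform distribution on `{1, …, m}` for `m ≥ 1` (a point mass at `0` if `m = 0`). -/
def unif (m : ℕ) : PMF ℕ :=
  if H : (Finset.Icc 1 m).Nonempty then PMF.uniformOfFinset (Finset.Icc 1 m) H
  else PMF.pure 0

/-- Run `p`; return `true` if it does, and otherwise run `q`. -/
def orElse (p q : PMF Bool) : PMF Bool :=
  p.bind fun b => if b then PMF.pure true else q

/-- Run `body 0, …, body (m - 1)` in this order with independent randomness; return `true`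
as soon as one of them does, and `false` if none does. -/
def runUntilReject (m : ℕ) (body : ℕ → PMF Bool) : PMF Bool :=
  (List.range m).foldr (fun k rest => orElse (body k) rest) (PMF.pure false)

/-- The randomized search over pairs, for a given outcome `test i j` of the local tests: the
distribution of its answer (`true` means that monotonicity is rejected). -/
def search (n reps : ℕ) (test : ℕ → ℕ → Bool) : PMF Bool :=
  runUntilReject reps fun _ =>
    (unif n).bind fun I =>
      orElse
        (if I + 1 ≤ n then
          runUntilReject ⌈20 * Real.log n⌉₊ fun _ =>
            runUntilReject (Nat.clog 2 (n - I) + 1) fun k =>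
              (unif (min (2 ^ k) (n - I))).map fun J => test I (I + J)
        else PMF.pure false)
        (if 2 ≤ I then
          runUntilReject ⌈20 * Real.log n⌉₊ fun _ =>
            runUntilReject (Nat.clog 2 (I - 1) + 1) fun k =>
              (unif (min (2 ^ k) (I - 1))).map fun J => test (I - J) I
        else PMF.pure false)

/-- FOMT at level `α` on the data `y`, with the value `v` used for the noise variance in the
bandwidth, the critical values and the number of repetitions. -/
def Params.fomt (P : Params) (v α : ℝ) (n : ℕ) (y : Fin n → ℝ) : PMF Bool :=
  search n ⌊P.Cn v α n⌋₊ (P.localTest v α n y)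

/-! ### The regression model -/

/-- The law of `(Y_1, …, Y_n)`, where `Y_i = f(i/n) + ε_i` with independent centred Gaussian
errors of standard deviation `σ`. -/
def dataLaw (f : ℝ → ℝ) (σ : ℝ) (n : ℕ) : Measure (Fin n → ℝ) :=
  Measure.pi fun i : Fin n => gaussianReal (f (design n (i + 1))) (Real.toNNReal (σ ^ 2))

/-- `P_f(Φ = 1)` for FOMT with the noise variance replaced by the estimate `v n y`; the random
draws of the algorithm are independent of the data. -/
def Params.rejectProb (P : Params) (v : (n : ℕ) → (Fin n → ℝ) → ℝ) (α σ : ℝ) (n : ℕ)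
    (f : ℝ → ℝ) : ℝ≥0∞ :=
  ∫⁻ y, P.fomt (v n y) α n y true ∂(dataLaw f σ n)

/-- `v n` is an estimator of the noise variance `σ ^ 2`, consistent uniformly over the class
`F`. -/
def UniformlyConsistent (v : (n : ℕ) → (Fin n → ℝ) → ℝ) (σ : ℝ) (F : Set (ℝ → ℝ)) : Prop :=
  ∀ δ : ℝ, 0 < δ →
    Tendsto (fun n => ⨆ f ∈ F, dataLaw f σ n {y | δ ≤ |v n y / σ ^ 2 - 1|}) atTop (𝓝 0)

end Fomt

end

/-!
The constant `W` in the critical values is much larger than the variances require. Write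
`ρ = Kmax / lam`, which is at least `1` (`Admissible.lam_le`), and let `w_i` be the vector of
weights of the local polynomial estimator at `x_i` (`lpeWeight`, `lpe_eq_sum`). The variance of the
difference of two estimates is at most `σ² (2 ρ m)² / (n h)`, with
`m = min (8 L₂ |x_i - x_j| / (lam h)) 1` (`Admissible.sum_sub_sq_le`), whereas the stochastic part
of the critical value exceeds `9 ρ m σ √(log n / (n h))`. The Gaussian tail at this level is
a power of `n` which is small enough for a union bound over *all* pairs of design points and over
a grid of `n³` bandwidths, and the weights are Lipschitz in the bandwidth
(`Admissible.sum_sub_sq_le_of_bandwidth`), so that the grid controls all bandwidths. Hence there is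
an exceptional set of data of probability `O(1/n)`, uniformly in the regression function
(`dataLaw_largeNoise_le`), off which the stochastic error of every difference is smaller than the
stochastic part of its critical value, for every bandwidth of the right order
(`Params.Regular.abs_noiseDiff_lt`). The dependence of the bandwidth on the data is then harmless,
and everything that follows is deterministic off this set and the event that the variance estimate
is wrong by more than one percent.

Under the null hypothesis no local test at all rejects. For points away from the boundary the
estimator is, by the symmetry of the kernel, a moving average with constant weights, which preserves
monotonicity; near the boundary the bias is covered by the deterministic part of the critical
value (`Params.Regular.localTest_eq_false`). So the probability of a rejection even tends to zero.

Under the alternative there are two windows of length `h_n` such that `f` decreases by at least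
`(11/4) C_β h_n^β` from the first to the second (`Params.Valid.exists_windows`); for `β > 1` they
are the two outer thirds of an interval on which the slope is very negative. A local test rejects if
`f` decreases by half of that (`Params.Regular.localTest_eq_true`). Pair the points of the two
windows. For a pair `i < j` and any index `t` between, `f` decreases by half of the amount from `i`
to `t` or from `t` to `j`, so that `i` or `j` rejects with at least half of the indices between
(`heavy_of_between`). About `n h_n` indices are therefore heavy in this sense; a heavy index, once
drawn, leads to a rejection at the right dyadic scale with probability close to one, and the number
of repetitions makes the probability of never drawing a heavy index at most `α / 2`
(`acceptProb_search_le`, `Params.Valid.accept_bound`).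
-/

namespace Fomt

/-! ### Weights of the local polynomial estimator -/

/-- The quadratic form of the weighted least squares problem with regressors `U(u_l)` and
weights `K(u_l)`, polarized. -/
noncomputable def energy (K : ℝ → ℝ) (k : ℕ) {n : ℕ} (u : Fin n → ℝ)
    (p q : Fin (k + 1) → ℝ) : ℝ :=
  ∑ l, K (u l) * (p ⬝ᵥ U k (u l)) * (q ⬝ᵥ U k (u l))

lemma energy_smul_left (K : ℝ → ℝ) (k : ℕ) {n : ℕ} (u : Fin n → ℝ) (c : ℝ) (p q) :
    energy K k u (c • p) q = c * energy K k u p q := by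
  simp only [energy, smul_dotProduct, smul_eq_mul, Finset.mul_sum]
  exact Finset.sum_congr rfl fun _ _ => by ring

lemma energy_sub_left (K : ℝ → ℝ) (k : ℕ) {n : ℕ} (u : Fin n → ℝ) (p p' q) :
    energy K k u (p - p') q = energy K k u p q - energy K k u p' q := by
  simp only [energy, sub_dotProduct, ← Finset.sum_sub_distrib]
  exact Finset.sum_congr rfl fun _ _ => by ring

lemma energy_comm (K : ℝ → ℝ) (k : ℕ) {n : ℕ} (u : Fin n → ℝ) (p q) :
    energy K k u p q = energy K k u q p :=
  Finset.sum_congr rfl fun _ _ => by ring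

lemma energy_eq_dotProduct (K : ℝ → ℝ) (k : ℕ) {n : ℕ} (u : Fin n → ℝ) (p q) :
    energy K k u p q =
      (∑ l, (K (u l) * (p ⬝ᵥ U k (u l))) • U k (u l)) ⬝ᵥ q := by
  simp only [energy, sum_dotProduct, smul_dotProduct, smul_eq_mul, dotProduct_comm q]

/-- The smallest eigenvalue of the quadratic form is at least `g`. -/
def EnergyBound (K : ℝ → ℝ) (k : ℕ) {n : ℕ} (u : Fin n → ℝ) (g : ℝ) : Prop :=
  ∀ p, g * (p ⬝ᵥ p) ≤ energy K k u p p

lemma zero_le_dotProduct_self {m : ℕ} (p : Fin m → ℝ) : 0 ≤ p ⬝ᵥ p :=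
  Finset.sum_nonneg fun _ _ => mul_self_nonneg _

lemma dotProduct_sq_le {m : ℕ} (p q : Fin m → ℝ) : (p ⬝ᵥ q) ^ 2 ≤ (p ⬝ᵥ p) * (q ⬝ᵥ q) := by
  have := Finset.sum_mul_sq_le_sq_mul_sq Finset.univ p q
  simpa [dotProduct, pow_two] using this

lemma eq_zero_of_energy_eq_zero {K : ℝ → ℝ} {k n : ℕ} {u : Fin n → ℝ} {g : ℝ} (hg : 0 < g)
    (hE : EnergyBound K k u g) {p} (hp : energy K k u p p = 0) : p = 0 := by
  have h1 := hE p
  have h2 : p ⬝ᵥ p = 0 := by nlinarith [zero_le_dotProduct_self p]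
  exact dotProduct_self_eq_zero.1 h2

/-- The normal equations have a solution for every right hand side. -/
lemma exists_energy_eq {K : ℝ → ℝ} {k n : ℕ} {u : Fin n → ℝ} {g : ℝ} (hg : 0 < g)
    (hE : EnergyBound K k u g) (b : Fin (k + 1) → ℝ) :
    ∃ a, ∀ p, energy K k u a p = b ⬝ᵥ p := by
  let T : (Fin (k + 1) → ℝ) →ₗ[ℝ] (Fin (k + 1) → ℝ) :=
    { toFun := fun p => ∑ l, (K (u l) * (p ⬝ᵥ U k (u l))) • U k (u l)
      map_add' := fun p q => by
        simp only [add_dotProduct, mul_add, add_smul, Finset.sum_add_distrib]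
      map_smul' := fun c p => by
        simp only [smul_dotProduct, smul_eq_mul, RingHom.id_apply, Finset.smul_sum, smul_smul]
        exact Finset.sum_congr rfl fun _ _ => by ring_nf }
  have hT : ∀ p q, energy K k u p q = T p ⬝ᵥ q := energy_eq_dotProduct K k u
  have hinj : Function.Injective T := by
    rw [← LinearMap.ker_eq_bot, LinearMap.ker_eq_bot']
    intro p hp
    exact eq_zero_of_energy_eq_zero hg hE (by rw [hT, hp, zero_dotProduct])
  obtain ⟨a, ha⟩ := LinearMap.injective_iff_surjective.1 hinj b
  exact ⟨a, fun p => by rw [hT, ha]⟩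

/-- `a` represents the evaluation of polynomials at `0` in the inner product `energy`. -/
def IsRepresenter (K : ℝ → ℝ) (k : ℕ) {n : ℕ} (u : Fin n → ℝ) (a : Fin (k + 1) → ℝ) : Prop :=
  ∀ p, energy K k u a p = U k 0 ⬝ᵥ p

open Classical in
/-- The weights of the local polynomial estimator when the rescaled design points are `u`; they
are given the value `0` if the normal equations cannot be solved. -/
noncomputable def lpeWeight (K : ℝ → ℝ) (k : ℕ) {n : ℕ} (u : Fin n → ℝ) (l : Fin n) : ℝ :=
  if H : ∃ a, IsRepresenter K k u a then K (u l) * (H.choose ⬝ᵥ U k (u l)) else 0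

lemma IsRepresenter.unique {K : ℝ → ℝ} {k n : ℕ} {u : Fin n → ℝ} {g : ℝ} (hg : 0 < g)
    (hE : EnergyBound K k u g) {a a'} (ha : IsRepresenter K k u a)
    (ha' : IsRepresenter K k u a') : a = a' := by
  refine sub_eq_zero.1 (eq_zero_of_energy_eq_zero hg hE ?_)
  rw [energy_sub_left, ha, ha', sub_self]

lemma lpeWeight_eq {K : ℝ → ℝ} {k n : ℕ} {u : Fin n → ℝ} {g : ℝ} (hg : 0 < g)
    (hE : EnergyBound K k u g) {a} (ha : IsRepresenter K k u a) (l : Fin n) :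
    lpeWeight K k u l = K (u l) * (a ⬝ᵥ U k (u l)) := by
  have H : ∃ a, IsRepresenter K k u a := ⟨a, ha⟩
  rw [lpeWeight, dif_pos H, H.choose_spec.unique hg hE ha]

lemma exists_representer {K : ℝ → ℝ} {k n : ℕ} {u : Fin n → ℝ} {g : ℝ} (hg : 0 < g)
    (hE : EnergyBound K k u g) : ∃ a, IsRepresenter K k u a :=
  exists_energy_eq hg hE _

lemma U_zero_dotProduct (k : ℕ) (p : Fin (k + 1) → ℝ) : U k 0 ⬝ᵥ p = p 0 := by
  simp [dotProduct, Fin.sum_univ_succ, U]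

/-- The estimator reproduces polynomials of degree at most `k`. -/
lemma sum_lpeWeight_mul_poly {K : ℝ → ℝ} {k n : ℕ} {u : Fin n → ℝ} {g : ℝ} (hg : 0 < g)
    (hE : EnergyBound K k u g) (p : Fin (k + 1) → ℝ) :
    ∑ l, lpeWeight K k u l * (p ⬝ᵥ U k (u l)) = p 0 := by
  obtain ⟨a, ha⟩ := exists_representer hg hE
  simp only [lpeWeight_eq hg hE ha]
  rw [← U_zero_dotProduct k p, ← ha p, energy]

lemma lpeWeight_eq_zero {K : ℝ → ℝ} (hK : ∀ u, 1 < |u| → K u = 0) {k n : ℕ} {u : Fin n → ℝ}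
    {l : Fin n} (hl : 1 < |u l|) : lpeWeight K k u l = 0 := by
  rw [lpeWeight]; split_ifs <;> simp [hK _ hl]

/-- The representer of the evaluation at `0` has Euclidean norm and energy controlled by the
smallest eigenvalue. -/
lemma IsRepresenter.bounds {K : ℝ → ℝ} {k n : ℕ} {u : Fin n → ℝ} {g : ℝ} (hg : 0 < g)
    (hE : EnergyBound K k u g) {a} (ha : IsRepresenter K k u a) :
    a ⬝ᵥ a ≤ (1 / g) ^ 2 ∧ energy K k u a a ≤ 1 / g := by
  have h1 := hE a
  have h2 : energy K k u a a = a 0 := by rw [ha a, U_zero_dotProduct]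
  have h3 : a 0 ^ 2 ≤ a ⬝ᵥ a := by
    have : a 0 * a 0 ≤ ∑ i, a i * a i :=
      Finset.single_le_sum (f := fun i => a i * a i) (fun i _ => mul_self_nonneg _)
        (Finset.mem_univ 0)
    simpa [dotProduct, pow_two] using this
  rw [h2] at h1 ⊢
  have h4 : a 0 ≤ 1 / g := by
    rw [le_div_iff₀ hg]
    by_contra! h
    have h5 : 0 < a 0 := pos_of_mul_pos_left (by linarith) hg.le
    nlinarith [mul_pos h5 (sub_pos.2 h), mul_le_mul_of_nonneg_left h3 hg.le]
  have h0 : 0 ≤ a 0 := by nlinarith [zero_le_dotProduct_self a]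
  refine ⟨?_, h4⟩
  have h5 : a ⬝ᵥ a ≤ a 0 / g := by rw [le_div_iff₀ hg]; linarith
  calc a ⬝ᵥ a ≤ a 0 / g := h5
    _ ≤ (1 / g) / g := by gcongr
    _ = (1 / g) ^ 2 := by ring

/-- The sum of `K² (p · U)²` is controlled by the energy of `p`. -/
lemma sum_sq_le_energy {K : ℝ → ℝ} {Kmax : ℝ} (h0 : ∀ u, 0 ≤ K u) (hK : ∀ u, K u ≤ Kmax)
    {k n : ℕ} (u : Fin n → ℝ) (p : Fin (k + 1) → ℝ) :
    ∑ l, (K (u l) * (p ⬝ᵥ U k (u l))) ^ 2 ≤ Kmax * energy K k u p p := by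
  rw [energy, Finset.mul_sum]
  refine Finset.sum_le_sum fun l _ => ?_
  have := mul_le_mul_of_nonneg_right (hK (u l))
    (mul_nonneg (h0 (u l)) (sq_nonneg (p ⬝ᵥ U k (u l))))
  nlinarith

lemma sum_lpeWeight_sq_le {K : ℝ → ℝ} {Kmax : ℝ} (h0 : ∀ u, 0 ≤ K u) (hK : ∀ u, K u ≤ Kmax)
    {k n : ℕ} {u : Fin n → ℝ} {g : ℝ} (hg : 0 < g) (hE : EnergyBound K k u g) :
    ∑ l, lpeWeight K k u l ^ 2 ≤ Kmax / g := by
  obtain ⟨a, ha⟩ := exists_representer hg hE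
  simp only [lpeWeight_eq hg hE ha]
  refine (sum_sq_le_energy h0 hK u a).trans ?_
  rw [div_eq_mul_one_div]
  exact mul_le_mul_of_nonneg_left (ha.bounds hg hE).2 ((h0 0).trans (hK 0))

/-! ### Regularity of the weights -/

lemma U_dotProduct_self_le {k : ℕ} (hk : k ≤ 1) {u : ℝ} (hu : |u| ≤ 1) :
    U k u ⬝ᵥ U k u ≤ 2 := by
  have : u ^ 2 ≤ 1 := (sq_le_one_iff_abs_le_one u).2 hu
  interval_cases k
  · simp [dotProduct, U]
  · simp [dotProduct, U, Fin.sum_univ_succ]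
    nlinarith

lemma U_sub_dotProduct_self_le {k : ℕ} (hk : k ≤ 1) (u v : ℝ) :
    (U k u - U k v) ⬝ᵥ (U k u - U k v) ≤ (u - v) ^ 2 := by
  interval_cases k <;> simp [dotProduct, U, Fin.sum_univ_succ] <;> nlinarith [sq_nonneg (u - v)]

lemma abs_dotProduct_U_le {k : ℕ} (hk : k ≤ 1) {u : ℝ} (hu : |u| ≤ 1) {p : Fin (k + 1) → ℝ}
    {s : ℝ} (hs : 0 ≤ s) (hp : p ⬝ᵥ p ≤ s ^ 2) : |p ⬝ᵥ U k u| ≤ √2 * s := by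
  apply abs_le_of_sq_le_sq _ (by positivity)
  rw [mul_pow, Real.sq_sqrt (by norm_num)]
  nlinarith [dotProduct_sq_le p (U k u), U_dotProduct_self_le hk hu, zero_le_dotProduct_self p,
    zero_le_dotProduct_self (U k u)]

lemma abs_dotProduct_U_sub_le {k : ℕ} (hk : k ≤ 1) (u v : ℝ) {p : Fin (k + 1) → ℝ}
    {s : ℝ} (hs : 0 ≤ s) (hp : p ⬝ᵥ p ≤ s ^ 2) :
    |p ⬝ᵥ U k u - p ⬝ᵥ U k v| ≤ s * |u - v| := by
  rw [← dotProduct_sub]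
  apply abs_le_of_sq_le_sq _ (by positivity)
  rw [mul_pow, sq_abs]
  refine (dotProduct_sq_le p _).trans ?_
  exact mul_le_mul hp (U_sub_dotProduct_self_le hk u v) (zero_le_dotProduct_self _) (sq_nonneg _)

/-- Increments of `K P`, where `P` is a linear polynomial with coefficients of norm `s`. Nothing
is needed of `P` outside `[-1, 1]`, where the kernel vanishes. -/
lemma abs_kernel_mul_sub_le {K : ℝ → ℝ} {Kmin Kmax Δ LK : ℝ}
    (hK : KernelAssumptions K Kmin Kmax Δ LK) {P Q u v s η : ℝ} (hs : 0 ≤ s)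
    (hη : |u - v| ≤ η) (hP : |u| ≤ 1 → |P| ≤ √2 * s) (hQ : |v| ≤ 1 → |Q| ≤ √2 * s)
    (hPQ : |P - Q| ≤ s * |u - v|) :
    |K u * P - K v * Q| ≤ √2 * (2 * Kmax + LK) * s * η := by
  have hη0 : 0 ≤ η := (abs_nonneg _).trans hη
  have hLK := hK.LK_pos
  have hKm : 0 ≤ Kmax := (hK.nonneg 0).trans (hK.upper 0)
  have h2 : 1 ≤ √2 := Real.one_le_sqrt.2 (by norm_num)
  have hlip : |K u - K v| ≤ LK * η := (hK.lipschitz u v).trans (by gcongr)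
  have key : LK * η * (√2 * s) ≤ √2 * (2 * Kmax + LK) * s * η := by
    have : 0 ≤ √2 * (2 * Kmax) * s * η := by positivity
    nlinarith
  by_cases hv : |v| ≤ 1
  · by_cases hu : |u| ≤ 1
    · have e : K u * P - K v * Q = (K u - K v) * Q + K u * (P - Q) := by ring
      rw [e]
      refine (abs_add_le _ _).trans ?_
      rw [abs_mul, abs_mul, abs_of_nonneg (hK.nonneg u)]
      have h3 : |K u - K v| * |Q| ≤ LK * η * (√2 * s) := by
        gcongr; exact hQ hv
      have h4 : K u * |P - Q| ≤ Kmax * (s * η) := by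
        gcongr
        · exact hK.upper u
        · exact hPQ.trans (by gcongr)
      have h5 : Kmax * (s * η) ≤ √2 * (Kmax * (s * η)) :=
        le_mul_of_one_le_left (by positivity) h2
      have h6 : 0 ≤ √2 * (Kmax * (s * η)) := by positivity
      nlinarith
    · rw [hK.support_subset u (not_le.1 hu)] at hlip ⊢
      rw [zero_sub, abs_neg] at hlip
      rw [zero_mul, zero_sub, abs_neg, abs_mul]
      exact (mul_le_mul hlip (hQ hv) (abs_nonneg _) (by positivity)).trans key
  · rw [hK.support_subset v (not_le.1 hv)] at hlip ⊢
    rw [sub_zero] at hlip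
    rw [zero_mul, sub_zero, abs_mul]
    by_cases hu : |u| ≤ 1
    · exact (mul_le_mul hlip (hP hu) (abs_nonneg _) (by positivity)).trans key
    · rw [hK.support_subset u (not_le.1 hu), abs_zero, zero_mul]
      positivity

/-- The analogue of `abs_kernel_mul_sub_le` for `K P Q`. -/
lemma abs_kernel_mul_mul_sub_le {K : ℝ → ℝ} {Kmin Kmax Δ LK : ℝ}
    (hK : KernelAssumptions K Kmin Kmax Δ LK) {P Q P' Q' u v s t η : ℝ} (hs : 0 ≤ s)
    (ht : 0 ≤ t)
    (hη : |u - v| ≤ η) (hP : |u| ≤ 1 → |P| ≤ √2 * s) (hP' : |v| ≤ 1 → |P'| ≤ √2 * s)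
    (hQ : |u| ≤ 1 → |Q| ≤ √2 * t) (hQ' : |v| ≤ 1 → |Q'| ≤ √2 * t)
    (hPP : |P - P'| ≤ s * |u - v|) (hQQ : |Q - Q'| ≤ t * |u - v|) :
    |K u * P * Q - K v * P' * Q'| ≤ 2 * (2 * Kmax + LK) * s * t * η := by
  have hη0 : 0 ≤ η := (abs_nonneg _).trans hη
  have hLK := hK.LK_pos
  have hKm : 0 ≤ Kmax := (hK.nonneg 0).trans (hK.upper 0)
  have h2 : √2 * √2 = 2 := Real.mul_self_sqrt (by norm_num)
  have h2' : √2 ≤ 2 := by nlinarith [Real.one_le_sqrt.2 (show (1 : ℝ) ≤ 2 by norm_num)]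
  have hlip : |K u - K v| ≤ LK * η := (hK.lipschitz u v).trans (by gcongr)
  have key : LK * η * (√2 * s) * (√2 * t) ≤ 2 * (2 * Kmax + LK) * s * t * η := by
    have : 0 ≤ 2 * (2 * Kmax) * s * t * η := by positivity
    have e : LK * η * (√2 * s) * (√2 * t) = (√2 * √2) * (LK * η * s * t) := by ring
    rw [e, h2]
    linarith
  by_cases hv : |v| ≤ 1
  · by_cases hu : |u| ≤ 1
    · have e : K u * P * Q - K v * P' * Q'
          = (K u - K v) * P' * Q' + (K u * (P - P') * Q' + K u * P * (Q - Q')) := by ring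
      rw [e]
      refine (abs_add_le _ _).trans ?_
      have h3 : |(K u - K v) * P' * Q'| ≤ LK * η * (√2 * s) * (√2 * t) := by
        rw [abs_mul, abs_mul]
        gcongr
        · exact hP' hv
        · exact hQ' hv
      have h4 : |K u * (P - P') * Q'| ≤ Kmax * (s * η) * (√2 * t) := by
        rw [abs_mul, abs_mul, abs_of_nonneg (hK.nonneg u)]
        gcongr
        · exact hK.upper u
        · exact hPP.trans (by gcongr)
        · exact hQ' hv
      have h5 : |K u * P * (Q - Q')| ≤ Kmax * (√2 * s) * (t * η) := by
        rw [abs_mul, abs_mul, abs_of_nonneg (hK.nonneg u)]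
        gcongr
        · exact hK.upper u
        · exact hP hu
        · exact hQQ.trans (by gcongr)
      have h6 : Kmax * (s * η) * (√2 * t) + Kmax * (√2 * s) * (t * η)
          ≤ 2 * (2 * Kmax) * s * t * η := by
        have := mul_le_mul_of_nonneg_right h2' (show 0 ≤ 2 * Kmax * s * t * η by positivity)
        linarith
      have h7 := abs_add_le (K u * (P - P') * Q') (K u * P * (Q - Q'))
      have e2 : LK * η * (√2 * s) * (√2 * t) = (√2 * √2) * (LK * η * s * t) := by ring
      rw [e2, h2] at h3
      linarith
    · rw [hK.support_subset u (not_le.1 hu)] at hlip ⊢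
      rw [zero_sub, abs_neg] at hlip
      rw [zero_mul, zero_mul, zero_sub, abs_neg, abs_mul, abs_mul]
      refine le_trans ?_ key
      gcongr
      · exact hP' hv
      · exact hQ' hv
  · rw [hK.support_subset v (not_le.1 hv)] at hlip ⊢
    rw [sub_zero] at hlip
    rw [zero_mul, zero_mul, sub_zero, abs_mul, abs_mul]
    by_cases hu : |u| ≤ 1
    · refine le_trans ?_ key
      gcongr
      · exact hP hu
      · exact hQ hu
    · rw [hK.support_subset u (not_le.1 hu), abs_zero, zero_mul, zero_mul]
      positivity

open Classical in
/-- The indices at which one of the two kernel weights may be nonzero. -/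
noncomputable def active {n : ℕ} (u v : Fin n → ℝ) : Finset (Fin n) :=
  Finset.univ.filter fun l => |u l| ≤ 1 ∨ |v l| ≤ 1

lemma sum_le_of_active {n : ℕ} {u v : Fin n → ℝ} {N B : ℝ} (hN : ((active u v).card : ℝ) ≤ N)
    (hB : 0 ≤ B) {F : Fin n → ℝ} (h0 : ∀ l, l ∉ active u v → F l = 0)
    (h1 : ∀ l ∈ active u v, F l ≤ B) : ∑ l, F l ≤ N * B := by
  rw [← Finset.sum_subset (Finset.subset_univ (active u v)) fun l _ hl => h0 l hl]
  refine (Finset.sum_le_card_nsmul _ _ B h1).trans ?_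
  rw [nsmul_eq_mul]
  exact mul_le_mul_of_nonneg_right hN hB

/-- The weights depend on the rescaled design points in a Lipschitz way, in the `ℓ²` norm. Both
the shift of the evaluation point and the change of the bandwidth are instances. -/
lemma sum_lpeWeight_sub_sq_le {K : ℝ → ℝ} {Kmin Kmax Δ LK : ℝ}
    (hK : KernelAssumptions K Kmin Kmax Δ LK) {k n : ℕ} (hk : k ≤ 1) {u v : Fin n → ℝ}
    {g N η : ℝ} (hg : 0 < g) (hEu : EnergyBound K k u g) (hEv : EnergyBound K k v g)
    (hη0 : 0 ≤ η) (hη : ∀ l ∈ active u v, |u l - v l| ≤ η)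
    (hN : ((active u v).card : ℝ) ≤ N) :
    ∑ l, (lpeWeight K k u l - lpeWeight K k v l) ^ 2
      ≤ 8 * (Kmax / g) * (N * (2 * Kmax + LK) * η / g) ^ 2
        + 4 * N * ((2 * Kmax + LK) * η / g) ^ 2 := by
  have hLK := hK.LK_pos
  have hKm : 0 ≤ Kmax := (hK.nonneg 0).trans (hK.upper 0)
  have hN0 : 0 ≤ N := le_trans (Nat.cast_nonneg _) hN
  obtain ⟨a, ha⟩ := exists_representer hg hEu
  obtain ⟨b, hb⟩ := exists_representer hg hEv
  simp only [lpeWeight_eq hg hEu ha, lpeWeight_eq hg hEv hb]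
  have hb2 := (hb.bounds hg hEv).1
  have hg' : (0 : ℝ) ≤ 1 / g := by positivity
  have hout : ∀ l, l ∉ active u v → K (u l) = 0 ∧ K (v l) = 0 := by
    intro l hl
    simp only [active, Finset.mem_filter, Finset.mem_univ, true_and, not_or, not_le] at hl
    exact ⟨hK.support_subset _ hl.1, hK.support_subset _ hl.2⟩
  -- the energy of the difference of the two representers
  have hE : energy K k u (a - b) (a - b) ≤ (N * (2 * (2 * Kmax + LK)) * η / g) ^ 2 / g := by
    set d := a - b with hd
    set t := √(d ⬝ᵥ d) with ht
    have ht2 : t ^ 2 = d ⬝ᵥ d := Real.sq_sqrt (zero_le_dotProduct_self d)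
    have ht0 : 0 ≤ t := Real.sqrt_nonneg _
    have h1 : energy K k u d d ≤ (N * (2 * (2 * Kmax + LK)) * η / g) * t := by
      have e : energy K k u d d = energy K k v b d - energy K k u b d := by
        conv_lhs => rw [hd, energy_sub_left, ← hd, ha, ← hb]
      rw [e, energy, energy, ← Finset.sum_sub_distrib]
      have := sum_le_of_active (u := u) (v := v) (N := N)
        (B := 2 * (2 * Kmax + LK) * (1 / g) * t * η)
        (F := fun l => K (v l) * (b ⬝ᵥ U k (v l)) * (d ⬝ᵥ U k (v l))
          - K (u l) * (b ⬝ᵥ U k (u l)) * (d ⬝ᵥ U k (u l))) hN (by positivity)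
        (fun l hl => by simp [hout l hl])
        (fun l hl => by
          refine (le_abs_self _).trans ?_
          rw [abs_sub_comm]
          exact abs_kernel_mul_mul_sub_le hK hg' ht0 (hη l hl)
            (fun h => abs_dotProduct_U_le hk h hg' hb2)
            (fun h => abs_dotProduct_U_le hk h hg' hb2)
            (fun h => abs_dotProduct_U_le hk h ht0 ht2.ge)
            (fun h => abs_dotProduct_U_le hk h ht0 ht2.ge)
            (abs_dotProduct_U_sub_le hk _ _ hg' hb2)
            (abs_dotProduct_U_sub_le hk _ _ ht0 ht2.ge))
      refine this.trans (le_of_eq ?_)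
      ring
    set X := N * (2 * (2 * Kmax + LK)) * η / g
    have hX : 0 ≤ X := by positivity
    have h2 : g * t ^ 2 ≤ X * t := by rw [ht2]; exact (hEu d).trans h1
    have h3 : t ≤ X / g := by
      rw [le_div_iff₀ hg]
      rcases ht0.eq_or_lt with h | h
      · rw [← h]; simpa using hX
      · nlinarith
    calc energy K k u d d ≤ X * t := h1
      _ ≤ X * (X / g) := by gcongr
      _ = X ^ 2 / g := by ring
  have h1 : ∑ l, (K (u l) * ((a - b) ⬝ᵥ U k (u l))) ^ 2
      ≤ Kmax * ((N * (2 * (2 * Kmax + LK)) * η / g) ^ 2 / g) :=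
    (sum_sq_le_energy hK.nonneg hK.upper u _).trans (by gcongr)
  have h2 : ∑ l, (K (u l) * (b ⬝ᵥ U k (u l)) - K (v l) * (b ⬝ᵥ U k (v l))) ^ 2
      ≤ N * (√2 * (2 * Kmax + LK) * (1 / g) * η) ^ 2 := by
    refine sum_le_of_active hN (by positivity) (fun l hl => by simp [hout l hl]) fun l hl => ?_
    rw [← sq_abs]
    gcongr
    exact abs_kernel_mul_sub_le hK hg' (hη l hl)
      (fun h => abs_dotProduct_U_le hk h hg' hb2) (fun h => abs_dotProduct_U_le hk h hg' hb2)
      (abs_dotProduct_U_sub_le hk _ _ hg' hb2)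
  calc ∑ l, (K (u l) * (a ⬝ᵥ U k (u l)) - K (v l) * (b ⬝ᵥ U k (v l))) ^ 2
      ≤ ∑ l, (2 * (K (u l) * ((a - b) ⬝ᵥ U k (u l))) ^ 2
        + 2 * (K (u l) * (b ⬝ᵥ U k (u l)) - K (v l) * (b ⬝ᵥ U k (v l))) ^ 2) := by
        refine Finset.sum_le_sum fun l _ => ?_
        have e : K (u l) * (a ⬝ᵥ U k (u l)) - K (v l) * (b ⬝ᵥ U k (v l))
          = K (u l) * ((a - b) ⬝ᵥ U k (u l))
            + (K (u l) * (b ⬝ᵥ U k (u l)) - K (v l) * (b ⬝ᵥ U k (v l))) := by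
          rw [sub_dotProduct]; ring
        rw [e]
        nlinarith [sq_nonneg (K (u l) * ((a - b) ⬝ᵥ U k (u l))
            - (K (u l) * (b ⬝ᵥ U k (u l)) - K (v l) * (b ⬝ᵥ U k (v l))))]
    _ ≤ 2 * (Kmax * ((N * (2 * (2 * Kmax + LK)) * η / g) ^ 2 / g))
        + 2 * (N * (√2 * (2 * Kmax + LK) * (1 / g) * η) ^ 2) := by
        rw [Finset.sum_add_distrib, ← Finset.mul_sum, ← Finset.mul_sum]
        gcongr
    _ = _ := by
        have : √2 ^ 2 = 2 := Real.sq_sqrt (by norm_num)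
        simp only [mul_pow, div_pow, this]
        ring

/-! ### The estimator as a weighted sum -/

/-- The rescaled design points seen from `x`. -/
noncomputable def scaled (n : ℕ) (h x : ℝ) (l : Fin n) : ℝ := (design n (l + 1) - x) / h

/-- A solution of the normal equations splits the criterion orthogonally. -/
lemma lpeCriterion_eq (K : ℝ → ℝ) (k n : ℕ) (h x : ℝ) (y : Fin n → ℝ)
    (θ θ' : Fin (k + 1) → ℝ)
    (hθ : ∀ p, energy K k (scaled n h x) θ p
      = (∑ l, (K (scaled n h x l) * y l) • U k (scaled n h x l)) ⬝ᵥ p) :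
    lpeCriterion K k n h x y θ' = lpeCriterion K k n h x y θ
      + energy K k (scaled n h x) (θ' - θ) (θ' - θ) := by
  have h1 := hθ (θ' - θ)
  rw [sum_dotProduct] at h1
  simp only [smul_dotProduct, smul_eq_mul, energy, scaled] at h1
  simp only [lpeCriterion, energy, scaled]
  have : ∀ l : Fin n, (y l - θ' ⬝ᵥ U k ((design n (l + 1) - x) / h)) ^ 2
        * K ((design n (l + 1) - x) / h)
      = (y l - θ ⬝ᵥ U k ((design n (l + 1) - x) / h)) ^ 2 * K ((design n (l + 1) - x) / h)
        + K ((design n (l + 1) - x) / h) * ((θ' - θ) ⬝ᵥ U k ((design n (l + 1) - x) / h))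
          * ((θ' - θ) ⬝ᵥ U k ((design n (l + 1) - x) / h))
        + 2 * (K ((design n (l + 1) - x) / h) * (θ ⬝ᵥ U k ((design n (l + 1) - x) / h))
            * ((θ' - θ) ⬝ᵥ U k ((design n (l + 1) - x) / h))
          - K ((design n (l + 1) - x) / h) * y l
            * (U k ((design n (l + 1) - x) / h) ⬝ᵥ (θ' - θ))) := by
    intro l
    rw [dotProduct_comm (U k _) (θ' - θ), sub_dotProduct]
    ring
  rw [Finset.sum_congr rfl fun l _ => this l, Finset.sum_add_distrib, Finset.sum_add_distrib,
    ← Finset.mul_sum, Finset.sum_sub_distrib, h1, sub_self, mul_zero, add_zero]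

/-- If the normal equations are nondegenerate, the estimator is linear in the data. -/
lemma lpe_eq_sum {K : ℝ → ℝ} {k n : ℕ} {h x : ℝ} {g : ℝ} (hg : 0 < g)
    (hE : EnergyBound K k (scaled n h x) g) (y : Fin n → ℝ) :
    lpe K k n h x y = ∑ l, lpeWeight K k (scaled n h x) l * y l := by
  obtain ⟨θ, hθ⟩ := exists_energy_eq hg hE
    (∑ l : Fin n, (K (scaled n h x l) * y l) • U k (scaled n h x l))
  have hcrit := fun θ' => lpeCriterion_eq K k n h x y θ θ' hθ
  have hmin : ∀ θ', IsLpeMinimizer K k n h x y θ' → θ' = θ := by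
    intro θ' hθ'
    have h1 := hθ' θ
    rw [hcrit θ'] at h1
    have h2 : energy K k (scaled n h x) (θ' - θ) (θ' - θ) ≤ 0 := by linarith
    have h3 := hE (θ' - θ)
    have h4 : 0 ≤ g * ((θ' - θ) ⬝ᵥ (θ' - θ)) := mul_nonneg hg.le (zero_le_dotProduct_self _)
    exact sub_eq_zero.1 (eq_zero_of_energy_eq_zero hg hE (by linarith))
  have hθm : IsLpeMinimizer K k n h x y θ := by
    intro θ'
    rw [hcrit θ']
    have h3 := hE (θ' - θ)
    have h4 : 0 ≤ g * ((θ' - θ) ⬝ᵥ (θ' - θ)) := mul_nonneg hg.le (zero_le_dotProduct_self _)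
    have : 0 ≤ energy K k (scaled n h x) (θ' - θ) (θ' - θ) := h4.trans h3
    linarith
  have H : ∃! θ : Fin (k + 1) → ℝ, IsLpeMinimizer K k n h x y θ := ⟨θ, hθm, hmin⟩
  rw [lpe, dif_pos H, hmin _ H.choose_spec.1]
  obtain ⟨a, ha⟩ := exists_representer hg hE
  simp only [lpeWeight_eq hg hE ha]
  rw [dotProduct_comm, ← ha θ, energy_comm, hθ a, sum_dotProduct]
  refine Finset.sum_congr rfl fun l _ => ?_
  rw [smul_dotProduct, smul_eq_mul, dotProduct_comm]
  ring

/-- In terms of `energy`, the Gram matrix is the matrix of the quadratic form divided by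
`n h`. -/
lemma dotProduct_gram_mulVec (K : ℝ → ℝ) (k n : ℕ) (h x : ℝ) (p : Fin (k + 1) → ℝ) :
    p ⬝ᵥ (gram K k n h x).mulVec p = ((n : ℝ) * h)⁻¹ * energy K k (scaled n h x) p p := by
  simp only [gram, Matrix.smul_mulVec, dotProduct_smul, smul_eq_mul, Matrix.sum_mulVec,
    Matrix.vecMulVec_mulVec, dotProduct_sum, energy, scaled]
  congr 1
  refine Finset.sum_congr rfl fun l _ => ?_
  simp [dotProduct_comm p]
  ring

/-! ### Bounds for admissible bandwidths -/

lemma card_filter_between_le {n : ℕ} {c d : ℝ} (hcd : c ≤ d) (s : Finset (Fin n))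
    (hs : ∀ l ∈ s, c ≤ (l : ℝ) + 1 ∧ (l : ℝ) + 1 ≤ d) : (s.card : ℝ) ≤ d - c + 1 := by
  have h1 : s.card ≤ (Finset.Icc ⌈c⌉ ⌊d⌋).card := by
    refine Finset.card_le_card_of_injOn (fun l => ((l : ℕ) : ℤ) + 1) ?_ ?_
    · intro l hl
      have := hs l hl
      simp only [Finset.coe_Icc, mem_Icc, Int.ceil_le, Int.le_floor]
      push_cast
      exact this
    · intro a _ b _ hab
      simp only at hab
      ext
      omega
  rw [Int.card_Icc] at h1
  have h2 : (s.card : ℝ) ≤ ((⌊d⌋ + 1 - ⌈c⌉).toNat : ℝ) := by exact_mod_cast h1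
  have h3 : (((⌊d⌋ + 1 - ⌈c⌉).toNat : ℤ) : ℝ) ≤ d - c + 1 := by
    rw [Int.toNat_eq_max]
    push_cast
    refine max_le ?_ (by linarith)
    linarith [Int.floor_le d, Int.le_ceil c]
  exact h2.trans (by exact_mod_cast h3)

/-- The requirements on the bandwidth `h` at sample size `n` under which the local polynomial
estimators behave well at every point of the unit interval. -/
structure Admissible (K : ℝ → ℝ) (k : ℕ) (lam : ℝ) (n : ℕ) (h : ℝ) : Prop where
  pos : 0 < h
  large : 2 ≤ n * h
  energy : ∀ x ∈ Icc (0 : ℝ) 1, EnergyBound K k (scaled n h x) (n * h * lam)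

lemma Admissible.n_pos {K : ℝ → ℝ} {k : ℕ} {lam : ℝ} {n : ℕ} {h : ℝ}
    (A : Admissible K k lam n h) : (0 : ℝ) < n := by
  have h1 := A.large
  have h2 := A.pos
  by_contra! h3
  nlinarith

lemma abs_scaled_le_iff {n : ℕ} {h x : ℝ} (hh : 0 < h) (l : Fin n) (r : ℝ) :
    |scaled n h x l| ≤ r ↔ |design n (l + 1) - x| ≤ r * h := by
  rw [scaled, abs_div, abs_of_pos hh, div_le_iff₀ hh]

lemma design_bounds {n : ℕ} (hn : (0 : ℝ) < n) {l : Fin n} {x r : ℝ}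
    (h : |design n (l + 1) - x| ≤ r) :
    n * x - n * r ≤ (l : ℝ) + 1 ∧ (l : ℝ) + 1 ≤ n * x + n * r := by
  rw [abs_le, design] at h
  push_cast at h
  have e : (n : ℝ) * (((l : ℝ) + 1) / n) = l + 1 := by field_simp
  constructor
  · have := mul_le_mul_of_nonneg_left h.1 hn.le
    rw [mul_sub, e] at this
    linarith
  · have := mul_le_mul_of_nonneg_left h.2 hn.le
    rw [mul_sub, e] at this
    linarith

lemma card_near_le {n : ℕ} (hn : (0 : ℝ) < n) {x r : ℝ} (hr : 0 ≤ r) (s : Finset (Fin n))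
    (hs : ∀ l ∈ s, |design n (l + 1) - x| ≤ r) : (s.card : ℝ) ≤ 2 * (n * r) + 1 := by
  have hnr : 0 ≤ (n : ℝ) * r := by positivity
  have := card_filter_between_le (c := n * x - n * r) (d := n * x + n * r) (by linarith) s
    fun l hl => design_bounds hn (hs l hl)
  linarith

lemma EnergyBound.mono {K : ℝ → ℝ} {k n : ℕ} {u : Fin n → ℝ} {g g' : ℝ}
    (h : EnergyBound K k u g) (hg : g' ≤ g) : EnergyBound K k u g' := fun p =>
  (mul_le_mul_of_nonneg_right hg (zero_le_dotProduct_self p)).trans (h p)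

lemma energy_U_zero (K : ℝ → ℝ) (k : ℕ) {n : ℕ} (u : Fin n → ℝ) :
    energy K k u (U k 0) (U k 0) = ∑ l, K (u l) := by
  simp [energy, U_zero_dotProduct, U]

lemma U_zero_dotProduct_self (k : ℕ) : U k 0 ⬝ᵥ U k 0 = 1 := by
  rw [U_zero_dotProduct]; simp [U]

section
variable {K : ℝ → ℝ} {Kmin Kmax Δ LK : ℝ} {k : ℕ} {lam : ℝ} {n : ℕ} {h : ℝ}

lemma Admissible.gain_pos (A : Admissible K k lam n h) (hlam : 0 < lam) : 0 < n * h * lam :=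
  mul_pos (mul_pos A.n_pos A.pos) hlam

/-- At the left end point at most `n h` design points carry weight, which bounds the smallest
eigenvalue by the maximum of the kernel. -/
lemma Admissible.lam_le (A : Admissible K k lam n h)
    (hK : KernelAssumptions K Kmin Kmax Δ LK) : lam ≤ Kmax := by
  have hn := A.n_pos
  have hh := A.pos
  have hl := A.large
  have hKm : 0 ≤ Kmax := (hK.nonneg 0).trans (hK.upper 0)
  have h1 := A.energy 0 (by simp) (U k 0)
  rw [U_zero_dotProduct_self, energy_U_zero, mul_one] at h1
  classical
  set s : Finset (Fin n) := Finset.univ.filter fun l => |scaled n h 0 l| ≤ 1 with hs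
  have h2 : ∑ l, K (scaled n h 0 l) ≤ s.card * Kmax := by
    rw [← Finset.sum_subset (Finset.subset_univ s) (fun l _ hl => by
      simp only [hs, Finset.mem_filter, Finset.mem_univ, true_and, not_le] at hl
      exact hK.support_subset _ hl)]
    refine (Finset.sum_le_card_nsmul _ _ Kmax fun l _ => hK.upper _).trans ?_
    rw [nsmul_eq_mul]
  have h3 : (s.card : ℝ) ≤ n * h := by
    have := card_filter_between_le (c := 1) (d := n * h) (by linarith) s (fun l hl => by
      have h4 : |scaled n h 0 l| ≤ 1 := by simpa [hs] using hl
      have h5 := (design_bounds hn ((abs_scaled_le_iff hh l 1).1 h4)).2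
      refine ⟨by linarith [(Nat.cast_nonneg (l : ℕ) : (0 : ℝ) ≤ (l : ℕ))], ?_⟩
      linarith)
    linarith
  have h4 : n * h * lam ≤ n * h * Kmax := h1.trans (h2.trans (by gcongr))
  exact le_of_mul_le_mul_left h4 (mul_pos hn hh)

lemma Admissible.one_le_ratio (A : Admissible K k lam n h) (hlam : 0 < lam)
    (hK : KernelAssumptions K Kmin Kmax Δ LK) : 1 ≤ Kmax / lam := by
  rw [le_div_iff₀ hlam, one_mul]; exact A.lam_le hK

lemma Admissible.sum_sq_le (A : Admissible K k lam n h) (hlam : 0 < lam)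
    (hK : KernelAssumptions K Kmin Kmax Δ LK) {x : ℝ} (hx : x ∈ Icc (0 : ℝ) 1) :
    ∑ l, lpeWeight K k (scaled n h x) l ^ 2 ≤ Kmax / lam / (n * h) := by
  refine (sum_lpeWeight_sq_le hK.nonneg hK.upper (A.gain_pos hlam) (A.energy x hx)).trans
    (le_of_eq ?_)
  rw [div_div, mul_comm lam]

/-- By Cauchy-Schwarz, as at most `3 n h` weights are nonzero. -/
lemma Admissible.sum_abs_le (A : Admissible K k lam n h) (hlam : 0 < lam)
    (hK : KernelAssumptions K Kmin Kmax Δ LK) {x : ℝ} (hx : x ∈ Icc (0 : ℝ) 1) :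
    ∑ l, |lpeWeight K k (scaled n h x) l| ≤ 2 * (Kmax / lam) := by
  have hn := A.n_pos
  have hh := A.pos
  have hl := A.large
  have hρ := A.one_le_ratio hlam hK
  have hnh : 0 < n * h := mul_pos hn hh
  classical
  set s : Finset (Fin n) := Finset.univ.filter fun l => |scaled n h x l| ≤ 1 with hs
  have h1 : ∑ l, |lpeWeight K k (scaled n h x) l|
      = ∑ l ∈ s, |lpeWeight K k (scaled n h x) l| := by
    refine (Finset.sum_subset (Finset.subset_univ s) fun l _ hl => ?_).symm
    simp only [hs, Finset.mem_filter, Finset.mem_univ, true_and, not_le] at hl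
    rw [lpeWeight_eq_zero hK.support_subset hl, abs_zero]
  have hcard : (s.card : ℝ) ≤ 3 * (n * h) := by
    have := card_near_le hn hh.le s fun l hl => by
      have h4 : |scaled n h x l| ≤ 1 := by simpa [hs] using hl
      simpa using (abs_scaled_le_iff hh l 1).1 h4
    linarith
  have h2 : (∑ l ∈ s, |lpeWeight K k (scaled n h x) l|) ^ 2 ≤ 3 * (Kmax / lam) := by
    refine (sq_sum_le_card_mul_sum_sq (s := s)).trans ?_
    have h3 : ∑ l ∈ s, |lpeWeight K k (scaled n h x) l| ^ 2 ≤ Kmax / lam / (n * h) := by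
      simp only [sq_abs]
      exact (Finset.sum_le_sum_of_subset_of_nonneg (Finset.subset_univ s)
        fun _ _ _ => sq_nonneg _).trans (A.sum_sq_le hlam hK hx)
    calc (s.card : ℝ) * ∑ l ∈ s, |lpeWeight K k (scaled n h x) l| ^ 2
        ≤ 3 * (n * h) * (Kmax / lam / (n * h)) := by
          gcongr
      _ = 3 * (Kmax / lam) := by field_simp
  rw [h1]
  apply le_of_sq_le_sq _ (by positivity)
  nlinarith

/-- The bound of `sum_lpeWeight_sub_sq_le` when at most `5 n h` weights are involved. -/
lemma lipschitz_bound_le {Kmax LK lam L2 δ h n : ℝ} (hn : 0 < n) (hh : 0 < h) (hlam : 0 < lam)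
    (hKm : 0 ≤ Kmax) (hLK : 0 ≤ LK) (hρ : 1 ≤ Kmax / lam) (hL2 : 2 * Kmax + LK ≤ L2)
    (hδ0 : 0 ≤ δ) :
    8 * (Kmax / (n * h * lam)) * (5 * (n * h) * (2 * Kmax + LK) * δ / (n * h * lam)) ^ 2
        + 4 * (5 * (n * h)) * ((2 * Kmax + LK) * δ / (n * h * lam)) ^ 2
      ≤ (2 * (Kmax / lam) * (8 * L2 / lam * δ)) ^ 2 / (n * h) := by
  set z := (2 * Kmax + LK) * δ / lam with hz
  have hz0 : 0 ≤ z := by positivity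
  have e1 : 8 * (Kmax / (n * h * lam)) * (5 * (n * h) * (2 * Kmax + LK) * δ / (n * h * lam)) ^ 2
      + 4 * (5 * (n * h)) * ((2 * Kmax + LK) * δ / (n * h * lam)) ^ 2
      = (200 * (Kmax / lam) + 20) * z ^ 2 / (n * h) := by
    rw [hz]; field_simp; ring
  rw [e1]
  have h2 : 8 * z ≤ 8 * L2 / lam * δ := by
    have : 8 * L2 / lam * δ = 8 * (L2 * δ / lam) := by ring
    rw [this, hz]; gcongr
  have h3 : (200 * (Kmax / lam) + 20) * z ^ 2 ≤ (2 * (Kmax / lam) * (8 * z)) ^ 2 := by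
    have : (2 * (Kmax / lam) * (8 * z)) ^ 2 = 256 * (Kmax / lam) ^ 2 * z ^ 2 := by ring
    rw [this]
    gcongr
    nlinarith
  gcongr
  exact h3.trans (by gcongr)

/-- The `ℓ²` distance of the weights at two points of the unit interval. -/
lemma Admissible.sum_sub_sq_le (A : Admissible K k lam n h) (hlam : 0 < lam) (hk : k ≤ 1)
    (hK : KernelAssumptions K Kmin Kmax Δ LK) {L2 : ℝ} (hL2 : 2 * Kmax + LK ≤ L2)
    {x x' : ℝ} (hx : x ∈ Icc (0 : ℝ) 1) (hx' : x' ∈ Icc (0 : ℝ) 1) :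
    ∑ l, (lpeWeight K k (scaled n h x) l - lpeWeight K k (scaled n h x') l) ^ 2
      ≤ (2 * (Kmax / lam) * min (8 * L2 / lam * (|x - x'| / h)) 1) ^ 2 / (n * h) := by
  have hn := A.n_pos
  have hh := A.pos
  have hl := A.large
  have hρ := A.one_le_ratio hlam hK
  have hnh : 0 < n * h := mul_pos hn hh
  have hKm : 0 ≤ Kmax := (hK.nonneg 0).trans (hK.upper 0)
  have hLK := hK.LK_pos
  rcases le_total (8 * L2 / lam * (|x - x'| / h)) 1 with hmin | hmin
  · rw [min_eq_left hmin]
    have h1 := sum_lpeWeight_sub_sq_le hK hk (u := scaled n h x) (v := scaled n h x')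
      (N := 5 * (n * h)) (η := |x - x'| / h)
      (A.gain_pos hlam) (A.energy x hx) (A.energy x' hx') (by positivity)
      (fun l _ => by
        rw [scaled, scaled, ← sub_div, abs_div, abs_of_pos hh, sub_sub_sub_cancel_left,
          abs_sub_comm])
      (by
        classical
        have hu : active (scaled n h x) (scaled n h x')
            ⊆ (Finset.univ.filter fun l => |scaled n h x l| ≤ 1)
              ∪ (Finset.univ.filter fun l => |scaled n h x' l| ≤ 1) := by
          intro l hl
          simpa [active] using hl
        have h2 := Finset.card_le_card hu |>.trans (Finset.card_union_le _ _)
        have h3 : ∀ x, ((Finset.univ.filter fun l => |scaled n h x l| ≤ 1).card : ℝ)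
            ≤ 2 * (n * h) + 1 := fun x => card_near_le (x := x) hn hh.le _ fun l hl => by
          have h4 : |scaled n h x l| ≤ 1 := by simpa using hl
          simpa using (abs_scaled_le_iff hh l 1).1 h4
        have h2' := (Nat.cast_le (α := ℝ)).2 h2
        push_cast at h2'
        linarith [h3 x, h3 x'])
    exact h1.trans (lipschitz_bound_le hn hh hlam hKm hK.LK_pos.le hρ hL2 (by positivity))
  · rw [min_eq_right hmin, mul_one]
    calc ∑ l, (lpeWeight K k (scaled n h x) l - lpeWeight K k (scaled n h x') l) ^ 2
        ≤ ∑ l, (2 * lpeWeight K k (scaled n h x) l ^ 2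
          + 2 * lpeWeight K k (scaled n h x') l ^ 2) :=
          Finset.sum_le_sum fun l _ => by
            nlinarith [sq_nonneg (lpeWeight K k (scaled n h x) l
              + lpeWeight K k (scaled n h x') l)]
      _ ≤ 2 * (Kmax / lam / (n * h)) + 2 * (Kmax / lam / (n * h)) := by
          rw [Finset.sum_add_distrib, ← Finset.mul_sum, ← Finset.mul_sum]
          have := A.sum_sq_le hlam hK hx
          have := A.sum_sq_le hlam hK hx'
          gcongr
      _ = 4 * (Kmax / lam) / (n * h) := by ring
      _ ≤ (2 * (Kmax / lam)) ^ 2 / (n * h) := by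
          gcongr
          nlinarith

/-- The `ℓ²` distance of the weights for two close bandwidths. -/
lemma Admissible.sum_sub_sq_le_of_bandwidth {h' τ : ℝ} (A : Admissible K k lam n h)
    (A' : Admissible K k lam n h') (hhh : h ≤ h') (hτ : h' ≤ h + τ) (hτ2 : n * τ ≤ 1)
    (hlam : 0 < lam) (hk : k ≤ 1)
    (hK : KernelAssumptions K Kmin Kmax Δ LK) {L2 : ℝ} (hL2 : 2 * Kmax + LK ≤ L2)
    {x : ℝ} (hx : x ∈ Icc (0 : ℝ) 1) :
    ∑ l, (lpeWeight K k (scaled n h x) l - lpeWeight K k (scaled n h' x) l) ^ 2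
      ≤ (2 * (Kmax / lam) * (8 * L2 / lam * (τ / h))) ^ 2 / (n * h) := by
  have hn := A.n_pos
  have hh := A.pos
  have hh' := A'.pos
  have hl := A.large
  have hρ := A.one_le_ratio hlam hK
  have hnh : 0 < n * h := mul_pos hn hh
  have hKm : 0 ≤ Kmax := (hK.nonneg 0).trans (hK.upper 0)
  have hLK := hK.LK_pos
  have hτ0 : 0 ≤ τ := by linarith
  have hact : ∀ l ∈ active (scaled n h x) (scaled n h' x), |design n (l + 1) - x| ≤ h' := by
    intro l hl
    simp only [active, Finset.mem_filter, Finset.mem_univ, true_and, abs_scaled_le_iff hh,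
      abs_scaled_le_iff hh', one_mul] at hl
    exact hl.elim (fun h => h.trans hhh) id
  have h1 := sum_lpeWeight_sub_sq_le hK hk (u := scaled n h x) (v := scaled n h' x)
    (N := 5 * (n * h)) (η := τ / h)
    (A.gain_pos hlam) (A.energy x hx) ((A'.energy x hx).mono (by gcongr)) (by positivity)
    (fun l hl => by
      have e : scaled n h x l - scaled n h' x l
          = ((design n (l + 1) - x) / h') * ((h' - h) / h) := by
        rw [scaled, scaled]; field_simp
      have h4 : 0 ≤ (h' - h) / h := div_nonneg (by linarith) hh.le
      rw [e, abs_mul, abs_div, abs_of_pos hh', abs_of_nonneg h4]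
      have h2 : |design n (l + 1) - x| / h' ≤ 1 := (div_le_one hh').2 (hact l hl)
      have h3 : (h' - h) / h ≤ τ / h := by gcongr; linarith
      nlinarith)
    (by
      have h2 := card_near_le hn hh'.le _ hact
      have h3 : n * h' ≤ n * h + n * τ := by rw [← mul_add]; gcongr
      linarith)
  exact h1.trans (lipschitz_bound_le hn hh hlam hKm hK.LK_pos.le hρ hL2 (by positivity))

end

/-! ### Bias -/

lemma order_eq_zero {β : ℝ} (h1 : β ≤ 1) : order β = 0 := by
  have : ⌈β⌉₊ ≤ 1 := Nat.ceil_le.2 (by simpa using h1)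
  rw [order]; omega

lemma ceil_eq_one {β : ℝ} (h0 : 0 < β) (h1 : β ≤ 1) : ⌈β⌉₊ = 1 := by
  have : ⌈β⌉₊ ≤ 1 := Nat.ceil_le.2 (by simpa using h1)
  have := Nat.ceil_pos.2 h0
  omega

lemma ceil_eq_two {β : ℝ} (h1 : 1 < β) (h2 : β ≤ 2) : ⌈β⌉₊ = 2 := by
  have : ⌈β⌉₊ ≤ 2 := Nat.ceil_le.2 (by simpa using h2)
  have : 1 < ⌈β⌉₊ := Nat.lt_ceil.2 (by simpa using h1)
  omega

lemma order_eq_one {β : ℝ} (h1 : 1 < β) (h2 : β ≤ 2) : order β = 1 := by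
  rw [order, ceil_eq_two h1 h2]

lemma order_le_one {β : ℝ} (h2 : β ≤ 2) : order β ≤ 1 := by
  rcases le_or_gt β 1 with h | h
  · simp [order_eq_zero h]
  · simp [order_eq_one h h2]

lemma holderClass_of_le_one {β L : ℝ} (h1 : β ≤ 1) {f : ℝ → ℝ} (hf : f ∈ holderClass β L)
    {x y : ℝ} (hx : x ∈ Icc (0 : ℝ) 1) (hy : y ∈ Icc (0 : ℝ) 1) :
    |f x - f y| ≤ L * |x - y| ^ β := by
  have := hf.2 x hx y hy
  simpa [order_eq_zero h1] using this

lemma hasDerivWithinAt_of_holderClass {β L : ℝ} (h1 : 1 < β) (h2 : β ≤ 2) {f : ℝ → ℝ}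
    (hf : f ∈ holderClass β L) {x : ℝ} (hx : x ∈ Icc (0 : ℝ) 1) :
    HasDerivWithinAt f (derivWithin f (Icc 0 1) x) (Icc 0 1) x := by
  have h := hf.1
  rw [order_eq_one h1 h2] at h
  exact (h.differentiableOn (by simp) x hx).hasDerivWithinAt

lemma derivWithin_holder {β L : ℝ} (h1 : 1 < β) (h2 : β ≤ 2) {f : ℝ → ℝ}
    (hf : f ∈ holderClass β L) {x y : ℝ} (hx : x ∈ Icc (0 : ℝ) 1) (hy : y ∈ Icc (0 : ℝ) 1) :
    |derivWithin f (Icc 0 1) x - derivWithin f (Icc 0 1) y| ≤ L * |x - y| ^ (β - 1) := by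
  have := hf.2 x hx y hy
  simpa [order_eq_one h1 h2, iteratedDerivWithin_one] using this

/-- The Taylor polynomial of `f` at `x`, in the coordinates of `U` at scale `h`. -/
lemma exists_taylor_poly {β L : ℝ} (hβ : 0 < β) (hβ2 : β ≤ 2) (hL : 0 < L) {f : ℝ → ℝ}
    (hf : f ∈ holderClass β L) {x h : ℝ} (hx : x ∈ Icc (0 : ℝ) 1) (hh : 0 < h) :
    ∃ p : Fin (order β + 1) → ℝ, p 0 = f x ∧ ∀ z ∈ Icc (0 : ℝ) 1,
      |f z - p ⬝ᵥ U (order β) ((z - x) / h)| ≤ L * |z - x| ^ β := by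
  rcases le_or_gt β 1 with h1 | h1
  · rw [order_eq_zero h1]
    refine ⟨fun _ => f x, rfl, fun z hz => ?_⟩
    simpa [dotProduct, U] using holderClass_of_le_one h1 hf hz hx
  · rw [order_eq_one h1 hβ2]
    set s := derivWithin f (Icc 0 1) x with hs
    refine ⟨![f x, s * h], rfl, fun z hz => ?_⟩
    have e : ![f x, s * h] ⬝ᵥ U 1 ((z - x) / h) = f x + s * (z - x) := by
      simp [dotProduct, U, Fin.sum_univ_succ]
      field_simp
    rw [e]
    have hsub : uIcc x z ⊆ Icc 0 1 := (convex_Icc (0 : ℝ) 1).ordConnected.uIcc_subset hx hz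
    have key := Convex.norm_image_sub_le_of_norm_hasDerivWithin_le
      (f := fun t => f t - s * t) (f' := fun t => derivWithin f (Icc 0 1) t - s)
      (C := L * |z - x| ^ (β - 1)) (s := uIcc x z)
      (fun t ht => by
        have := ((hasDerivWithinAt_of_holderClass h1 hβ2 hf (hsub ht)).mono hsub).sub
          ((hasDerivWithinAt_id t (uIcc x z)).const_mul s)
        simp only [mul_one] at this
        exact this)
      (fun t ht => by
        rw [Real.norm_eq_abs]
        refine (derivWithin_holder h1 hβ2 hf (hsub ht) hx).trans ?_
        have : |t - x| ≤ |z - x| := by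
          simpa [abs_sub_comm] using abs_sub_left_of_mem_uIcc ht
        gcongr)
      (convex_uIcc x z) left_mem_uIcc right_mem_uIcc
    have e2 : f z - (f x + s * (z - x)) = f z - s * z - (f x - s * x) := by ring
    rw [e2]
    refine key.trans (le_of_eq ?_)
    rw [Real.norm_eq_abs, mul_assoc]
    congr 1
    rcases (abs_nonneg (z - x)).eq_or_lt with h0 | h0
    · rw [← h0, Real.zero_rpow hβ.ne', mul_zero]
    · nth_rw 2 [← Real.rpow_one |z - x|]
      rw [← Real.rpow_add h0]; ring_nf

lemma design_mem {n : ℕ} {i : ℕ} (hi : i ≤ n) : design n i ∈ Icc (0 : ℝ) 1 := by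
  rw [design]
  exact ⟨by positivity, div_le_one_of_le₀ (by exact_mod_cast hi) (by positivity)⟩

section
variable {K : ℝ → ℝ} {Kmin Kmax Δ LK : ℝ} {lam : ℝ} {n : ℕ} {h : ℝ}

/-- The expectation of the estimator at `x` when the regression function is `f`. -/
noncomputable def lpeMean (K : ℝ → ℝ) (k n : ℕ) (h x : ℝ) (f : ℝ → ℝ) : ℝ :=
  ∑ l : Fin n, lpeWeight K k (scaled n h x) l * f (design n (l + 1))

/-- The bias is controlled since the estimator reproduces the Taylor polynomial. -/
lemma abs_lpeMean_sub_le {β L : ℝ} (hβ : 0 < β) (hβ2 : β ≤ 2) (hL : 0 < L)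
    (A : Admissible K (order β) lam n h) (hlam : 0 < lam)
    (hK : KernelAssumptions K Kmin Kmax Δ LK) {f : ℝ → ℝ} (hf : f ∈ holderClass β L)
    {x : ℝ} (hx : x ∈ Icc (0 : ℝ) 1) :
    |lpeMean K (order β) n h x f - f x| ≤ 2 * (Kmax / lam) * (L * h ^ β) := by
  have hh := A.pos
  obtain ⟨p, hp0, hp⟩ := exists_taylor_poly hβ hβ2 hL hf hx hh
  rw [← hp0, ← sum_lpeWeight_mul_poly (A.gain_pos hlam) (A.energy x hx) p, lpeMean,
    ← Finset.sum_sub_distrib]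
  refine (Finset.abs_sum_le_sum_abs _ _).trans ?_
  refine le_trans ?_ (mul_le_mul_of_nonneg_right (A.sum_abs_le hlam hK hx) (by positivity))
  rw [Finset.sum_mul]
  refine Finset.sum_le_sum fun l _ => ?_
  rw [← mul_sub, abs_mul]
  by_cases hl : 1 < |scaled n h x l|
  · simp [lpeWeight_eq_zero hK.support_subset hl]
  · have h1 : |design n (l + 1) - x| ≤ h := by
      simpa using (abs_scaled_le_iff hh l 1).1 (not_lt.1 hl)
    refine mul_le_mul_of_nonneg_left ?_ (abs_nonneg _)
    refine (hp _ (design_mem l.2)).trans ?_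
    gcongr

lemma KernelAssumptions.eq_zero_of_one_le (hK : KernelAssumptions K Kmin Kmax Δ LK) {u : ℝ}
    (hu : 1 ≤ |u|) : K u = 0 := by
  rcases hu.lt_or_eq with h | h
  · exact hK.support_subset u h
  -- by continuity the kernel vanishes at `±1` as well
  · by_contra hne
    have hpos : 0 < K u := (hK.nonneg u).lt_of_ne' hne
    have hLK := hK.LK_pos
    set t := K u / (2 * LK) with ht
    have ht0 : 0 < t := by positivity
    have h1 : K ((1 + t) * u) = 0 := hK.support_subset _ (by
      rw [abs_mul, ← h, mul_one, abs_of_pos (by linarith)]; linarith)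
    have h2 := hK.lipschitz u ((1 + t) * u)
    rw [h1, sub_zero, abs_of_pos hpos] at h2
    have h3 : |u - (1 + t) * u| = t := by
      have : u - (1 + t) * u = -(t * u) := by ring
      rw [this, abs_neg, abs_mul, ← h, mul_one, abs_of_pos ht0]
    rw [h3] at h2
    have h4 : LK * t = K u / 2 := by rw [ht]; field_simp
    linarith

/-- At a design point whose window lies inside the unit interval, kernel sums are sums over
all integer shifts. -/
lemma sum_kernel_design (hK : KernelAssumptions K Kmin Kmax Δ LK) (hh : 0 < h) {i : ℕ}
    (hn : 0 < n) (hi : design n i ∈ Icc h (1 - h)) (φ : ℤ → ℝ) :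
    ∑ l : Fin n, K (scaled n h (design n i) l) * φ ((l : ℤ) + 1)
      = ∑ m ∈ Finset.Icc (-n : ℤ) n, K (m / (n * h)) * φ (i + m) := by
  have hn' : (0 : ℝ) < n := by exact_mod_cast hn
  have hnh : (0 : ℝ) < n * h := mul_pos hn' hh
  have hi1 : n * h ≤ i := by
    have := hi.1; rw [design, le_div_iff₀ hn'] at this; linarith
  have hi2 : (i : ℝ) + n * h ≤ n := by
    have := hi.2; rw [design, div_le_iff₀ hn'] at this; linarith
  have hi3 : i ≤ n := by
    have : (i : ℝ) ≤ n := by linarith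
    exact_mod_cast this
  refine Finset.sum_bij_ne_zero (fun l _ _ => (l : ℤ) + 1 - i) ?_ ?_ ?_ ?_
  · intro l _ _
    have := l.2
    rw [Finset.mem_Icc]
    omega
  · intro a _ _ b _ _ hab
    ext
    omega
  · intro m _ hm
    have hKm : K (m / (n * h)) ≠ 0 := left_ne_zero_of_mul hm
    have hlt : |(m : ℝ) / (n * h)| < 1 := by
      by_contra! hge
      exact hKm (hK.eq_zero_of_one_le hge)
    rw [abs_div, abs_of_pos hnh, div_lt_one hnh, abs_lt] at hlt
    have h1 : (0 : ℤ) < i + m := by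
      have : (0 : ℝ) < i + m := by linarith
      exact_mod_cast this
    have h2 : (i : ℤ) + m < n := by
      have : (i : ℝ) + m < n := by linarith
      exact_mod_cast this
    have h3 : (((i + m - 1).toNat : ℕ) : ℤ) + 1 = i + m := by omega
    have h3' : (((i + m - 1).toNat : ℕ) : ℝ) + 1 = i + m := by exact_mod_cast h3
    refine ⟨⟨(i + m - 1).toNat, by omega⟩, Finset.mem_univ _, ?_, by simp only; omega⟩
    have e : scaled n h (design n i) ⟨(i + m - 1).toNat, by omega⟩ = m / (n * h) := by
      simp only [scaled, design]
      push_cast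
      rw [h3']
      field_simp
      ring
    rw [e]
    simp only [h3]
    exact hm
  · intro l _ _
    have e : scaled n h (design n i) l = (((l : ℤ) + 1 - i : ℤ) : ℝ) / (n * h) := by
      simp only [scaled, design]
      push_cast
      field_simp
    rw [e]
    congr 2
    ring

lemma sum_kernel_odd (hK : KernelAssumptions K Kmin Kmax Δ LK) (c : ℝ) :
    ∑ m ∈ Finset.Icc (-n : ℤ) n, K (m / c) * m = 0 := by
  have : ∑ m ∈ Finset.Icc (-n : ℤ) n, K (m / c) * m
      = ∑ m ∈ Finset.Icc (-n : ℤ) n, -(K (m / c) * m) := by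
    refine Finset.sum_nbij' (fun m => -m) (fun m => -m) ?_ ?_ ?_ ?_ ?_
    · intro m hm; rw [Finset.mem_Icc] at *; omega
    · intro m hm; rw [Finset.mem_Icc] at *; omega
    · intro m _; simp
    · intro m _; simp
    · intro m _
      push_cast
      rw [neg_div, hK.symm]
      ring
  rw [Finset.sum_neg_distrib] at this
  linarith

/-- Away from the boundary the estimator is, at design points, the Nadaraya-Watson estimator,
also when it is of order one, since the kernel is symmetric. -/
lemma lpeMean_interior {k : ℕ} (hk : k ≤ 1) (A : Admissible K k lam n h) (hlam : 0 < lam)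
    (hK : KernelAssumptions K Kmin Kmax Δ LK) {i : ℕ}
    (hi : design n i ∈ Icc h (1 - h)) (f : ℝ → ℝ) :
    lpeMean K k n h (design n i) f
      = (∑ m ∈ Finset.Icc (-n : ℤ) n, K (m / (n * h)) * f (((i : ℝ) + m) / n))
        / ∑ m ∈ Finset.Icc (-n : ℤ) n, K (m / (n * h)) := by
  have hh := A.pos
  have hn' := A.n_pos
  have hn : 0 < n := by exact_mod_cast hn'
  have hx : design n i ∈ Icc (0 : ℝ) 1 := ⟨hh.le.trans hi.1, hi.2.trans (by linarith)⟩
  set S := ∑ m ∈ Finset.Icc (-n : ℤ) n, K (m / (n * h)) with hS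
  have hS' : ∑ l : Fin n, K (scaled n h (design n i) l) = S := by
    simpa using sum_kernel_design hK hh hn hi (fun _ => 1)
  have hodd : ∑ l : Fin n, K (scaled n h (design n i) l) * scaled n h (design n i) l = 0 := by
    have h1 := sum_kernel_design hK hh hn hi (fun m => ((m : ℝ) - i) / (n * h))
    have h2 : ∑ m ∈ Finset.Icc (-n : ℤ) n, K (m / (n * h)) * ((((i + m : ℤ) : ℝ) - i) / (n * h))
        = 0 := by
      have := sum_kernel_odd (n := n) hK (n * h)
      calc _ = (∑ m ∈ Finset.Icc (-n : ℤ) n, K (m / (n * h)) * m) / (n * h) := by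
            rw [Finset.sum_div]
            refine Finset.sum_congr rfl fun m _ => ?_
            push_cast
            ring
        _ = 0 := by rw [this, zero_div]
    rw [h2] at h1
    rw [← h1]
    refine Finset.sum_congr rfl fun l _ => ?_
    congr 1
    simp only [scaled, design]
    push_cast
    field_simp
  have hg := A.gain_pos hlam
  have hSpos : 0 < S := by
    have := A.energy _ hx (U k 0)
    rw [U_zero_dotProduct_self, energy_U_zero, hS', mul_one] at this
    linarith
  have ha : IsRepresenter K k (scaled n h (design n i)) (S⁻¹ • U k 0) := by
    intro p
    rw [energy_smul_left, U_zero_dotProduct, energy]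
    simp only [U_zero_dotProduct]
    rw [inv_mul_eq_iff_eq_mul₀ hSpos.ne', ← hS']
    interval_cases k
    · simp [U, dotProduct, Finset.sum_mul]
    · have e : ∀ l : Fin n, K (scaled n h (design n i) l) * U 1 (scaled n h (design n i) l) 0
          * (p ⬝ᵥ U 1 (scaled n h (design n i) l))
          = K (scaled n h (design n i) l) * p 0
            + K (scaled n h (design n i) l) * scaled n h (design n i) l * p 1 := by
        intro l
        simp [dotProduct, U, Fin.sum_univ_succ]
        ring
      rw [Finset.sum_congr rfl fun l _ => e l, Finset.sum_add_distrib, ← Finset.sum_mul,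
        ← Finset.sum_mul, hodd]
      ring
  rw [lpeMean]
  have e : ∀ l : Fin n, lpeWeight K k (scaled n h (design n i)) l * f (design n (l + 1))
      = K (scaled n h (design n i) l) * (fun m : ℤ => f ((m : ℝ) / n)) ((l : ℤ) + 1) / S := by
    intro l
    rw [lpeWeight_eq hg (A.energy _ hx) ha, smul_dotProduct, U_zero_dotProduct]
    simp only [design, smul_eq_mul]
    push_cast
    simp [U]
    ring
  rw [Finset.sum_congr rfl fun l _ => e l, ← Finset.sum_div,
    sum_kernel_design hK hh hn hi (fun m : ℤ => f ((m : ℝ) / n))]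
  push_cast
  rfl

lemma lpeMean_interior_mono {k : ℕ} (hk : k ≤ 1) (A : Admissible K k lam n h) (hlam : 0 < lam)
    (hK : KernelAssumptions K Kmin Kmax Δ LK) {i j : ℕ} (hij : i ≤ j)
    (hi : design n i ∈ Icc h (1 - h)) (hj : design n j ∈ Icc h (1 - h)) {f : ℝ → ℝ}
    (hf : f ∈ monotoneClass) :
    lpeMean K k n h (design n i) f ≤ lpeMean K k n h (design n j) f := by
  rw [lpeMean_interior hk A hlam hK hi, lpeMean_interior hk A hlam hK hj]
  have hn' := A.n_pos
  have hnh : (0 : ℝ) < n * h := mul_pos hn' A.pos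
  refine div_le_div_of_nonneg_right (Finset.sum_le_sum fun m _ => ?_)
    (Finset.sum_nonneg fun m _ => hK.nonneg _)
  rcases le_or_gt 1 |(m : ℝ) / (n * h)| with hm | hm
  · rw [hK.eq_zero_of_one_le hm]; simp
  · rw [abs_div, abs_of_pos hnh, div_lt_one hnh, abs_lt] at hm
    have hmem : ∀ i : ℕ, design n i ∈ Icc h (1 - h) → ((i : ℝ) + m) / n ∈ Icc (0 : ℝ) 1 := by
      intro i hi
      have h1 := hi.1
      have h2 := hi.2
      rw [design, le_div_iff₀ hn'] at h1
      rw [design, div_le_iff₀ hn'] at h2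
      constructor
      · apply div_nonneg _ hn'.le; linarith
      · rw [div_le_one hn']; linarith
    refine mul_le_mul_of_nonneg_left (hf (hmem i hi) (hmem j hj) ?_) (hK.nonneg _)
    have : (i : ℝ) ≤ j := by exact_mod_cast hij
    gcongr

end

/-! ### Stochastic error -/

lemma hasSubgaussianMGF_gaussianReal (m : ℝ) (v : NNReal) :
    HasSubgaussianMGF (fun x => x - m) v (gaussianReal m v) where
  integrable_exp_mul t := by
    have := (integrable_exp_mul_gaussianReal (μ := m) (v := v) t).mul_const (Real.exp (-(t * m)))
    refine this.congr (Filter.Eventually.of_forall fun x => ?_)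
    simp only
    rw [← Real.exp_add]
    ring_nf
  mgf_le t := by
    have h : (gaussianReal m v).map (fun x => x - m) = gaussianReal 0 v := by
      rw [gaussianReal_map_sub_const, sub_self]
    rw [mgf_gaussianReal h t]
    simp

instance isProbabilityMeasure_dataLaw (f : ℝ → ℝ) (σ : ℝ) (n : ℕ) :
    IsProbabilityMeasure (dataLaw f σ n) := by
  unfold dataLaw; infer_instance

lemma hasSubgaussianMGF_mono {Ω : Type*} {mΩ : MeasurableSpace Ω} {μ : Measure Ω}
    {X : Ω → ℝ} {c c' : NNReal} (h : HasSubgaussianMGF X c μ) (hc : (c : ℝ) ≤ c') :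
    HasSubgaussianMGF X c' μ where
  integrable_exp_mul := h.integrable_exp_mul
  mgf_le t := (h.mgf_le t).trans (by gcongr)

/-- One-sided version of `dataLaw_tail_le`. -/
lemma dataLaw_tail_le_aux (f : ℝ → ℝ) {σ : ℝ} {n : ℕ} (c : Fin n → ℝ) {V t : ℝ}
    (hc : ∑ l, c l ^ 2 ≤ V) (ht : 0 ≤ t) :
    (dataLaw f σ n).real {y | t ≤ ∑ l, c l * (y l - f (design n (l + 1)))}
      ≤ Real.exp (-t ^ 2 / (2 * (σ ^ 2 * V))) := by
  have hind : iIndepFun (fun (l : Fin n) (y : Fin n → ℝ) =>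
      c l * (y l - f (design n (l + 1)))) (dataLaw f σ n) :=
    iIndepFun_pi (X := fun l x => c l * (x - f (design n (l + 1))))
      fun l => by fun_prop
  have hsub : ∀ l ∈ (Finset.univ : Finset (Fin n)), HasSubgaussianMGF
      (fun y : Fin n → ℝ => c l * (y l - f (design n (l + 1))))
      (Real.toNNReal (σ ^ 2 * c l ^ 2)) (dataLaw f σ n) := by
    intro l _
    have h1 : HasSubgaussianMGF (fun y : Fin n → ℝ => y l - f (design n (l + 1)))
        (Real.toNNReal (σ ^ 2)) (dataLaw f σ n) := by
      refine HasSubgaussianMGF.of_map (Y := fun y : Fin n → ℝ => y l)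
        (X := fun x => x - f (design n (l + 1))) (measurable_pi_apply l).aemeasurable ?_
      rw [dataLaw, (measurePreserving_eval _ l).map_eq]
      exact hasSubgaussianMGF_gaussianReal _ _
    refine hasSubgaussianMGF_mono (h1.const_mul (c l)) (le_of_eq ?_)
    rw [Real.coe_toNNReal _ (by positivity), mul_comm (σ ^ 2)]
    refine (NNReal.coe_mul _ _).trans ?_
    rw [Real.coe_toNNReal _ (sq_nonneg σ)]
    rfl
  have hV : 0 ≤ V := (Finset.sum_nonneg fun l _ => sq_nonneg (c l)).trans hc
  have h2 := hasSubgaussianMGF_mono (c' := Real.toNNReal (σ ^ 2 * V))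
    (HasSubgaussianMGF.sum_of_iIndepFun hind hsub) (by
      rw [NNReal.coe_sum, Real.coe_toNNReal _ (by positivity)]
      simp only [Real.coe_toNNReal _ (mul_nonneg (sq_nonneg σ) (sq_nonneg (c _)))]
      rw [← Finset.mul_sum]
      gcongr)
  have h3 := h2.measure_ge_le ht
  rwa [Real.coe_toNNReal _ (by positivity)] at h3

/-- Gaussian tail bound for linear functions of the errors. -/
lemma dataLaw_tail_le (f : ℝ → ℝ) {σ : ℝ} {n : ℕ} (c : Fin n → ℝ) {V t : ℝ}
    (hc : ∑ l, c l ^ 2 ≤ V) (ht : 0 ≤ t) :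
    dataLaw f σ n {y | t ≤ |∑ l, c l * (y l - f (design n (l + 1)))|}
      ≤ ENNReal.ofReal (2 * Real.exp (-t ^ 2 / (2 * (σ ^ 2 * V)))) := by
  have h1 := dataLaw_tail_le_aux (σ := σ) f c hc ht
  have h2 := dataLaw_tail_le_aux (σ := σ) f (fun l => -c l) (by simpa using hc) ht
  have hsub : {y : Fin n → ℝ | t ≤ |∑ l, c l * (y l - f (design n (l + 1)))|}
      ⊆ {y | t ≤ ∑ l, c l * (y l - f (design n (l + 1)))}
        ∪ {y | t ≤ ∑ l, -c l * (y l - f (design n (l + 1)))} := by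
    intro y hy
    rw [mem_ofPred_eq] at hy
    rcases le_abs.1 hy with h | h
    · exact Or.inl h
    · right
      simpa only [mem_ofPred_eq, neg_mul, Finset.sum_neg_distrib] using h
  rw [← ofReal_measureReal (measure_ne_top _ _)]
  refine ENNReal.ofReal_le_ofReal ?_
  refine (measureReal_mono hsub (measure_ne_top _ _)).trans ((measureReal_union_le _ _).trans ?_)
  linarith

/-- The deviation level, up to constants, of the difference of the stochastic errors at two
points at distance `d`. -/
noncomputable def noiseLevel (lam L2 : ℝ) (n : ℕ) (h d : ℝ) : ℝ :=
  √(Real.log n / (n * h)) * min (8 * L2 / lam * (d / h)) 1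

/-- The difference of the stochastic errors of the estimators at `x` and `x'`. -/
noncomputable def noiseDiff (K : ℝ → ℝ) (k : ℕ) {n : ℕ} (h x x' : ℝ) (f : ℝ → ℝ)
    (y : Fin n → ℝ) : ℝ :=
  ∑ l, (lpeWeight K k (scaled n h x) l - lpeWeight K k (scaled n h x') l)
    * (y l - f (design n (l + 1)))

/-- The data sets for which some single error is large, or some difference of stochastic errors
is large for an admissible bandwidth that is a multiple of `n⁻³`. -/
def largeNoise (K : ℝ → ℝ) (k : ℕ) (Kmax lam L2 σ : ℝ) (f : ℝ → ℝ) (n : ℕ) :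
    Set (Fin n → ℝ) :=
  {y | ∃ l, 4 * σ * √(Real.log n) ≤ |y l - f (design n (l + 1))|} ∪
  {y | ∃ q ≤ n ^ 3, Admissible K k lam n (q / n ^ 3) ∧ ∃ i ≤ n, ∃ j ≤ n, i ≠ j ∧
    8 * (Kmax / lam) * σ * noiseLevel lam L2 n (q / n ^ 3) |design n i - design n j|
      ≤ |noiseDiff K k (q / n ^ 3) (design n i) (design n j) f y|}

lemma noiseDiff_eq (K : ℝ → ℝ) (k : ℕ) {n : ℕ} (h x x' : ℝ) (f : ℝ → ℝ) (y : Fin n → ℝ) :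
    noiseDiff K k h x x' f y = (∑ l, lpeWeight K k (scaled n h x) l * y l
      - lpeMean K k n h x f) - (∑ l, lpeWeight K k (scaled n h x') l * y l
      - lpeMean K k n h x' f) := by
  simp only [noiseDiff, lpeMean, ← Finset.sum_sub_distrib]
  exact Finset.sum_congr rfl fun _ _ => by ring

lemma measurableSet_largeNoise (K : ℝ → ℝ) (k : ℕ) (Kmax lam L2 σ : ℝ) (f : ℝ → ℝ) (n : ℕ) :
    MeasurableSet (largeNoise K k Kmax lam L2 σ f n) := by
  refine MeasurableSet.union ?_ ?_
  · simp only [ofPred_exists]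
    exact MeasurableSet.iUnion fun l => measurableSet_le (by fun_prop) (by fun_prop)
  · simp only [ofPred_exists, ofPred_and]
    refine MeasurableSet.iUnion fun q => (MeasurableSet.const _).inter
      ((MeasurableSet.const _).inter (MeasurableSet.iUnion fun i => (MeasurableSet.const _).inter
        (MeasurableSet.iUnion fun j => (MeasurableSet.const _).inter
        ((MeasurableSet.const _).inter (measurableSet_le (by fun_prop) ?_)))))
    unfold noiseDiff
    fun_prop

lemma abs_design_sub {n : ℕ} (i j : ℕ) : |design n i - design n j| = |(i : ℝ) - j| / n := by
  rw [design, design, ← sub_div, abs_div, Nat.abs_cast]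

lemma one_div_le_abs_design_sub {n i j : ℕ} (hij : i ≠ j) :
    1 / (n : ℝ) ≤ |design n i - design n j| := by
  rw [abs_design_sub]
  gcongr
  have : (1 : ℤ) ≤ |(i : ℤ) - j| := Int.one_le_abs (sub_ne_zero.2 (by exact_mod_cast hij))
  exact_mod_cast this

lemma exp_neg_eight_log {n : ℕ} (hn : 0 < n) :
    Real.exp (-(8 * Real.log n)) = 1 / (n : ℝ) ^ 8 := by
  have hn' : (0 : ℝ) < n := by exact_mod_cast hn
  rw [Real.exp_neg, mul_comm, Real.exp_mul, Real.exp_log hn', one_div]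
  norm_cast

/-- The exceptional set of large noise has probability `O(1/n)`, uniformly in the regression
function: the critical values exceed the standard deviations by a factor that pays for a union
bound over all pairs of design points and a polynomial number of bandwidths. -/
lemma dataLaw_largeNoise_le {K : ℝ → ℝ} {Kmin Kmax Δ LK : ℝ} {k : ℕ} {lam : ℝ} {n : ℕ}
    (hn : 0 < n) (hlam : 0 < lam) (hk : k ≤ 1)
    (hK : KernelAssumptions K Kmin Kmax Δ LK) {L2 : ℝ} (hL2 : 2 * Kmax + LK ≤ L2) {σ : ℝ}
    (hσ : 0 < σ) (f : ℝ → ℝ) :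
    dataLaw f σ n (largeNoise K k Kmax lam L2 σ f n) ≤ ENNReal.ofReal (18 / n) := by
  classical
  have hn' : (0 : ℝ) < n := by exact_mod_cast hn
  have hn1 : (1 : ℝ) ≤ n := by exact_mod_cast hn
  have hlog : 0 ≤ Real.log n := Real.log_natCast_nonneg n
  have hKm : 0 ≤ Kmax := (hK.nonneg 0).trans (hK.upper 0)
  have hLK := hK.LK_pos
  have hL2pos : 0 < L2 := by linarith
  have hexp := exp_neg_eight_log hn
  -- every single event has probability at most `2 n⁻⁸`
  set b : ℝ≥0∞ := ENNReal.ofReal (2 * (1 / (n : ℝ) ^ 8)) with hb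
  have h1 : ∀ l : Fin n, dataLaw f σ n
      {y | 4 * σ * √(Real.log n) ≤ |y l - f (design n (l + 1))|} ≤ b := by
    intro l
    have := dataLaw_tail_le (σ := σ) f (n := n) (Pi.single l 1) (V := 1)
      (t := 4 * σ * √(Real.log n)) (by simp [Pi.single_apply]) (by positivity)
    have e : -(4 * σ * √(Real.log n)) ^ 2 / (2 * (σ ^ 2 * 1)) = -(8 * Real.log n) := by
      rw [mul_pow, Real.sq_sqrt hlog]; field_simp; ring
    rw [e, hexp] at this
    simpa [Pi.single_apply, -one_div, hb] using this
  have h2 : ∀ q : ℕ, Admissible K k lam n (q / n ^ 3) → ∀ i ≤ n, ∀ j ≤ n, i ≠ j →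
      dataLaw f σ n {y | 8 * (Kmax / lam) * σ
        * noiseLevel lam L2 n (q / n ^ 3) |design n i - design n j|
          ≤ |noiseDiff K k (q / n ^ 3) (design n i) (design n j) f y|} ≤ b := by
    intro q A i hi j hj hij
    set h : ℝ := q / n ^ 3
    set d := |design n i - design n j|
    have hh := A.pos
    have hd : 0 < d := lt_of_lt_of_le (by positivity) (one_div_le_abs_design_sub hij)
    have hρ := A.one_le_ratio hlam hK
    set m := min (8 * L2 / lam * (d / h)) 1 with hm
    have hm0 : 0 < m := lt_min (by positivity) one_pos
    have := dataLaw_tail_le (σ := σ) f _ (A.sum_sub_sq_le hlam hk hK hL2 (design_mem hi)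
      (design_mem hj)) (t := 8 * (Kmax / lam) * σ * noiseLevel lam L2 n h d)
      (by unfold noiseLevel; positivity)
    have e : -(8 * (Kmax / lam) * σ * noiseLevel lam L2 n h d) ^ 2
        / (2 * (σ ^ 2 * ((2 * (Kmax / lam) * m) ^ 2 / (n * h)))) = -(8 * Real.log n) := by
      rw [noiseLevel, ← hm, mul_pow, mul_pow _ m, Real.sq_sqrt (by positivity)]
      have : 0 < Kmax / lam := by linarith
      generalize Kmax / lam = ρ at *
      field_simp
      ring
    rw [e, hexp] at this
    exact this
  -- union bound over `n` errors and `(n³ + 1) (n + 1)²` differences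
  have hcover : largeNoise K k Kmax lam L2 σ f n ⊆
      (⋃ l ∈ (Finset.univ : Finset (Fin n)),
        {y | 4 * σ * √(Real.log n) ≤ |y l - f (design n (l + 1))|}) ∪
      (⋃ p ∈ ((Finset.range (n ^ 3 + 1) ×ˢ (Finset.range (n + 1) ×ˢ Finset.range (n + 1))).filter
        fun p : ℕ × ℕ × ℕ => Admissible K k lam n (p.1 / n ^ 3) ∧ p.2.1 ≠ p.2.2),
        {y | 8 * (Kmax / lam) * σ
          * noiseLevel lam L2 n (p.1 / n ^ 3) |design n p.2.1 - design n p.2.2|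
          ≤ |noiseDiff K k (p.1 / n ^ 3) (design n p.2.1) (design n p.2.2) f y|}) := by
    rintro y (⟨l, hl⟩ | ⟨q, hq, A, i, hi, j, hj, hij, hy⟩)
    · left
      simp only [mem_iUnion]
      exact ⟨l, Finset.mem_univ _, hl⟩
    · right
      simp only [mem_iUnion]
      refine ⟨(q, i, j), ?_, hy⟩
      simp only [Finset.mem_filter, Finset.mem_product, Finset.mem_range]
      exact ⟨⟨by omega, by omega, by omega⟩, A, hij⟩
  refine (measure_mono hcover).trans ((measure_union_le _ _).trans ?_)
  have e1 : dataLaw f σ n (⋃ l ∈ (Finset.univ : Finset (Fin n)),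
        {y | 4 * σ * √(Real.log n) ≤ |y l - f (design n (l + 1))|}) ≤ n * b := by
    refine (measure_biUnion_finset_le _ _).trans ((Finset.sum_le_sum fun l _ => h1 l).trans ?_)
    simp
  have e2 : dataLaw f σ n (⋃ p ∈ ((Finset.range (n ^ 3 + 1) ×ˢ
        (Finset.range (n + 1) ×ˢ Finset.range (n + 1))).filter
        fun p : ℕ × ℕ × ℕ => Admissible K k lam n (p.1 / n ^ 3) ∧ p.2.1 ≠ p.2.2),
        {y | 8 * (Kmax / lam) * σ
          * noiseLevel lam L2 n (p.1 / n ^ 3) |design n p.2.1 - design n p.2.2|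
          ≤ |noiseDiff K k (p.1 / n ^ 3) (design n p.2.1) (design n p.2.2) f y|})
      ≤ ((n ^ 3 + 1) * ((n + 1) * (n + 1)) : ℕ) * b := by
    refine (measure_biUnion_finset_le _ _).trans ?_
    refine (Finset.sum_le_card_nsmul _ _ b fun p hp => ?_).trans ?_
    · simp only [Finset.mem_filter, Finset.mem_product, Finset.mem_range] at hp
      exact h2 p.1 hp.2.1 _ (by omega) _ (by omega) hp.2.2
    · rw [nsmul_eq_mul]
      gcongr
      exact_mod_cast (Finset.card_filter_le _ _).trans (by simp)
  refine (add_le_add e1 e2).trans ?_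
  rw [← add_mul, ← Nat.cast_add, hb, ← ENNReal.ofReal_natCast, ← ENNReal.ofReal_mul (by positivity)]
  refine ENNReal.ofReal_le_ofReal ?_
  push_cast
  rw [le_div_iff₀ hn']
  have h3 : (n : ℝ) + ((n : ℝ) ^ 3 + 1) * ((n + 1) * (n + 1)) ≤ 9 * (n : ℝ) ^ 5 := by
    have a1 : (n : ℝ) ≤ n ^ 5 := le_self_pow₀ hn1 (by norm_num)
    have a2 : (1 : ℝ) ≤ n ^ 3 := one_le_pow₀ hn1
    calc (n : ℝ) + ((n : ℝ) ^ 3 + 1) * ((n + 1) * (n + 1))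
        ≤ n ^ 5 + (n ^ 3 + n ^ 3) * ((n + n) * (n + n)) := by gcongr
      _ = 9 * (n : ℝ) ^ 5 := by ring
  calc ((n : ℝ) + ((n : ℝ) ^ 3 + 1) * ((n + 1) * (n + 1))) * (2 * (1 / (n : ℝ) ^ 8)) * n
      ≤ 9 * (n : ℝ) ^ 5 * (2 * (1 / (n : ℝ) ^ 8)) * n := by gcongr
    _ = 18 * (1 / (n : ℝ) ^ 2) := by field_simp; ring
    _ ≤ 18 * 1 := by
        gcongr
        exact div_le_one_of_le₀ (one_le_pow₀ hn1) (by positivity)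
    _ = 18 := by norm_num

lemma abs_sum_mul_le_of_sq_le {n : ℕ} {w e : Fin n → ℝ} {V M : ℝ} (hV : 0 ≤ V) (hM : 0 ≤ M)
    (hw : ∑ l, w l ^ 2 ≤ V ^ 2) (he : ∀ l, |e l| ≤ M) :
    |∑ l, w l * e l| ≤ V * (√n * M) := by
  apply abs_le_of_sq_le_sq _ (by positivity)
  refine (Finset.sum_mul_sq_le_sq_mul_sq _ _ _).trans ?_
  rw [mul_pow, mul_pow, Real.sq_sqrt (by positivity)]
  have : ∑ l, e l ^ 2 ≤ n * M ^ 2 := by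
    refine (Finset.sum_le_card_nsmul _ _ (M ^ 2) fun l _ => ?_).trans (by simp)
    exact sq_le_sq' (abs_le.1 (he l)).1 (abs_le.1 (he l)).2
  exact mul_le_mul hw this (Finset.sum_nonneg fun _ _ => sq_nonneg _) (sq_nonneg _)

/-- Off the exceptional set, the stochastic errors are controlled for all bandwidths at once. -/
lemma abs_noiseDiff_le {K : ℝ → ℝ} {Kmin Kmax Δ LK : ℝ} {k : ℕ} {lam : ℝ} {n : ℕ}
    (hlam : 0 < lam) (hk : k ≤ 1)
    (hK : KernelAssumptions K Kmin Kmax Δ LK) {L2 : ℝ} (hL2 : 2 * Kmax + LK ≤ L2) {σ : ℝ}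
    (hσ : 0 < σ) {f : ℝ → ℝ} {y : Fin n → ℝ} (hy : y ∉ largeNoise K k Kmax lam L2 σ f n)
    {h : ℝ} (hA : ∀ h', h ≤ h' → h' ≤ h + 1 / n ^ 3 → Admissible K k lam n h')
    (hh1 : h + 1 / n ^ 3 ≤ 1) (hnL : 128 * (L2 / lam) ≤ n)
    {i j : ℕ} (hi : i ≤ n) (hj : j ≤ n) (hij : i ≠ j) :
    |noiseDiff K k h (design n i) (design n j) f y|
      ≤ 9 * (Kmax / lam) * σ * noiseLevel lam L2 n h |design n i - design n j| := by
  have A := hA h le_rfl (by simp)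
  have hn := A.n_pos
  have hn1 : (1 : ℝ) ≤ n := by
    have : 0 < n := by exact_mod_cast hn
    exact_mod_cast this
  have hh := A.pos
  have hlog : 0 ≤ Real.log n := Real.log_natCast_nonneg n
  have hKm : 0 ≤ Kmax := (hK.nonneg 0).trans (hK.upper 0)
  have hLK := hK.LK_pos
  have hL2pos : 0 < L2 := by linarith
  have hρ := A.one_le_ratio hlam hK
  simp only [largeNoise, mem_union, mem_ofPred_eq, not_or, not_exists, not_le, not_and] at hy
  obtain ⟨hy1, hy2⟩ := hy
  have hn3 : (0 : ℝ) < (n : ℝ) ^ 3 := by positivity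
  -- round the bandwidth up to the grid
  set q := ⌈h * n ^ 3⌉₊ with hq
  set h' : ℝ := q / n ^ 3 with hh'
  have hle : h ≤ h' := by rw [hh', le_div_iff₀ hn3]; exact Nat.le_ceil _
  have hle' : h' ≤ h + 1 / n ^ 3 := by
    rw [hh', div_le_iff₀ hn3, add_mul, one_div, inv_mul_cancel₀ hn3.ne']
    exact (Nat.ceil_lt_add_one (by positivity)).le
  have A' := hA h' hle hle'
  have hqn : q ≤ n ^ 3 := by
    have : h' ≤ 1 := hle'.trans hh1
    rw [hh', div_le_one hn3] at this
    exact_mod_cast this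
  have hgrid := hy2 q hqn A' i hi j hj hij
  set d := |design n i - design n j| with hd
  have hd1 : 1 / (n : ℝ) ≤ d := one_div_le_abs_design_sub hij
  have hd0 : 0 < d := lt_of_lt_of_le (by positivity) hd1
  have hlevel : noiseLevel lam L2 n h' d ≤ noiseLevel lam L2 n h d := by
    unfold noiseLevel
    gcongr
  have hτ : (n : ℝ) * (1 / n ^ 3) ≤ 1 := by
    rw [mul_one_div, div_le_one hn3]
    exact le_self_pow₀ hn1 (by norm_num)
  -- the effect of rounding the bandwidth at one point
  have hstep : ∀ x ∈ Icc (0 : ℝ) 1,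
      |∑ l, (lpeWeight K k (scaled n h x) l - lpeWeight K k (scaled n h' x) l)
        * (y l - f (design n (l + 1)))| ≤ (Kmax / lam) * σ / 2 * noiseLevel lam L2 n h d := by
    intro x hx
    have h1 := A.sum_sub_sq_le_of_bandwidth A' hle hle' hτ hlam hk hK hL2 hx
    rw [show (n : ℝ) * h = √(n * h) ^ 2 from (Real.sq_sqrt (by positivity)).symm,
      ← div_pow] at h1
    refine (abs_sum_mul_le_of_sq_le (by positivity) (by positivity) h1
      fun l => (hy1 l).le).trans ?_
    -- distinct design points are at distance at least `1 / n`
    have hm : 1 / (n * h) ≤ min (8 * L2 / lam * (d / h)) 1 := by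
      refine le_min ?_ ((div_le_one (by positivity)).2 (by linarith [A.large]))
      have h2 : 1 ≤ 8 * L2 / lam := by
        rw [le_div_iff₀ hlam]
        linarith [A.lam_le hK]
      calc 1 / (n * h) = 1 * ((1 / n) / h) := by field_simp
        _ ≤ _ := by gcongr
    have hsn : √(n : ℝ) ≤ n := by
      rw [Real.sqrt_le_left hn.le]; nlinarith
    have key : 128 * (L2 / lam) * (1 / n ^ 3) * √(n : ℝ) / h ≤ min (8 * L2 / lam * (d / h)) 1 := by
      refine le_trans ?_ hm
      calc 128 * (L2 / lam) * (1 / n ^ 3) * √(n : ℝ) / h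
          ≤ n * (1 / n ^ 3) * n / h := by gcongr
        _ = 1 / (n * h) := by field_simp
    rw [noiseLevel, Real.sqrt_div hlog]
    calc 2 * (Kmax / lam) * (8 * L2 / lam * (1 / n ^ 3 / h)) / √(n * h)
          * (√n * (4 * σ * √(Real.log n)))
        = Kmax / lam * σ / 2 * (√(Real.log n) / √(n * h)
          * (128 * (L2 / lam) * (1 / n ^ 3) * √(n : ℝ) / h)) := by ring
      _ ≤ _ := by gcongr
  have hi' := hstep _ (design_mem hi)
  have hj' := hstep _ (design_mem hj)
  have e : noiseDiff K k h (design n i) (design n j) f y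
      = noiseDiff K k h' (design n i) (design n j) f y
        + (∑ l, (lpeWeight K k (scaled n h (design n i)) l
            - lpeWeight K k (scaled n h' (design n i)) l) * (y l - f (design n (l + 1)))
          - ∑ l, (lpeWeight K k (scaled n h (design n j)) l
            - lpeWeight K k (scaled n h' (design n j)) l) * (y l - f (design n (l + 1)))) := by
    simp only [noiseDiff, ← Finset.sum_sub_distrib, ← Finset.sum_add_distrib]
    exact Finset.sum_congr rfl fun _ _ => by ring
  rw [e]
  have h8 : 8 * (Kmax / lam) * σ * noiseLevel lam L2 n h' d
      ≤ 8 * (Kmax / lam) * σ * noiseLevel lam L2 n h d := by gcongr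
  refine (abs_add_le _ _).trans ?_
  have h9 := abs_sub (∑ l, (lpeWeight K k (scaled n h (design n i)) l
            - lpeWeight K k (scaled n h' (design n i)) l) * (y l - f (design n (l + 1))))
    (∑ l, (lpeWeight K k (scaled n h (design n j)) l
            - lpeWeight K k (scaled n h' (design n j)) l) * (y l - f (design n (l + 1))))
  linarith

/-! ### The randomized search -/

/-- The probability that a randomized procedure does not reject. -/
noncomputable def acceptProb (p : PMF Bool) : ℝ := (p false).toReal

lemma acceptProb_nonneg (p : PMF Bool) : 0 ≤ acceptProb p := ENNReal.toReal_nonneg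

lemma acceptProb_le_one (p : PMF Bool) : acceptProb p ≤ 1 :=
  ENNReal.toReal_le_of_le_ofReal zero_le_one (by simpa using p.coe_le_one false)

lemma apply_true_eq (p : PMF Bool) : p true = ENNReal.ofReal (1 - acceptProb p) := by
  have h := p.tsum_coe
  rw [tsum_bool] at h
  rw [acceptProb, ENNReal.ofReal_sub _ ENNReal.toReal_nonneg,
    ENNReal.ofReal_toReal (p.apply_ne_top false), ENNReal.ofReal_one, ← h]
  exact (ENNReal.add_sub_cancel_left (p.apply_ne_top false)).symm

lemma acceptProb_orElse (p q : PMF Bool) :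
    acceptProb (orElse p q) = acceptProb p * acceptProb q := by
  rw [acceptProb, orElse, PMF.bind_apply, tsum_bool]
  simp [acceptProb, PMF.pure_apply]

lemma acceptProb_pure (b : Bool) : acceptProb (PMF.pure b) = if b then 0 else 1 := by
  cases b <;> simp [acceptProb, PMF.pure_apply]

lemma acceptProb_foldr (body : ℕ → PMF Bool) (l : List ℕ) :
    acceptProb (l.foldr (fun k rest => orElse (body k) rest) (PMF.pure false))
      = (l.map fun k => acceptProb (body k)).prod := by
  induction l with
  | nil => simp [acceptProb_pure]
  | cons a l ih => simp [acceptProb_orElse, ih]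

lemma acceptProb_runUntilReject (m : ℕ) (body : ℕ → PMF Bool) :
    acceptProb (runUntilReject m body) = ∏ k ∈ Finset.range m, acceptProb (body k) := by
  rw [runUntilReject, acceptProb_foldr]
  rfl

lemma acceptProb_runUntilReject_const (m : ℕ) (p : PMF Bool) :
    acceptProb (runUntilReject m fun _ => p) = acceptProb p ^ m := by
  simp [acceptProb_runUntilReject]

lemma acceptProb_runUntilReject_le (m : ℕ) (body : ℕ → PMF Bool) {k : ℕ} (hk : k < m) :
    acceptProb (runUntilReject m body) ≤ acceptProb (body k) := by
  rw [acceptProb_runUntilReject, ← Finset.mul_prod_erase _ _ (Finset.mem_range.2 hk)]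
  exact mul_le_of_le_one_right (acceptProb_nonneg _)
    (Finset.prod_le_one (fun _ _ => acceptProb_nonneg _) fun _ _ => acceptProb_le_one _)

lemma acceptProb_unif_bind {m : ℕ} (hm : 0 < m) (g : ℕ → PMF Bool) :
    acceptProb ((unif m).bind g) = (∑ J ∈ Finset.Icc 1 m, acceptProb (g J)) / m := by
  have H : (Finset.Icc 1 m).Nonempty := Finset.nonempty_Icc.2 hm
  rw [acceptProb, unif, dif_pos H, PMF.bind_apply, tsum_eq_sum (s := Finset.Icc 1 m),
    ENNReal.toReal_sum, Finset.sum_div]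
  · refine Finset.sum_congr rfl fun J hJ => ?_
    rw [PMF.uniformOfFinset_apply, if_pos hJ, ENNReal.toReal_mul, acceptProb]
    simp
    ring
  · intro J _
    exact ENNReal.mul_ne_top (PMF.apply_ne_top _ _) (PMF.apply_ne_top _ _)
  · intro J hJ
    rw [PMF.uniformOfFinset_apply, if_neg hJ, zero_mul]

lemma acceptProb_unif_map {m : ℕ} (hm : 0 < m) (g : ℕ → Bool) :
    acceptProb ((unif m).map g)
      = 1 - ((Finset.Icc 1 m).filter fun J => g J = true).card / m := by
  have hm' : (m : ℝ) ≠ 0 := by exact_mod_cast hm.ne'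
  have e : (unif m).map g = (unif m).bind fun J => PMF.pure (g J) := rfl
  rw [e, acceptProb_unif_bind hm, eq_sub_iff_add_eq, ← add_div, div_eq_one_iff_eq hm']
  have : ∀ J, acceptProb (PMF.pure (g J)) = 1 - if g J = true then 1 else 0 := by
    intro J
    rw [acceptProb_pure]
    split_ifs <;> simp
  simp [this, Finset.sum_sub_distrib]

/-- The search at scales `1, 2, 4, …` finds a rejecting partner among the next `m` indices with
probability at least `1/4` if at least half of them are rejecting. -/
lemma acceptProb_scales_le {m N : ℕ} (hm : 0 < m) (hmN : m ≤ N) (g : ℕ → Bool)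
    (hg : m ≤ 2 * ((Finset.Icc 1 m).filter fun J => g J = true).card) :
    acceptProb (runUntilReject (Nat.clog 2 N + 1) fun k => (unif (min (2 ^ k) N)).map g)
      ≤ 3 / 4 := by
  have hk : Nat.clog 2 m < Nat.clog 2 N + 1 := Nat.lt_succ_of_le (Nat.clog_mono_right 2 hmN)
  refine (acceptProb_runUntilReject_le _ _ hk).trans ?_
  -- at this scale the draw is uniform on `s` indices, `m ≤ s ≤ 2 m`
  set s := min (2 ^ Nat.clog 2 m) N with hs
  have h1 : m ≤ s := le_min (Nat.le_pow_clog one_lt_two m) hmN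
  have h2 : s ≤ 2 * m := by
    refine (min_le_left _ _).trans ?_
    rcases Nat.lt_or_ge 1 m with h | h
    · have h3 := Nat.pow_pred_clog_lt_self one_lt_two h
      have h4 : 0 < Nat.clog 2 m := Nat.clog_pos one_lt_two h
      have h5 : 2 ^ Nat.clog 2 m = 2 * 2 ^ (Nat.clog 2 m).pred := by
        rw [← pow_succ', ← Nat.succ_eq_add_one, Nat.succ_pred_eq_of_pos h4]
      omega
    · have : m = 1 := by omega
      subst this
      simp
  have hs0 : 0 < s := by omega
  rw [acceptProb_unif_map hs0]
  have h3 : ((Finset.Icc 1 m).filter fun J => g J = true).card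
      ≤ ((Finset.Icc 1 s).filter fun J => g J = true).card :=
    Finset.card_le_card (Finset.filter_subset_filter _ (Finset.Icc_subset_Icc_right h1))
  have h4 : s ≤ 4 * ((Finset.Icc 1 s).filter fun J => g J = true).card := by omega
  have hs' : (0 : ℝ) < s := by exact_mod_cast hs0
  have h5 : (s : ℝ) ≤ 4 * ((Finset.Icc 1 s).filter fun J => g J = true).card := by
    exact_mod_cast h4
  have h6 : (1 : ℝ) / 4 ≤ ((Finset.Icc 1 s).filter fun J => g J = true).card / s := by
    rw [div_le_div_iff₀ (by norm_num) hs']; linarith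
  linarith

/-- At least half of the `m` indices following `I` reject together with `I`. -/
def HeavyRight (n : ℕ) (test : ℕ → ℕ → Bool) (I : ℕ) : Prop :=
  ∃ m, 0 < m ∧ I + m ≤ n ∧
    m ≤ 2 * ((Finset.Icc 1 m).filter fun J => test I (I + J) = true).card

/-- At least half of the `m` indices preceding `I` reject together with `I`. -/
def HeavyLeft (test : ℕ → ℕ → Bool) (I : ℕ) : Prop :=
  ∃ m, 0 < m ∧ m + 1 ≤ I ∧
    m ≤ 2 * ((Finset.Icc 1 m).filter fun J => test (I - J) I = true).card

/-- The two searches of a round, to the right and to the left of the index `I`. -/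
noncomputable def roundAt (n : ℕ) (test : ℕ → ℕ → Bool) (I : ℕ) : PMF Bool :=
  orElse
    (if I + 1 ≤ n then
      runUntilReject ⌈20 * Real.log n⌉₊ fun _ =>
        runUntilReject (Nat.clog 2 (n - I) + 1) fun k =>
          (unif (min (2 ^ k) (n - I))).map fun J => test I (I + J)
    else PMF.pure false)
    (if 2 ≤ I then
      runUntilReject ⌈20 * Real.log n⌉₊ fun _ =>
        runUntilReject (Nat.clog 2 (I - 1) + 1) fun k =>
          (unif (min (2 ^ k) (I - 1))).map fun J => test (I - J) I
    else PMF.pure false)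

lemma search_eq (n reps : ℕ) (test : ℕ → ℕ → Bool) :
    search n reps test = runUntilReject reps fun _ => (unif n).bind (roundAt n test) := rfl

lemma acceptProb_roundAt_le {n : ℕ} {test : ℕ → ℕ → Bool} {I : ℕ}
    (h : HeavyRight n test I ∨ HeavyLeft test I) :
    acceptProb (roundAt n test I) ≤ (3 / 4) ^ ⌈20 * Real.log n⌉₊ := by
  rw [roundAt, acceptProb_orElse]
  rcases h with ⟨m, hm, hmn, hc⟩ | ⟨m, hm, hmn, hc⟩
  · refine (mul_le_of_le_one_right (acceptProb_nonneg _) (acceptProb_le_one _)).trans ?_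
    rw [if_pos (by omega), acceptProb_runUntilReject_const]
    exact pow_le_pow_left₀ (acceptProb_nonneg _)
      (acceptProb_scales_le hm (by omega) (fun J => test I (I + J)) hc) _
  · refine (mul_le_of_le_one_left (acceptProb_nonneg _) (acceptProb_le_one _)).trans ?_
    rw [if_pos (by omega), acceptProb_runUntilReject_const]
    exact pow_le_pow_left₀ (acceptProb_nonneg _)
      (acceptProb_scales_le hm (by omega) (fun J => test (I - J) I) hc) _

/-- If many indices are heavy, the search rarely fails. -/
lemma acceptProb_search_le_of_heavy {n reps : ℕ} (hn : 0 < n) {test : ℕ → ℕ → Bool}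
    {H : Finset ℕ} (hH : H ⊆ Finset.Icc 1 n)
    (hheavy : ∀ I ∈ H, HeavyRight n test I ∨ HeavyLeft test I) :
    acceptProb (search n reps test)
      ≤ (1 - H.card / n * (1 - (3 / 4) ^ ⌈20 * Real.log n⌉₊)) ^ reps := by
  rw [search_eq, acceptProb_runUntilReject_const]
  refine pow_le_pow_left₀ (acceptProb_nonneg _) ?_ _
  rw [acceptProb_unif_bind hn]
  have hn' : (0 : ℝ) < n := by exact_mod_cast hn
  set κ : ℝ := (3 / 4) ^ ⌈20 * Real.log n⌉₊
  have h1 : ∑ I ∈ Finset.Icc 1 n, acceptProb (roundAt n test I)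
      ≤ ∑ I ∈ Finset.Icc 1 n, (1 - if I ∈ H then 1 - κ else 0) := by
    refine Finset.sum_le_sum fun I _ => ?_
    split_ifs with h
    · simpa using acceptProb_roundAt_le (hheavy I h)
    · simpa using acceptProb_le_one _
  have h2 : ∑ I ∈ Finset.Icc 1 n, (1 - if I ∈ H then 1 - κ else 0) = n - H.card * (1 - κ) := by
    rw [Finset.sum_sub_distrib, Finset.sum_ite_mem, Finset.inter_eq_right.2 hH]
    simp [mul_sub]
  rw [h2] at h1
  calc _ ≤ (n - H.card * (1 - κ)) / n := by gcongr
    _ = _ := by field_simp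

/-- If `(i, j)` is rejected, and with every index between them one of `i` and `j` is rejected,
then `i` or `j` is heavy. -/
lemma heavy_of_between {n : ℕ} {test : ℕ → ℕ → Bool} {i j : ℕ} (hi : 1 ≤ i) (hij : i < j)
    (hj : j ≤ n) (h1 : test i j = true)
    (h2 : ∀ t, i < t → t < j → test i t = true ∨ test t j = true) :
    HeavyRight n test i ∨ HeavyLeft test j := by
  set m := j - i with hm
  set F := (Finset.Icc 1 m).filter fun J => test i (i + J) = true with hF
  set B := (Finset.Icc 1 m).filter fun J => test (j - J) j = true with hB
  -- `J` stands for the index `i + J`, seen from `j` as `j - (m - J)`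
  have hsub : Finset.Icc 1 m ⊆ F ∪ B.image fun J => m - J := by
    intro J hJ
    rw [Finset.mem_Icc] at hJ
    rw [Finset.mem_union, Finset.mem_image]
    by_cases hJm : J = m
    · left
      rw [hF, Finset.mem_filter, Finset.mem_Icc]
      refine ⟨hJ, ?_⟩
      rw [hJm, show i + m = j by omega]
      exact h1
    · rcases h2 (i + J) (by omega) (by omega) with h | h
      · left
        rw [hF, Finset.mem_filter, Finset.mem_Icc]
        exact ⟨hJ, h⟩
      · right
        refine ⟨m - J, ?_, by omega⟩
        rw [hB, Finset.mem_filter, Finset.mem_Icc]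
        refine ⟨by omega, ?_⟩
        rw [show j - (m - J) = i + J by omega]
        exact h
  have hcard : m ≤ F.card + B.card := by
    have := (Finset.card_le_card hsub).trans ((Finset.card_union_le _ _).trans
      (Nat.add_le_add_left Finset.card_image_le _))
    simpa using this
  rcases le_total F.card B.card with h | h
  · exact Or.inr ⟨m, by omega, by omega, (by omega : m ≤ 2 * B.card)⟩
  · exact Or.inl ⟨m, by omega, by omega, (by omega : m ≤ 2 * F.card)⟩

/-- `M` disjoint pairs, each with a heavy member, make the search successful. -/
lemma acceptProb_search_le {n reps : ℕ} {test : ℕ → ℕ → Bool} {i₀ j₀ M : ℕ} (hi₀ : 1 ≤ i₀)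
    (hj₀ : j₀ ≤ n) (hM : i₀ + 2 * M ≤ j₀ + 1)
    (hn : 0 < n)
    (h1 : ∀ s < M, test (i₀ + s) (j₀ - s) = true)
    (h2 : ∀ s < M, ∀ t, i₀ + s < t → t < j₀ - s →
      test (i₀ + s) t = true ∨ test t (j₀ - s) = true) :
    acceptProb (search n reps test)
      ≤ (1 - M / n * (1 - (3 / 4) ^ ⌈20 * Real.log n⌉₊)) ^ reps := by
  classical
  have hheavy : ∀ s < M, HeavyRight n test (i₀ + s) ∨ HeavyLeft test (j₀ - s) := fun s hs =>
    heavy_of_between (by omega) (by omega) (by omega) (h1 s hs) (h2 s hs)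
  -- the heavy member of each pair; the left and the right members are disjoint by `hM`
  set c : ℕ → ℕ := fun s => if HeavyRight n test (i₀ + s) then i₀ + s else j₀ - s with hc
  have hinj : Set.InjOn c (Finset.range M) := by
    intro s hs s' hs' h
    simp only [Finset.coe_range, mem_Iio] at hs hs'
    simp only [hc] at h
    split_ifs at h <;> omega
  have := acceptProb_search_le_of_heavy (reps := reps) hn (test := test)
    (H := (Finset.range M).image c)
    (by
      intro I hI
      obtain ⟨s, hs, rfl⟩ := Finset.mem_image.1 hI
      rw [Finset.mem_range] at hs
      rw [Finset.mem_Icc]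
      simp only [hc]
      split_ifs <;> omega)
    (by
      intro I hI
      obtain ⟨s, hs, rfl⟩ := Finset.mem_image.1 hI
      rw [Finset.mem_range] at hs
      simp only [hc]
      split_ifs with h
      · exact Or.inl h
      · exact Or.inr ((hheavy s hs).resolve_left h))
  rwa [Finset.card_image_of_injOn hinj, Finset.card_range] at this

/-- Without rejecting pairs the search accepts. -/
lemma search_eq_zero {n reps : ℕ} (hn : 0 < n) {test : ℕ → ℕ → Bool}
    (h : ∀ i j, 1 ≤ i → i < j → j ≤ n → test i j = false) :
    search n reps test true = 0 := by
  have hround : ∀ I ∈ Finset.Icc 1 n, acceptProb (roundAt n test I) = 1 := by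
    intro I hI
    rw [Finset.mem_Icc] at hI
    have hscale : ∀ (N : ℕ) (g : ℕ → Bool), 0 < N → (∀ J ∈ Finset.Icc 1 N, g J = false) →
        acceptProb (runUntilReject (Nat.clog 2 N + 1) fun k => (unif (min (2 ^ k) N)).map g)
          = 1 := by
      intro N g hN hg
      rw [acceptProb_runUntilReject]
      refine Finset.prod_eq_one fun k _ => ?_
      rw [acceptProb_unif_map (by positivity), Finset.filter_false_of_mem]
      · simp
      · intro J hJ
        rw [Finset.mem_Icc] at hJ
        rw [hg J (Finset.mem_Icc.2 ⟨hJ.1, hJ.2.trans (min_le_right _ _)⟩)]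
        simp
    rw [roundAt, acceptProb_orElse]
    have e1 : acceptProb (if I + 1 ≤ n then
        runUntilReject ⌈20 * Real.log n⌉₊ fun _ =>
          runUntilReject (Nat.clog 2 (n - I) + 1) fun k =>
            (unif (min (2 ^ k) (n - I))).map fun J => test I (I + J)
        else PMF.pure false) = 1 := by
      split_ifs with hI2
      · rw [acceptProb_runUntilReject_const, hscale _ _ (by omega), one_pow]
        intro J hJ
        rw [Finset.mem_Icc] at hJ
        exact h _ _ (by omega) (by omega) (by omega)
      · simp [acceptProb_pure]
    have e2 : acceptProb (if 2 ≤ I then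
        runUntilReject ⌈20 * Real.log n⌉₊ fun _ =>
          runUntilReject (Nat.clog 2 (I - 1) + 1) fun k =>
            (unif (min (2 ^ k) (I - 1))).map fun J => test (I - J) I
        else PMF.pure false) = 1 := by
      split_ifs with hI2
      · rw [acceptProb_runUntilReject_const, hscale _ _ (by omega), one_pow]
        intro J hJ
        rw [Finset.mem_Icc] at hJ
        exact h _ _ (by omega) (by omega) (by omega)
      · simp [acceptProb_pure]
    rw [e1, e2, one_mul]
  have hn' : (n : ℝ) ≠ 0 := by exact_mod_cast hn.ne'
  rw [apply_true_eq, search_eq, acceptProb_runUntilReject_const, acceptProb_unif_bind hn,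
    Finset.sum_congr rfl hround]
  simp [hn']

/-! ### Tuning constants -/

section Kernel
variable {K : ℝ → ℝ} {Kmin Kmax Δ LK : ℝ}

lemma KernelAssumptions.continuous (hK : KernelAssumptions K Kmin Kmax Δ LK) :
    Continuous K :=
  (LipschitzWith.of_dist_le_mul (K := Real.toNNReal LK) fun u v => by
    rw [Real.dist_eq, Real.dist_eq, Real.coe_toNNReal _ hK.LK_pos.le]
    exact hK.lipschitz u v).continuous

lemma KernelAssumptions.hasCompactSupport (hK : KernelAssumptions K Kmin Kmax Δ LK) :
    HasCompactSupport K :=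
  HasCompactSupport.intro (isCompact_Icc (a := (-1 : ℝ)) (b := 1)) fun u hu =>
    hK.support_subset u (by
      by_contra! h
      exact hu (abs_le.1 h))

lemma KernelAssumptions.integrable (hK : KernelAssumptions K Kmin Kmax Δ LK) :
    Integrable K := hK.continuous.integrable_of_hasCompactSupport hK.hasCompactSupport

lemma KernelAssumptions.integrable_sq (hK : KernelAssumptions K Kmin Kmax Δ LK) :
    Integrable fun u => K u ^ 2 := by
  refine (hK.continuous.pow 2).integrable_of_hasCompactSupport ?_
  refine HasCompactSupport.intro (isCompact_Icc (a := (-1 : ℝ)) (b := 1)) fun u hu => ?_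
  have : K u = 0 := hK.support_subset u (by
    by_contra! h
    exact hu (abs_le.1 h))
  simp [this]

lemma KernelAssumptions.integral_sq_pos (hK : KernelAssumptions K Kmin Kmax Δ LK) :
    0 < ∫ u, K u ^ 2 := by
  have h0 : 0 ≤ ∫ u, K u ^ 2 := integral_nonneg fun u => sq_nonneg _
  refine h0.lt_of_ne' fun h => ?_
  rw [integral_eq_zero_iff_of_nonneg (fun u => sq_nonneg _) hK.integrable_sq] at h
  have h1 : K =ᵐ[volume] 0 := h.mono fun u hu => by simpa using hu
  have h2 := hK.integral_eq_one
  rw [integral_congr_ae h1] at h2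
  simp at h2

lemma KernelAssumptions.integral_sq_le (hK : KernelAssumptions K Kmin Kmax Δ LK) :
    ∫ u, K u ^ 2 ≤ Kmax := by
  calc ∫ u, K u ^ 2 ≤ ∫ u, Kmax * K u :=
        integral_mono hK.integrable_sq (hK.integrable.const_mul _) fun u => by
          simp only [pow_two]
          exact mul_le_mul_of_nonneg_right (hK.upper u) (hK.nonneg u)
    _ = Kmax := by rw [integral_const_mul, hK.integral_eq_one, mul_one]

lemma KernelAssumptions.half_le_Kmax (hK : KernelAssumptions K Kmin Kmax Δ LK) :
    1 / 2 ≤ Kmax := by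
  have h1 : ∫ u, K u ≤ ∫ u, (Icc (-1 : ℝ) 1).indicator (fun _ => Kmax) u := by
    refine integral_mono hK.integrable
      ((integrable_indicator_iff measurableSet_Icc).2 (integrableOn_const (by simp))) fun u => ?_
    by_cases hu : u ∈ Icc (-1 : ℝ) 1
    · rw [indicator_of_mem hu]; exact hK.upper u
    · rw [indicator_of_notMem hu, hK.support_subset u (by
        by_contra! h
        exact hu (abs_le.1 h))]
  rw [hK.integral_eq_one, integral_indicator measurableSet_Icc, setIntegral_const] at h1
  simp [Measure.real] at h1
  norm_num at h1
  linarith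

end Kernel

/-- The standing assumptions on the quantities the procedure depends on. -/
structure Params.Valid (P : Params) (Kmin Δ : ℝ) : Prop where
  kernel : KernelAssumptions P.K Kmin P.Kmax Δ P.LK
  β_pos : 0 < P.β
  β_le : P.β ≤ 2
  L_pos : 0 < P.L
  lam_bound : IsEigenvalueBound P.K (order P.β) P.lam

namespace Params
variable {P : Params} {Kmin Δ : ℝ}

lemma Valid.lam_pos (V : P.Valid Kmin Δ) : 0 < P.lam := V.lam_bound.1

lemma Valid.Kmax_pos (V : P.Valid Kmin Δ) : 0 < P.Kmax := by
  linarith [V.kernel.half_le_Kmax]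

lemma Valid.one_le_ceil (V : P.Valid Kmin Δ) : (1 : ℝ) ≤ ⌈P.β⌉₊ := by
  exact_mod_cast Nat.ceil_pos.2 V.β_pos

lemma Valid.L₂_ge (V : P.Valid Kmin Δ) : 2 * P.Kmax + P.LK ≤ P.L₂ := by
  have := V.one_le_ceil
  have := V.Kmax_pos
  have := V.kernel.LK_pos
  rw [L₂]
  nlinarith

lemma Valid.L₂_pos (V : P.Valid Kmin Δ) : 0 < P.L₂ := by
  linarith [V.L₂_ge, V.Kmax_pos, V.kernel.LK_pos]

lemma Valid.W_ge (_V : P.Valid Kmin Δ) : 256 * (P.Kmax / P.lam) ^ 2 ≤ P.W := by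
  refine le_trans (le_of_eq ?_) (le_max_left _ _)
  rw [Cstar]; ring

lemma Valid.W_nonneg (V : P.Valid Kmin Δ) : 0 ≤ P.W := le_trans (by positivity) V.W_ge

/-- The factor of the noise variance in the bandwidth. -/
noncomputable def bandwidthFactor (P : Params) : ℝ := P.q₂ 1 / (4 * P.q₁ ^ 2 * P.β)

lemma q₂_eq (P : Params) (v : ℝ) : P.q₂ v = v * P.q₂ 1 := by
  simp only [q₂]; ring

lemma Valid.q₁_pos (V : P.Valid Kmin Δ) : 0 < P.q₁ := by
  have := V.Kmax_pos
  have := V.lam_pos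
  have := V.L_pos
  have : (0 : ℝ) < ((⌈P.β⌉₊ - 1).factorial : ℝ) := by exact_mod_cast Nat.factorial_pos _
  rw [q₁, Cstar]
  positivity

lemma Valid.bandwidthFactor_pos (V : P.Valid Kmin Δ) : 0 < P.bandwidthFactor := by
  have := V.q₁_pos
  have := V.lam_pos
  have := V.β_pos
  have := V.one_le_ceil
  have := V.kernel.integral_sq_pos
  rw [bandwidthFactor, q₂]
  positivity

lemma Ch_eq (P : Params) (v : ℝ) :
    P.Ch v = (v * P.bandwidthFactor) ^ (1 / (2 * P.β + 1)) := by
  rw [Ch, q₂_eq, bandwidthFactor, mul_div_assoc]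

lemma Valid.Ch_pos (V : P.Valid Kmin Δ) {v : ℝ} (hv : 0 < v) : 0 < P.Ch v := by
  have := V.bandwidthFactor_pos
  rw [Ch_eq]
  positivity

lemma Valid.Ch_pow (V : P.Valid Kmin Δ) {v : ℝ} (hv : 0 < v) :
    P.Ch v ^ (2 * P.β + 1) = v * P.bandwidthFactor := by
  have := V.bandwidthFactor_pos
  have := V.β_pos
  rw [Ch_eq, ← Real.rpow_mul (by positivity), one_div, inv_mul_cancel₀ (by positivity),
    Real.rpow_one]

lemma Valid.bandwidth_pos (V : P.Valid Kmin Δ) {v : ℝ} (hv : 0 < v) {n : ℕ} (hn : 1 < n) :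
    0 < P.bandwidth v n := by
  have h1 := V.Ch_pos hv
  have h2 : 0 < Real.log n := Real.log_pos (by exact_mod_cast hn)
  have h3 : (0 : ℝ) < n := by positivity
  rw [bandwidth]
  positivity

lemma Valid.bandwidth_pow (V : P.Valid Kmin Δ) {v : ℝ} (hv : 0 < v) (n : ℕ) :
    P.bandwidth v n ^ (2 * P.β + 1) = P.Ch v ^ (2 * P.β + 1) * (Real.log n / n) := by
  have := V.β_pos
  have hr : 0 ≤ Real.log n / n := div_nonneg (Real.log_natCast_nonneg n) (Nat.cast_nonneg n)
  rw [bandwidth, Real.mul_rpow (V.Ch_pos hv).le (by positivity), ← Real.rpow_mul hr, one_div,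
    inv_mul_cancel₀ (by positivity), Real.rpow_one]

lemma Valid.bandwidth_eq_mul (V : P.Valid Kmin Δ) {v s : ℝ} (hv : 0 < v) (hs : 0 < s) (n : ℕ) :
    P.bandwidth v n = (v / s) ^ (1 / (2 * P.β + 1)) * P.bandwidth s n := by
  have := V.bandwidthFactor_pos
  have e : v * P.bandwidthFactor = v / s * (s * P.bandwidthFactor) := by field_simp
  rw [bandwidth, bandwidth, Ch_eq, Ch_eq, e, Real.mul_rpow (by positivity) (by positivity),
    mul_assoc]

lemma rpow_mem_Icc_of_near {x e : ℝ} (h1 : 99 / 100 ≤ x) (h2 : x ≤ 101 / 100) (he : 0 ≤ e)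
    (he1 : e ≤ 1) : x ^ e ∈ Icc (99 / 100 : ℝ) (101 / 100) := by
  rcases le_total x 1 with hx | hx
  · have h3 : x ≤ x ^ e := by
      nth_rw 1 [← Real.rpow_one x]
      exact Real.rpow_le_rpow_of_exponent_ge (by linarith) hx he1
    have h4 : x ^ e ≤ 1 := Real.rpow_le_one (by linarith) hx he
    exact ⟨by linarith, by linarith⟩
  · have h3 : x ^ e ≤ x := by
      nth_rw 2 [← Real.rpow_one x]
      exact Real.rpow_le_rpow_of_exponent_le hx he1
    have h4 : 1 ≤ x ^ e := Real.one_le_rpow hx he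
    exact ⟨by linarith, by linarith⟩

/-- The estimated variance is within one percent of the true one. -/
def Near (v s : ℝ) : Prop := 99 / 100 * s ≤ v ∧ v ≤ 101 / 100 * s

lemma Near.pos {v s : ℝ} (h : Near v s) (hs : 0 < s) : 0 < v := lt_of_lt_of_le (by positivity) h.1

lemma Near.ratio {v s : ℝ} (h : Near v s) (hs : 0 < s) :
    99 / 100 ≤ v / s ∧ v / s ≤ 101 / 100 :=
  ⟨(le_div_iff₀ hs).2 h.1, (div_le_iff₀ hs).2 h.2⟩

lemma Valid.bandwidth_near (V : P.Valid Kmin Δ) {v s : ℝ} (hs : 0 < s) (h : Near v s) {n : ℕ}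
    (hn : 1 < n) : 99 / 100 * P.bandwidth s n ≤ P.bandwidth v n ∧
      P.bandwidth v n ≤ 101 / 100 * P.bandwidth s n := by
  have hβ := V.β_pos
  have hb := V.bandwidth_pos hs hn
  have := rpow_mem_Icc_of_near (h.ratio hs).1 (h.ratio hs).2
    (e := 1 / (2 * P.β + 1)) (by positivity) (by rw [div_le_one (by positivity)]; linarith)
  rw [V.bandwidth_eq_mul (h.pos hs) hs]
  exact ⟨mul_le_mul_of_nonneg_right this.1 hb.le, mul_le_mul_of_nonneg_right this.2 hb.le⟩

lemma Valid.bandwidth_rpow_near (V : P.Valid Kmin Δ) {v s : ℝ} (hs : 0 < s) (h : Near v s)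
    {n : ℕ} (hn : 1 < n) : P.bandwidth v n ^ P.β ≤ 101 / 100 * P.bandwidth s n ^ P.β := by
  have hβ := V.β_pos
  have hb := V.bandwidth_pos hs hn
  have hr : 0 ≤ v / s := le_trans (by norm_num) (h.ratio hs).1
  have := rpow_mem_Icc_of_near (h.ratio hs).1 (h.ratio hs).2
    (e := 1 / (2 * P.β + 1) * P.β) (by positivity) (by
      rw [one_div_mul_eq_div, div_le_one (by positivity)]; linarith)
  rw [V.bandwidth_eq_mul (h.pos hs) hs, Real.mul_rpow (by positivity) hb.le, ← Real.rpow_mul hr]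
  exact mul_le_mul_of_nonneg_right this.2 (by positivity)

/-- The size of the stochastic error, relative to the bias `h_n ^ β`, at noise variance `s`. -/
noncomputable def noiseConst (P : Params) (s : ℝ) : ℝ := √(s * P.W / P.Ch s ^ (2 * P.β + 1))

/-- The bandwidth balances the stochastic error and the bias. -/
lemma Valid.sqrt_W_mul (V : P.Valid Kmin Δ) {s : ℝ} (hs : 0 < s) {n : ℕ} (hn : 1 < n) :
    √(s * P.W * (Real.log n / (n * P.bandwidth s n)))
      = P.noiseConst s * P.bandwidth s n ^ P.β := by
  have hb := V.bandwidth_pos hs hn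
  have hc := V.Ch_pos hs
  have hn' : (0 : ℝ) < n := by positivity
  have hW := V.W_nonneg
  have h1 := V.bandwidth_pow hs n
  have hbpow : P.bandwidth s n ^ (2 * P.β + 1)
      = (P.bandwidth s n ^ P.β) ^ 2 * P.bandwidth s n := by
    rw [Real.rpow_add hb, Real.rpow_one, mul_comm (2 : ℝ), Real.rpow_mul hb.le]
    norm_cast
  have hcp : 0 < P.Ch s ^ (2 * P.β + 1) := by positivity
  rw [noiseConst, ← Real.sqrt_sq (show 0 ≤ P.bandwidth s n ^ P.β by positivity),
    ← Real.sqrt_mul (by positivity)]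
  congr 1
  rw [hbpow] at h1
  have h2 : Real.log n / n = (P.bandwidth s n ^ P.β) ^ 2 * P.bandwidth s n
      / P.Ch s ^ (2 * P.β + 1) := by
    rw [eq_div_iff hcp.ne', h1]; ring
  rw [← div_div, h2]
  field_simp

/-- For `β > 1` the constant `Cβ` contains `L` only with the factor `4`. The bias is dominated by
the stochastic part of `Cβ` instead, since the choice of the bandwidth constant ties the two
together. -/
lemma Valid.L_le_noiseConst (V : P.Valid Kmin Δ) (h1 : 1 < P.β) (hρ : 1 ≤ P.Kmax / P.lam)
    {s : ℝ} (hs : 0 < s) : P.L ≤ P.noiseConst s := by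
  have hK := V.Kmax_pos
  have hl := V.lam_pos
  have hL := V.L_pos
  have hW := V.W_ge
  have hI := V.kernel.integral_sq_pos
  have hI2 := V.kernel.integral_sq_le
  have hK2 := V.kernel.half_le_Kmax
  have hβ := V.β_pos
  rw [noiseConst, V.Ch_pow hs]
  apply Real.le_sqrt_of_sq_le
  have e : P.bandwidthFactor
      = (∫ u, P.K u ^ 2) / (8 * P.Kmax ^ 2 * P.L ^ 2 * P.β) := by
    rw [bandwidthFactor, q₂, q₁, Cstar, ceil_eq_two h1 V.β_le]
    simp
    field_simp
    ring
  rw [mul_div_mul_left _ _ hs.ne', e, div_div_eq_mul_div, le_div_iff₀ hI]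
  have h2 : 1 ≤ P.W := by nlinarith
  calc P.L ^ 2 * ∫ u, P.K u ^ 2 ≤ P.L ^ 2 * P.Kmax := by gcongr
    _ ≤ 1 * (8 * P.Kmax ^ 2 * P.L ^ 2 * 1) := by nlinarith [mul_pos hK (pow_pos hL 2)]
    _ ≤ _ := by gcongr

/-- The separation constant dominates the bias, the boundary correction and twice the
stochastic part of the critical value. -/
lemma Valid.Cβ_ge (V : P.Valid Kmin Δ) (hρ : 1 ≤ P.Kmax / P.lam) {s : ℝ} (hs : 0 < s) :
    101 / 100 * (20 * (P.Kmax / P.lam) * P.L) + 3 * P.noiseConst s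
      ≤ 11 / 8 * P.Cβ s := by
  have hL := V.L_pos
  have hl := V.lam_pos
  have hW := V.W_nonneg
  have hc := V.Ch_pos hs
  have hcp : 0 < P.Ch s ^ (2 * P.β + 1) := by positivity
  have hS0 : 0 ≤ P.noiseConst s := Real.sqrt_nonneg _
  have h4 : √s * √(4 * P.W / P.Ch s ^ (2 * P.β + 1)) = 2 * P.noiseConst s := by
    rw [noiseConst, ← Real.sqrt_mul hs.le, show (2 : ℝ) = √(2 ^ 2) by simp,
      ← Real.sqrt_mul (by positivity)]
    congr 1
    ring
  have h6 : 2 * P.noiseConst s ≤ √s * √(6 * P.W / P.Ch s ^ (2 * P.β + 1)) := by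
    rw [← h4]; gcongr; norm_num
  have hmax : 16 * (P.Kmax / P.lam) ≤ max (16 * P.Kmax / P.lam) 2 := by
    rw [← mul_div_assoc]; exact le_max_left _ _
  rw [Cβ]
  split_ifs with hβ
  · rw [mul_add √s, h4]
    nlinarith
  · push Not at hβ
    have h5 := V.L_le_noiseConst hβ hρ hs
    have h7 : 16 * P.L₂ * √s / P.lam * √(4 * P.W / P.Ch s ^ (2 * P.β + 1))
        = 32 * (P.L₂ / P.lam) * P.noiseConst s := by
      calc _ = 16 * (P.L₂ / P.lam) * (√s * √(4 * P.W / P.Ch s ^ (2 * P.β + 1))) := by ring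
        _ = _ := by rw [h4]; ring
    have h8 : 2 * (P.Kmax / P.lam) ≤ P.L₂ / P.lam := by
      rw [← mul_div_assoc]
      gcongr
      linarith [V.L₂_ge, V.kernel.LK_pos]
    rw [h7]
    have h9 : 2 * (P.Kmax / P.lam) * P.noiseConst s ≤ P.L₂ / P.lam * P.noiseConst s := by gcongr
    have h10 : (P.Kmax / P.lam) * P.L ≤ P.Kmax / P.lam * P.noiseConst s := by gcongr
    have h11 : P.noiseConst s ≤ P.Kmax / P.lam * P.noiseConst s :=
      le_mul_of_one_le_left hS0 hρ
    linarith

end Params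

namespace Params
variable {P : Params} {Kmin Δ : ℝ}

/-! ### The local tests on data without large noise -/

lemma stochCrit_eq (P : Params) {v α : ℝ} {n : ℕ} (hn : 0 < n) (hh : 0 < P.bandwidth v n)
    (i j : ℕ) :
    P.stochCrit v α n i j = √v * √(2 * Real.log (P.Nmax v α n / α) * P.W)
      * (√(1 / (n * P.bandwidth v n))
        * min (8 * P.L₂ / P.lam * (|design n i - design n j| / P.bandwidth v n)) 1) := by
  have hn' : (0 : ℝ) < n := by exact_mod_cast hn
  set h := P.bandwidth v n
  have e1 : -2 * Real.log (α / P.Nmax v α n) * P.W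
      = 2 * Real.log (P.Nmax v α n / α) * P.W := by
    rw [← inv_div (P.Nmax v α n) α, Real.log_inv]; ring
  have e2 : min (8 * P.L₂ / P.lam * |design n i - design n j|) h
      = h * min (8 * P.L₂ / P.lam * (|design n i - design n j| / h)) 1 := by
    rw [mul_min_of_nonneg _ _ hh.le, mul_one]
    congr 1
    field_simp
  have e3 : √(1 / (n * h)) = (n : ℝ) ^ (-(1 / 2) : ℝ) * (h ^ (-(3 / 2) : ℝ) * h) := by
    have : h ^ (-(3 / 2) : ℝ) * h = h ^ (-(1 / 2) : ℝ) := by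
      nth_rw 2 [← Real.rpow_one h]
      rw [← Real.rpow_add hh]; norm_num
    rw [this, Real.sqrt_eq_rpow, one_div, Real.inv_rpow (by positivity),
      Real.mul_rpow hn'.le hh.le, Real.rpow_neg hn'.le, Real.rpow_neg hh.le, mul_inv]
  rw [stochCrit, e1, e2, e3]
  ring

/-- The sample size and the estimated variance are in the range in which all the asymptotic
estimates hold. -/
structure Regular (P : Params) (s α : ℝ) (n : ℕ) (v : ℝ) : Prop where
  one_lt : 1 < n
  near : Near v s
  adm : ∀ h', P.bandwidth v n ≤ h' → h' ≤ P.bandwidth v n + 1 / n ^ 3 →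
    Admissible P.K (order P.β) P.lam n h'
  small : P.bandwidth v n + 1 / n ^ 3 ≤ 1
  large : 128 * (P.L₂ / P.lam) ≤ n
  log_ge : 1 / 5 * Real.log n ≤ Real.log (P.Nmax v α n / α)
  log_le : Real.log (P.Nmax v α n / α) ≤ Real.log n

lemma Regular.admissible {s α v : ℝ} {n : ℕ} (R : P.Regular s α n v) :
    Admissible P.K (order P.β) P.lam n (P.bandwidth v n) := R.adm _ le_rfl (by simp)

lemma Regular.log_pos {s α v : ℝ} {n : ℕ} (R : P.Regular s α n v) : 0 < Real.log n :=
  Real.log_pos (by exact_mod_cast R.one_lt)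

lemma Regular.one_le_ratio (V : P.Valid Kmin Δ) {s α v : ℝ} {n : ℕ} (R : P.Regular s α n v) :
    1 ≤ P.Kmax / P.lam := R.admissible.one_le_ratio V.lam_pos V.kernel

/-- The exceptional data sets for the procedure with parameters `P`. -/
def exceptional (P : Params) (σ : ℝ) (f : ℝ → ℝ) (n : ℕ) : Set (Fin n → ℝ) :=
  largeNoise P.K (order P.β) P.Kmax P.lam P.L₂ σ f n

/-- The stochastic part of the critical values dominates the stochastic error. -/
lemma Regular.abs_noiseDiff_lt (V : P.Valid Kmin Δ) {σ α v : ℝ} (hσ : 0 < σ) {n : ℕ}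
    (R : P.Regular (σ ^ 2) α n v) {f : ℝ → ℝ} {y : Fin n → ℝ}
    (hy : y ∉ P.exceptional σ f n) {i j : ℕ} (hi : i ≤ n) (hj : j ≤ n) (hij : i ≠ j) :
    |noiseDiff P.K (order P.β) (P.bandwidth v n) (design n i) (design n j) f y|
      < P.stochCrit v α n i j := by
  have A := R.admissible
  have hn := A.n_pos
  have hh := A.pos
  have hlog := R.log_pos
  have hρ := R.one_le_ratio V
  have hL2 := V.L₂_pos
  have hlam := V.lam_pos
  refine (abs_noiseDiff_le V.lam_pos (order_le_one V.β_le) V.kernel V.L₂_ge hσ hy R.adm R.small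
    R.large hi hj hij).trans_lt ?_
  rw [stochCrit_eq P (by exact_mod_cast hn) hh, noiseLevel, div_eq_mul_one_div (Real.log n),
    Real.sqrt_mul hlog.le]
  set d := |design n i - design n j|
  have hd : 0 < d := lt_of_lt_of_le (by positivity) (one_div_le_abs_design_sub hij)
  set B := √(1 / (n * P.bandwidth v n))
    * min (8 * P.L₂ / P.lam * (d / P.bandwidth v n)) 1 with hB
  have hBpos : 0 < B := mul_pos (by positivity) (lt_min (by positivity) one_pos)
  have h1 : 9 * (P.Kmax / P.lam) * σ * √(Real.log n)
      < √v * √(2 * Real.log (P.Nmax v α n / α) * P.W) := by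
    have hv := R.near.pos (pow_pos hσ 2)
    rw [← Real.sqrt_mul hv.le]
    refine Real.lt_sqrt_of_sq_lt ?_
    rw [mul_pow, Real.sq_sqrt hlog.le]
    have h2 := R.near.1
    have h3 := R.log_ge
    have h4 := V.W_ge
    have h5 : 0 < P.Kmax / P.lam := by linarith
    have h6 : 0 ≤ Real.log (P.Nmax v α n / α) := le_trans (by positivity) h3
    calc (9 * (P.Kmax / P.lam) * σ) ^ 2 * Real.log n
        = 81 * ((P.Kmax / P.lam) ^ 2 * σ ^ 2 * Real.log n) := by ring
      _ < 99 / 100 * (2 / 5) * 256 * ((P.Kmax / P.lam) ^ 2 * σ ^ 2 * Real.log n) := by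
          gcongr
          norm_num
      _ = 99 / 100 * σ ^ 2 * (2 * (1 / 5 * Real.log n) * (256 * (P.Kmax / P.lam) ^ 2)) := by
          ring
      _ ≤ v * (2 * Real.log (P.Nmax v α n / α) * P.W) := by
          gcongr
  calc 9 * (P.Kmax / P.lam) * σ * (√(Real.log n) * √(1 / (n * P.bandwidth v n))
        * min (8 * P.L₂ / P.lam * (d / P.bandwidth v n)) 1)
      = 9 * (P.Kmax / P.lam) * σ * √(Real.log n) * B := by rw [hB]; ring
    _ < _ := mul_lt_mul_of_pos_right h1 hBpos

/-- On the scale of the true bandwidth; `3/2` exceeds `√2` by enough to absorb the error of the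
variance estimate. -/
lemma Regular.stochCrit_le (V : P.Valid Kmin Δ) {s α v : ℝ} (hs : 0 < s) {n : ℕ}
    (R : P.Regular s α n v) (i j : ℕ) :
    P.stochCrit v α n i j ≤ 3 / 2 * P.noiseConst s * P.bandwidth s n ^ P.β := by
  have A := R.admissible
  have hn := A.n_pos
  have hh := A.pos
  have hlog := R.log_pos
  have hW := V.W_nonneg
  have hv := R.near.pos hs
  have hb := V.bandwidth_pos hs R.one_lt
  rw [stochCrit_eq P (by exact_mod_cast hn) hh]
  have h1 : √(1 / (n * P.bandwidth v n))
        * min (8 * P.L₂ / P.lam * (|design n i - design n j| / P.bandwidth v n)) 1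
      ≤ √(1 / (n * P.bandwidth v n)) :=
    mul_le_of_le_one_right (Real.sqrt_nonneg _) (min_le_right _ _)
  refine (mul_le_mul_of_nonneg_left h1 (by positivity)).trans ?_
  rw [mul_assoc (3 / 2 : ℝ), ← V.sqrt_W_mul hs R.one_lt,
    show (3 / 2 : ℝ) = √((3 / 2) ^ 2) from (Real.sqrt_sq (by norm_num)).symm,
    ← Real.sqrt_mul hv.le, ← Real.sqrt_mul' _ (show 0 ≤ 1 / (n * P.bandwidth v n) by positivity),
    ← Real.sqrt_mul (show (0 : ℝ) ≤ (3 / 2) ^ 2 by norm_num)]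
  apply Real.sqrt_le_sqrt
  have h2 := (V.bandwidth_near hs R.near R.one_lt).1
  have h3 := R.near.2
  have h4 := R.log_le
  have h5 : 0 ≤ Real.log (P.Nmax v α n / α) := le_trans (by positivity) R.log_ge
  calc v * (2 * Real.log (P.Nmax v α n / α) * P.W) * (1 / (n * P.bandwidth v n))
      ≤ 101 / 100 * s * (2 * Real.log n * P.W)
        * (1 / (n * (99 / 100 * P.bandwidth s n))) := by gcongr
    _ = 202 / 99 * (s * P.W * (Real.log n / (n * P.bandwidth s n))) := by
        field_simp; ring
    _ ≤ (3 / 2) ^ 2 * (s * P.W * (Real.log n / (n * P.bandwidth s n))) := by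
        gcongr
        norm_num

lemma Regular.lpe_sub_eq (V : P.Valid Kmin Δ) {s α v : ℝ} {n : ℕ}
    (R : P.Regular s α n v) (f : ℝ → ℝ) (y : Fin n → ℝ) {i j : ℕ} (hi : i ≤ n) (hj : j ≤ n) :
    lpe P.K (order P.β) n (P.bandwidth v n) (design n i) y
        - lpe P.K (order P.β) n (P.bandwidth v n) (design n j) y
      = lpeMean P.K (order P.β) n (P.bandwidth v n) (design n i) f
        - lpeMean P.K (order P.β) n (P.bandwidth v n) (design n j) f
        + noiseDiff P.K (order P.β) (P.bandwidth v n) (design n i) (design n j) f y := by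
  have A := R.admissible
  rw [lpe_eq_sum (A.gain_pos V.lam_pos) (A.energy _ (design_mem hi)),
    lpe_eq_sum (A.gain_pos V.lam_pos) (A.energy _ (design_mem hj)), noiseDiff_eq]
  ring

/-- For a monotone regression function no local test rejects, unless the data are
exceptional. -/
lemma Regular.localTest_eq_false (V : P.Valid Kmin Δ) {σ α v : ℝ} (hσ : 0 < σ) {n : ℕ}
    (R : P.Regular (σ ^ 2) α n v) {f : ℝ → ℝ} (hf : f ∈ holderClass P.β P.L)
    (hmono : f ∈ monotoneClass) {y : Fin n → ℝ}
    (hy : y ∉ P.exceptional σ f n) {i j : ℕ} (hij : i < j) (hj : j ≤ n) :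
    P.localTest v α n y i j = false := by
  have A := R.admissible
  have hh := A.pos
  have hi : i ≤ n := hij.le.trans hj
  have hnoise := R.abs_noiseDiff_lt V hσ hy hi hj hij.ne
  rw [localTest, decide_eq_false_iff_not, not_le, R.lpe_sub_eq V f y hi hj, critValue, add_comm]
  refine add_lt_add_of_lt_of_le ((le_abs_self _).trans_lt hnoise) ?_
  rw [detCrit]
  split_ifs with hint
  · exact sub_nonpos.2 (lpeMean_interior_mono (order_le_one V.β_le) A V.lam_pos V.kernel hij.le
      hint.1 hint.2 hmono)
  · have h1 := abs_lpeMean_sub_le V.β_pos V.β_le V.L_pos A V.lam_pos V.kernel hf (design_mem hi)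
    have h2 := abs_lpeMean_sub_le V.β_pos V.β_le V.L_pos A V.lam_pos V.kernel hf (design_mem hj)
    have h3 : f (design n i) ≤ f (design n j) :=
      hmono (design_mem hi) (design_mem hj) (by rw [design, design]; gcongr)
    have hL := V.L_pos
    have hρ := R.one_le_ratio V
    have h4 : 4 * (P.Kmax / P.lam) * (P.L * P.bandwidth v n ^ P.β)
        ≤ max (16 * P.Kmax / P.lam) 2 * P.L * P.bandwidth v n ^ P.β := by
      rw [mul_assoc (max _ _)]
      gcongr
      refine le_trans ?_ (le_max_left _ _)
      rw [mul_div_assoc]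
      linarith
    rw [abs_le] at h1 h2
    linarith [h1.2, h2.1]

/-- A local test rejects if the regression function decreases enough, unless the data are
exceptional. -/
lemma Regular.localTest_eq_true (V : P.Valid Kmin Δ) {σ α v : ℝ} (hσ : 0 < σ) {n : ℕ}
    (R : P.Regular (σ ^ 2) α n v) {f : ℝ → ℝ} (hf : f ∈ holderClass P.β P.L)
    {y : Fin n → ℝ}
    (hy : y ∉ P.exceptional σ f n) {i j : ℕ} (hij : i < j) (hj : j ≤ n)
    (hdrop : 11 / 8 * P.Cβ (σ ^ 2) * P.bandwidth (σ ^ 2) n ^ P.β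
      ≤ f (design n i) - f (design n j)) :
    P.localTest v α n y i j = true := by
  have A := R.admissible
  have hh := A.pos
  have hi : i ≤ n := hij.le.trans hj
  have hσ2 : 0 < σ ^ 2 := pow_pos hσ 2
  have hb := V.bandwidth_pos hσ2 R.one_lt
  have hL := V.L_pos
  have hρ := R.one_le_ratio V
  have hnoise := (abs_lt.1 (R.abs_noiseDiff_lt V hσ hy hi hj hij.ne)).1
  have hst := R.stochCrit_le V hσ2 i j
  have h1 := abs_lpeMean_sub_le V.β_pos V.β_le V.L_pos A V.lam_pos V.kernel hf (design_mem hi)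
  have h2 := abs_lpeMean_sub_le V.β_pos V.β_le V.L_pos A V.lam_pos V.kernel hf (design_mem hj)
  rw [abs_le] at h1 h2
  rw [localTest, decide_eq_true_eq, R.lpe_sub_eq V f y hi hj, critValue]
  have hdet : P.detCrit v n i j ≤ 16 * (P.Kmax / P.lam) * (P.L * P.bandwidth v n ^ P.β) := by
    rw [detCrit]
    split_ifs
    · positivity
    · rw [mul_assoc (max _ _), ← mul_div_assoc]
      gcongr
      refine max_le le_rfl ?_
      rw [mul_div_assoc]
      linarith
  have hbias : 20 * (P.Kmax / P.lam) * (P.L * P.bandwidth v n ^ P.β)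
      ≤ 101 / 100 * (20 * (P.Kmax / P.lam) * P.L) * P.bandwidth (σ ^ 2) n ^ P.β := by
    calc _ ≤ 20 * (P.Kmax / P.lam) * (P.L * (101 / 100 * P.bandwidth (σ ^ 2) n ^ P.β)) := by
          gcongr
          exact V.bandwidth_rpow_near hσ2 R.near R.one_lt
      _ = _ := by ring
  have hC := mul_le_mul_of_nonneg_right (V.Cβ_ge hρ hσ2)
    (show 0 ≤ P.bandwidth (σ ^ 2) n ^ P.β by positivity)
  rw [add_mul] at hC
  linarith [h1.1, h2.2]

end Params

namespace Params
variable {P : Params} {Kmin Δ : ℝ}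

/-! ### Alternatives -/

lemma Valid.four_L_le (V : P.Valid Kmin Δ) (s : ℝ) : 4 * P.L ≤ P.Cβ s := by
  have hL := V.L_pos
  have hl := V.lam_pos
  have h2 := V.L₂_pos
  rw [Cβ]
  split_ifs
  · have h1 : (2 : ℝ) ≤ max (16 * P.Kmax / P.lam) 2 := le_max_right _ _
    have h3 : 0 ≤ √s * (√(4 * P.W / P.Ch s ^ (2 * P.β + 1))
        + √(6 * P.W / P.Ch s ^ (2 * P.β + 1))) := by positivity
    nlinarith
  · have : 0 ≤ 16 * P.L₂ * √s / P.lam * √(4 * P.W / P.Ch s ^ (2 * P.β + 1)) := by positivity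
    linarith

/-- The separation expressed through the bandwidth. -/
lemma Valid.separation_eq (V : P.Valid Kmin Δ) {s : ℝ} (hs : 0 < s) (n : ℕ) :
    (3 * P.Cβ s + 2 * P.L) * P.Ch s ^ (P.β - (⌈P.β⌉₊ : ℝ) + 1) * P.rate n
      = (3 * P.Cβ s + 2 * P.L) * P.bandwidth s n ^ (P.β - (⌈P.β⌉₊ : ℝ) + 1) := by
  have hr : 0 ≤ Real.log n / n := div_nonneg (Real.log_natCast_nonneg n) (Nat.cast_nonneg n)
  rw [bandwidth, Real.mul_rpow (V.Ch_pos hs).le (by positivity), ← Real.rpow_mul hr, rate,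
    one_div_mul_eq_div]
  ring

/-- A function in the alternative decreases substantially between two windows whose length is
the bandwidth. -/
lemma Valid.exists_windows (V : P.Valid Kmin Δ) {s : ℝ} (hs : 0 < s) {n : ℕ} (hn : 1 < n)
    (hsmall : 3 * P.bandwidth s n ≤ 1 / 2) {f : ℝ → ℝ}
    (hf : f ∈ alternativeClass P.β P.L
      ((3 * P.Cβ s + 2 * P.L) * P.Ch s ^ (P.β - (⌈P.β⌉₊ : ℝ) + 1) * P.rate n)) :
    ∃ a b : ℝ, 0 ≤ a ∧ b ≤ 1 ∧ a + 2 * P.bandwidth s n ≤ b ∧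
      ∀ x ∈ Icc a (a + P.bandwidth s n), ∀ z ∈ Icc (b - P.bandwidth s n) b,
        11 / 4 * P.Cβ s * P.bandwidth s n ^ P.β ≤ f x - f z := by
  have hL := V.L_pos
  have hb := V.bandwidth_pos hs hn
  have hC := V.four_L_le s
  rw [V.separation_eq hs] at hf
  set h := P.bandwidth s n
  obtain ⟨hf1, hf2⟩ := hf
  split_ifs at hf2 with hβ
  · obtain ⟨a, b, ha, hab, hb1, hd⟩ := hf2
    rw [ceil_eq_one V.β_pos hβ] at hd
    simp only [Nat.cast_one, sub_add_cancel] at hd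
    have hpow : 0 < h ^ P.β := by positivity
    -- over a distance below `2 h` the function cannot decrease by `2 L h ^ β` or more
    have hsep : a + 2 * h ≤ b := by
      by_contra! hlt
      have h1 := holderClass_of_le_one hβ hf1 (x := a) (y := b) ⟨ha, by linarith⟩
        ⟨by linarith, hb1⟩
      have h2 : |a - b| ^ P.β ≤ 2 * h ^ P.β := by
        calc |a - b| ^ P.β ≤ (2 * h) ^ P.β := by
              apply Real.rpow_le_rpow (abs_nonneg _) _ V.β_pos.le
              rw [abs_sub_comm, abs_of_pos (by linarith)]
              linarith
          _ = 2 ^ P.β * h ^ P.β := Real.mul_rpow (by norm_num) hb.le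
          _ ≤ 2 ^ (1 : ℝ) * h ^ P.β := by gcongr; norm_num
          _ = 2 * h ^ P.β := by rw [Real.rpow_one]
      have h3 : f a - f b ≤ P.L * (2 * h ^ P.β) :=
        (le_abs_self _).trans (h1.trans (by gcongr))
      nlinarith
    refine ⟨a, b, ha, hb1, hsep, fun x hx z hz => ?_⟩
    have hnear : ∀ x y : ℝ, x ∈ Icc (0 : ℝ) 1 → y ∈ Icc (0 : ℝ) 1 → |x - y| ≤ h →
        |f x - f y| ≤ P.L * h ^ P.β := fun x y hx hy hxy =>
      (holderClass_of_le_one hβ hf1 hx hy).trans (by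
        have := Real.rpow_le_rpow (abs_nonneg _) hxy V.β_pos.le
        gcongr)
    have h1 := hnear x a ⟨by linarith [hx.1], by linarith [hx.2]⟩ ⟨ha, by linarith⟩
      (abs_le.2 ⟨by linarith [hx.1], by linarith [hx.2]⟩)
    have h2 := hnear z b ⟨by linarith [hz.1], by linarith [hz.2]⟩ ⟨by linarith, hb1⟩
      (abs_le.2 ⟨by linarith [hz.1], by linarith [hz.2]⟩)
    rw [abs_le] at h1 h2
    nlinarith [h1.1, h2.2]
  · push Not at hβ
    obtain ⟨x₀, hx₀, hd⟩ := hf2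
    rw [ceil_eq_two hβ V.β_le] at hd
    have e : P.β - ((2 : ℕ) : ℝ) + 1 = P.β - 1 := by push_cast; ring
    rw [e] at hd
    have hpow : 0 < h ^ (P.β - 1) := by positivity
    -- an interval of length `3 h` with end point `x₀` on which the slope stays negative
    obtain ⟨a, ha, ha1, ha2⟩ : ∃ a : ℝ, 0 ≤ a ∧ a + 3 * h ≤ 1 ∧
        ∀ t ∈ Icc a (a + 3 * h), |t - x₀| ≤ 3 * h := by
      rcases le_total x₀ (1 / 2) with hx | hx
      · exact ⟨x₀, hx₀.1, by linarith, fun t ht =>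
          abs_le.2 ⟨by linarith [ht.1], by linarith [ht.2]⟩⟩
      · exact ⟨x₀ - 3 * h, by linarith, by linarith [hx₀.2], fun t ht =>
          abs_le.2 ⟨by linarith [ht.1], by linarith [ht.2]⟩⟩
    refine ⟨a, a + 3 * h, ha, ha1, by linarith, fun x hx z hz => ?_⟩
    have hxz : h ≤ z - x := by linarith [hx.2, hz.1]
    have hsub : Icc x z ⊆ Icc (0 : ℝ) 1 := Icc_subset_Icc (by linarith [hx.1])
      (by linarith [hz.2])
    have hcont : ContinuousOn f (Icc 0 1) := hf1.1.continuousOn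
    have hderiv : ∀ t ∈ interior (Icc x z), HasDerivAt f (derivWithin f (Icc 0 1) t) t := by
      intro t ht
      have ht1 : t ∈ interior (Icc (0 : ℝ) 1) := interior_mono hsub ht
      exact (hasDerivWithinAt_of_holderClass hβ V.β_le hf1 (interior_subset ht1)).hasDerivAt
        (mem_interior_iff_mem_nhds.1 ht1)
    have key := Convex.image_sub_le_mul_sub_of_deriv_le (convex_Icc x z) (hcont.mono hsub)
      (fun t ht => (hderiv t ht).differentiableAt.differentiableWithinAt)
      (C := -((3 * P.Cβ s - P.L) * h ^ (P.β - 1))) (fun t ht => by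
        rw [(hderiv t ht).deriv]
        have ht' := interior_subset ht
        have h1 := derivWithin_holder hβ V.β_le hf1 (hsub ht') hx₀
        have h2 : |t - x₀| ^ (P.β - 1) ≤ 3 * h ^ (P.β - 1) := by
          calc |t - x₀| ^ (P.β - 1) ≤ (3 * h) ^ (P.β - 1) := by
                apply Real.rpow_le_rpow (abs_nonneg _) _ (by linarith)
                exact ha2 t ⟨by linarith [ht'.1, hx.1], by linarith [ht'.2, hz.2]⟩
            _ = 3 ^ (P.β - 1) * h ^ (P.β - 1) := Real.mul_rpow (by norm_num) hb.le
            _ ≤ 3 ^ (1 : ℝ) * h ^ (P.β - 1) := by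
                gcongr
                · norm_num
                · linarith [V.β_le]
            _ = 3 * h ^ (P.β - 1) := by rw [Real.rpow_one]
        have h3 := (le_abs_self _).trans (h1.trans (mul_le_mul_of_nonneg_left h2 hL.le))
        linarith)
      x ⟨le_rfl, by linarith⟩ z ⟨by linarith, le_rfl⟩ (by linarith)
    have e2 : h ^ P.β = h ^ (P.β - 1) * h := by
      nth_rw 3 [← Real.rpow_one h]
      rw [← Real.rpow_add hb]; ring_nf
    have h4 : 0 ≤ (3 * P.Cβ s - P.L) * h ^ (P.β - 1) := by
      apply mul_nonneg _ hpow.le; linarith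
    have h5 : (3 * P.Cβ s - P.L) * h ^ (P.β - 1) * h
        ≤ (3 * P.Cβ s - P.L) * h ^ (P.β - 1) * (z - x) := by gcongr
    have h6 : 11 / 4 * P.Cβ s * (h ^ (P.β - 1) * h)
        ≤ (3 * P.Cβ s - P.L) * (h ^ (P.β - 1) * h) := by
      gcongr; linarith
    rw [e2]
    linarith

/-- For a function in the alternative, about `n h` indices are heavy. -/
lemma Regular.acceptProb_fomt_le (V : P.Valid Kmin Δ) {σ α v : ℝ} (hσ : 0 < σ) {n : ℕ}
    (R : P.Regular (σ ^ 2) α n v) (hsmall : 3 * P.bandwidth (σ ^ 2) n ≤ 1 / 2) {f : ℝ → ℝ}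
    (hf : f ∈ alternativeClass P.β P.L ((3 * P.Cβ (σ ^ 2) + 2 * P.L)
      * P.Ch (σ ^ 2) ^ (P.β - (⌈P.β⌉₊ : ℝ) + 1) * P.rate n))
    {y : Fin n → ℝ} (hy : y ∉ P.exceptional σ f n) :
    acceptProb (P.fomt v α n y) ≤ (1 - (⌊n * P.bandwidth (σ ^ 2) n⌋₊ : ℝ) / n
      * (1 - (3 / 4) ^ ⌈20 * Real.log n⌉₊)) ^ ⌊P.Cn v α n⌋₊ := by
  have hσ2 : 0 < σ ^ 2 := pow_pos hσ 2
  obtain ⟨a, b, ha, hb1, hab, hdrop⟩ := V.exists_windows hσ2 R.one_lt hsmall hf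
  have hh := V.bandwidth_pos hσ2 R.one_lt
  have hC : 0 < P.Cβ (σ ^ 2) := by linarith [V.four_L_le (σ ^ 2), V.L_pos]
  have hn := R.admissible.n_pos
  set h := P.bandwidth (σ ^ 2) n
  set M := ⌊n * h⌋₊ with hM
  have hMle : (M : ℝ) ≤ n * h := Nat.floor_le (by positivity)
  have hna : (0 : ℝ) ≤ n * a := by positivity
  have hnb : (0 : ℝ) ≤ n * b := mul_nonneg hn.le (by linarith)
  have hi1 := Nat.lt_floor_add_one ((n : ℝ) * a)
  have hi2 := Nat.floor_le hna
  have hj1 := Nat.lt_floor_add_one ((n : ℝ) * b)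
  have hj2 := Nat.floor_le hnb
  have hnab : n * a + 2 * (n * h) ≤ n * b := by
    have := mul_le_mul_of_nonneg_left hab hn.le
    linarith
  -- the first design point right of `a` (index `0` is not a design point) and the last one left
  -- of `b`
  set i₀ := ⌊(n : ℝ) * a⌋₊ + 1 with hi₀
  set j₀ := ⌊(n : ℝ) * b⌋₊ with hj₀
  have hi₀' : (i₀ : ℝ) = ⌊(n : ℝ) * a⌋₊ + 1 := by rw [hi₀]; push_cast; rfl
  have hsum : i₀ + 2 * M ≤ j₀ + 1 := by
    have : ((i₀ + 2 * M : ℕ) : ℝ) < ((j₀ + 2 : ℕ) : ℝ) := by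
      push_cast
      linarith
    have := Nat.cast_lt.1 this
    omega
  have hj₀n : j₀ ≤ n := by
    have : (j₀ : ℝ) ≤ n := by nlinarith
    exact_mod_cast this
  have hleft : ∀ s < M, design n (i₀ + s) ∈ Icc a (a + h) := by
    intro s hs
    have hs' : (s : ℝ) + 1 ≤ M := by exact_mod_cast hs
    rw [design]
    push_cast
    constructor
    · rw [le_div_iff₀ hn]
      have : (0 : ℝ) ≤ s := Nat.cast_nonneg s
      linarith
    · rw [div_le_iff₀ hn]
      linarith
  have hright : ∀ s < M, design n (j₀ - s) ∈ Icc (b - h) b := by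
    intro s hs
    have hs' : (s : ℝ) + 1 ≤ M := by exact_mod_cast hs
    rw [design, Nat.cast_sub (by omega)]
    constructor
    · rw [le_div_iff₀ hn]
      linarith
    · rw [div_le_iff₀ hn]
      have : (0 : ℝ) ≤ s := Nat.cast_nonneg s
      linarith
  have hpos : 0 ≤ 11 / 8 * P.Cβ (σ ^ 2) * h ^ P.β := by positivity
  refine acceptProb_search_le (i₀ := i₀) (j₀ := j₀) (M := M) (by omega) hj₀n hsum
    (by exact_mod_cast hn) (fun s hs => ?_) (fun s hs t ht1 ht2 => ?_)
  · refine R.localTest_eq_true V hσ hf.1 hy (by omega) (by omega) ?_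
    have := hdrop _ (hleft s hs) _ (hright s hs)
    linarith
  · have := hdrop _ (hleft s hs) _ (hright s hs)
    rcases le_total (11 / 8 * P.Cβ (σ ^ 2) * h ^ P.β)
      (f (design n (i₀ + s)) - f (design n t)) with h1 | h1
    · exact Or.inl (R.localTest_eq_true V hσ hf.1 hy ht1 (by omega) h1)
    · exact Or.inr (R.localTest_eq_true V hσ hf.1 hy ht2 (by omega) (by linarith))

/-- The number of repetitions suffices to draw a heavy index with probability at least
`1 - α / 2`. -/
lemma Valid.accept_bound (V : P.Valid Kmin Δ) {s α v : ℝ} (hs : 0 < s) (hα : 0 < α)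
    (hα1 : α < 1) {n : ℕ} (hn : 1 < n) (hnear : Near v s)
    (h1 : P.bandwidth s n ≤ 1 / 100) (h2 : 100 ≤ n * P.bandwidth s n) {κ : ℝ}
    (hκ0 : 0 ≤ κ) (hκ : κ ≤ 1 / 100) :
    (1 - (⌊n * P.bandwidth s n⌋₊ : ℝ) / n * (1 - κ)) ^ ⌊P.Cn v α n⌋₊ ≤ α / 2 := by
  have hb := V.bandwidth_pos hs hn
  have hv := hnear.pos hs
  have hbv := V.bandwidth_pos hv hn
  have hn' : (0 : ℝ) < n := by positivity
  have hnb := V.bandwidth_near hs hnear hn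
  set h := P.bandwidth s n
  set M : ℝ := (⌊n * h⌋₊ : ℝ)
  have hM1 : M ≤ n * h := Nat.floor_le (by positivity)
  have hM2 : n * h < M + 1 := Nat.lt_floor_add_one _
  set p := M / n * (1 - κ) with hp
  have hp1 : p ≤ 1 := by
    have : M / n ≤ 1 := (div_le_one hn').2 (by nlinarith)
    have : 0 ≤ M / n := by positivity
    nlinarith
  have hp2 : 98 / 100 * h ≤ p := by
    have h3 : 99 / 100 * h ≤ M / n := by
      rw [le_div_iff₀ hn']; linarith
    calc 98 / 100 * h ≤ 99 / 100 * h * (99 / 100) := by linarith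
      _ ≤ M / n * (1 - κ) := by
        gcongr
        linarith
  set ℓ := Real.log (2 / α) with hℓ
  have hℓ1 : 69 / 100 ≤ ℓ := by
    have h3 : Real.log 2 ≤ ℓ := Real.log_le_log (by norm_num) (by
      rw [le_div_iff₀ hα]; linarith)
    linarith [Real.log_two_gt_d9]
  have hCn : P.Cn v α n = 2 * ℓ / P.bandwidth v n := by
    rw [Cn, hℓ, ← inv_div α 2, Real.log_inv]; ring
  have hCn2 : 2 * ℓ / (101 / 100 * h) ≤ P.Cn v α n := by
    rw [hCn]
    have : 0 ≤ 2 * ℓ := by linarith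
    gcongr
    exact hnb.2
  have hreps : 2 * ℓ / (101 / 100 * h) - 1 ≤ (⌊P.Cn v α n⌋₊ : ℝ) := by
    linarith [Nat.lt_floor_add_one (P.Cn v α n)]
  -- the factor `2` in the number of repetitions leaves room for all rounding errors
  have hmul : ℓ ≤ p * (⌊P.Cn v α n⌋₊ : ℝ) := by
    calc ℓ ≤ 196 / 101 * ℓ - 98 / 100 * h := by linarith
      _ = 98 / 100 * h * (2 * ℓ / (101 / 100 * h) - 1) := by field_simp; ring
      _ ≤ p * (2 * ℓ / (101 / 100 * h) - 1) := by
          refine mul_le_mul_of_nonneg_right hp2 ?_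
          rw [sub_nonneg, le_div_iff₀ (by positivity)]
          linarith
      _ ≤ p * (⌊P.Cn v α n⌋₊ : ℝ) := by
          refine mul_le_mul_of_nonneg_left hreps (le_trans (by positivity) hp2)
  calc (1 - p) ^ ⌊P.Cn v α n⌋₊ ≤ (Real.exp (-p)) ^ ⌊P.Cn v α n⌋₊ :=
        pow_le_pow_left₀ (by linarith) (Real.one_sub_le_exp_neg p) _
    _ = Real.exp (-(p * (⌊P.Cn v α n⌋₊ : ℝ))) := by
        rw [← Real.exp_nat_mul]; ring_nf
    _ ≤ Real.exp (-ℓ) := Real.exp_le_exp.2 (by linarith)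
    _ = α / 2 := by
        rw [Real.exp_neg, hℓ, Real.exp_log (by positivity), inv_div]

end Params

/-! ### Asymptotics -/

/-- The eigenvalue bound, assumed along bandwidth sequences, holds uniformly over all bandwidths
comparable with a given sequence. -/
lemma IsEigenvalueBound.eventually_admissible {K : ℝ → ℝ} {k : ℕ} {lam : ℝ}
    (hE : IsEigenvalueBound K k lam) {b : ℕ → ℝ} (hpos : ∀ᶠ n in atTop, 0 < b n)
    (hb0 : Tendsto b atTop (𝓝 0)) (hb1 : Tendsto (fun n : ℕ => (n : ℝ) * b n) atTop atTop) :
    ∀ᶠ n in atTop, ∀ h, b n / 2 ≤ h → h ≤ 2 * b n → Admissible K k lam n h := by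
  classical
  -- if the bound fails for some comparable bandwidth, select such a bandwidth
  let Bad : ℕ → ℝ → Prop := fun n h => b n / 2 ≤ h ∧ h ≤ 2 * b n ∧
    ¬ ∀ x ∈ Icc (0 : ℝ) 1, ∀ v : Fin (k + 1) → ℝ,
      lam * (v ⬝ᵥ v) ≤ v ⬝ᵥ (gram K k n h x).mulVec v
  let g : ℕ → ℝ := fun n => if 0 < b n then
    (if H : ∃ h, Bad n h then H.choose else b n) else 1
  have hg : ∀ n, 0 < b n → b n / 2 ≤ g n ∧ g n ≤ 2 * b n := by
    intro n hn
    simp only [g, if_pos hn]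
    split_ifs with H
    · exact ⟨H.choose_spec.1, H.choose_spec.2.1⟩
    · constructor <;> linarith
  have hgpos : ∀ n, 0 < g n := by
    intro n
    by_cases hn : 0 < b n
    · linarith [(hg n hn).1]
    · simp only [g, if_neg hn]; exact one_pos
  have hg0 : Tendsto g atTop (𝓝 0) := by
    refine tendsto_of_tendsto_of_tendsto_of_le_of_le' tendsto_const_nhds
      (by simpa using hb0.const_mul 2) (Eventually.of_forall fun n => (hgpos n).le) ?_
    filter_upwards [hpos] with n hn using (hg n hn).2
  have hg1 : Tendsto (fun n : ℕ => (n : ℝ) * g n) atTop atTop := by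
    refine tendsto_atTop_mono' _ ?_ (hb1.atTop_div_const (show (0 : ℝ) < 2 by norm_num))
    filter_upwards [hpos] with n hn
    have := mul_le_mul_of_nonneg_left (hg n hn).1 (Nat.cast_nonneg (α := ℝ) n)
    linarith
  obtain ⟨n₀, hn₀⟩ := hE.2 g hgpos hg0 hg1
  filter_upwards [hpos, eventually_ge_atTop n₀, hb1.eventually_ge_atTop 4] with n hn hn' hn4 h h1 h2
  have hh : 0 < h := by linarith
  have hlarge : 2 ≤ n * h := by
    have := mul_le_mul_of_nonneg_left h1 (Nat.cast_nonneg (α := ℝ) n)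
    linarith
  refine ⟨hh, hlarge, ?_⟩
  have hgood : ∀ x ∈ Icc (0 : ℝ) 1, ∀ v : Fin (k + 1) → ℝ,
      lam * (v ⬝ᵥ v) ≤ v ⬝ᵥ (gram K k n h x).mulVec v := by
    by_contra hbad
    have H : ∃ h, Bad n h := ⟨h, h1, h2, hbad⟩
    have hgn : g n = H.choose := by simp only [g, if_pos hn, dif_pos H]
    apply H.choose_spec.2.2
    rw [← hgn]
    exact hn₀ n hn'
  intro x hx p
  have h3 := hgood x hx p
  rw [dotProduct_gram_mulVec, le_inv_mul_iff₀ (by linarith)] at h3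
  linarith

namespace Params
variable {P : Params} {Kmin Δ : ℝ}

lemma tendsto_log_div_nat : Tendsto (fun n : ℕ => Real.log n / n) atTop (𝓝 0) := by
  have h := (Real.isLittleO_log_id_atTop.tendsto_div_nhds_zero).comp
    (tendsto_natCast_atTop_atTop (R := ℝ))
  exact h

lemma Valid.exponent_mem (V : P.Valid Kmin Δ) :
    1 / 5 ≤ 1 / (2 * P.β + 1) ∧ 1 / (2 * P.β + 1) < 1 := by
  have h1 := V.β_pos
  have h2 := V.β_le
  constructor
  · exact one_div_le_one_div_of_le (by linarith) (by linarith)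
  · rw [div_lt_one (by linarith)]; linarith

lemma Valid.tendsto_bandwidth (V : P.Valid Kmin Δ) (s : ℝ) :
    Tendsto (P.bandwidth s) atTop (𝓝 0) := by
  have he := V.exponent_mem.1
  have h := (tendsto_log_div_nat.rpow_const (p := 1 / (2 * P.β + 1))
    (Or.inr (by linarith))).const_mul (P.Ch s)
  rw [Real.zero_rpow (by linarith), mul_zero] at h
  exact h

lemma Valid.tendsto_mul_bandwidth (V : P.Valid Kmin Δ) {s : ℝ} (hs : 0 < s) :
    Tendsto (fun n : ℕ => (n : ℝ) * P.bandwidth s n) atTop atTop := by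
  have he := V.exponent_mem
  have hC := V.Ch_pos hs
  have h1 : Tendsto (fun n : ℕ => P.Ch s * (n : ℝ) ^ (1 - 1 / (2 * P.β + 1))) atTop atTop :=
    ((tendsto_rpow_atTop (by linarith)).comp tendsto_natCast_atTop_atTop).const_mul_atTop hC
  refine tendsto_atTop_mono' _ ?_ h1
  have hlog := (Real.tendsto_log_atTop.comp
    (tendsto_natCast_atTop_atTop (R := ℝ))).eventually_ge_atTop 1
  filter_upwards [hlog, eventually_gt_atTop 0] with n hn hn0
  have hn' : (0 : ℝ) < n := by exact_mod_cast hn0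
  have hn1 : 1 ≤ Real.log n := hn
  have h2 : (1 / (n : ℝ)) ^ (1 / (2 * P.β + 1)) ≤ (Real.log n / n) ^ (1 / (2 * P.β + 1)) := by
    gcongr
    linarith
  rw [Real.rpow_sub hn', Real.rpow_one, bandwidth]
  rw [one_div (n : ℝ), Real.inv_rpow hn'.le] at h2
  calc P.Ch s * (n / (n : ℝ) ^ (1 / (2 * P.β + 1)))
      = n * (P.Ch s * ((n : ℝ) ^ (1 / (2 * P.β + 1)))⁻¹) := by ring
    _ ≤ _ := by gcongr

/-- The number of local tests is between `n ^ (1/5)` and `n`, up to the factor `α`. -/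
lemma Valid.eventually_log_bounds (V : P.Valid Kmin Δ) {s α : ℝ} (hs : 0 < s) (hα : 0 < α)
    (hα1 : α < 1) : ∀ᶠ n : ℕ in atTop, ∀ v, Near v s →
      1 / 5 * Real.log n ≤ Real.log (P.Nmax v α n / α) ∧
      Real.log (P.Nmax v α n / α) ≤ Real.log n := by
  have he := V.exponent_mem
  have hC := V.Ch_pos hs
  set e := 1 / (2 * P.β + 1) with hedef
  set ℓ := Real.log (2 / α) with hℓ
  have hℓ0 : 0 < ℓ := Real.log_pos (by rw [lt_div_iff₀ hα]; linarith)
  have hlog2 : 0 < Real.log 2 := Real.log_pos (by norm_num)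
  -- the constant in front of `h_n⁻¹ log² n`
  set c := 80 / Real.log 2 * ℓ / α with hc
  have hc0 : 0 < c := by positivity
  have hlogt := Real.tendsto_log_atTop.comp (tendsto_natCast_atTop_atTop (R := ℝ))
  have hlo := hlogt.eventually_ge_atTop (max 1 (101 / 100 * P.Ch s / c))
  have hup : ∀ᶠ n : ℕ in atTop,
      Real.log n ^ (2 : ℝ) ≤ (99 / 100 * P.Ch s / c) * (n : ℝ) ^ (1 - e) := by
    have h := ((isLittleO_log_rpow_rpow_atTop (s := 1 - e) 2 (by linarith)).comp_tendsto
      (tendsto_natCast_atTop_atTop (R := ℝ))).bound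
      (show 0 < 99 / 100 * P.Ch s / c by positivity)
    filter_upwards [h] with n hn
    have h1 := (le_abs_self _).trans hn
    simp only [Function.comp, Real.norm_eq_abs] at h1
    rwa [abs_of_nonneg (by positivity)] at h1
  filter_upwards [hlo, hup, eventually_gt_atTop 1] with n hn1 hn2 hn v hv
  have hn' : (0 : ℝ) < n := by positivity
  have hL1 : 1 ≤ Real.log n := (le_max_left _ _).trans hn1
  have hL2 : 101 / 100 * P.Ch s / c ≤ Real.log n := (le_max_right _ _).trans hn1
  have hb := V.bandwidth_pos hs hn
  have hbv := V.bandwidth_pos (hv.pos hs) hn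
  have hnear := V.bandwidth_near hs hv hn
  have hN : P.Nmax v α n / α = c * Real.log n ^ 2 / P.bandwidth v n := by
    rw [Nmax, Cn, hc, hℓ, ← inv_div α 2, Real.log_inv]; ring
  have hbn : P.bandwidth s n = P.Ch s * ((Real.log n) ^ e / (n : ℝ) ^ e) := by
    rw [bandwidth, Real.div_rpow (by linarith) hn'.le]
  have hle1 : 1 ≤ Real.log n ^ e := Real.one_le_rpow hL1 (by linarith)
  have hle2 : Real.log n ^ e ≤ Real.log n := by
    nth_rw 2 [← Real.rpow_one (Real.log n)]
    exact Real.rpow_le_rpow_of_exponent_le hL1 he.2.le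
  have hne : 0 < (n : ℝ) ^ e := by positivity
  have hn1' : (1 : ℝ) ≤ n := by exact_mod_cast hn.le
  constructor
  · rw [← Real.log_rpow hn']
    refine Real.log_le_log (by positivity) ?_
    rw [hN, le_div_iff₀ hbv]
    rw [div_le_iff₀ hc0] at hL2
    calc (n : ℝ) ^ (1 / 5 : ℝ) * P.bandwidth v n
        ≤ (n : ℝ) ^ e * (101 / 100 * (P.Ch s * (Real.log n / (n : ℝ) ^ e))) := by
          gcongr
          · exact he.1
          · refine hnear.2.trans ?_
            rw [hbn]
            gcongr
      _ = 101 / 100 * P.Ch s * Real.log n := by field_simp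
      _ ≤ Real.log n * c * Real.log n := by gcongr
      _ = c * Real.log n ^ 2 := by ring
  · refine Real.log_le_log (by rw [hN]; positivity) ?_
    rw [hN, div_le_iff₀ hbv]
    rw [Real.rpow_two, div_mul_eq_mul_div, le_div_iff₀ hc0, Real.rpow_sub hn', Real.rpow_one]
      at hn2
    calc c * Real.log n ^ 2 ≤ 99 / 100 * P.Ch s * (n / (n : ℝ) ^ e) := by linarith
      _ = n * (99 / 100 * (P.Ch s * (1 / (n : ℝ) ^ e))) := by ring
      _ ≤ n * P.bandwidth v n := by
          gcongr
          refine le_trans ?_ hnear.1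
          rw [hbn]
          gcongr

/-- For large sample sizes everything is in the regular range, simultaneously for all values of
the variance estimate that are close to the true variance. -/
lemma Valid.eventually_regular (V : P.Valid Kmin Δ) {s α : ℝ} (hs : 0 < s) (hα : 0 < α)
    (hα1 : α < 1) : ∀ᶠ n : ℕ in atTop, (∀ v, Near v s → P.Regular s α n v) ∧
      P.bandwidth s n ≤ 1 / 100 ∧ 100 ≤ n * P.bandwidth s n := by
  have hpos : ∀ᶠ n : ℕ in atTop, 0 < P.bandwidth s n := by
    filter_upwards [eventually_gt_atTop 1] with n hn using V.bandwidth_pos hs hn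
  filter_upwards [hpos, V.lam_bound.eventually_admissible hpos (V.tendsto_bandwidth s)
    (V.tendsto_mul_bandwidth hs), V.eventually_log_bounds hs hα hα1,
    (V.tendsto_bandwidth s).eventually_le_const (show (0 : ℝ) < 1 / 100 by norm_num),
    (V.tendsto_mul_bandwidth hs).eventually_ge_atTop 100, eventually_gt_atTop 1,
    (tendsto_natCast_atTop_atTop (R := ℝ)).eventually_ge_atTop (128 * (P.L₂ / P.lam))]
    with n hb hadm hlog hb1 hb2 hn hlarge
  refine ⟨fun v hv => ?_, hb1, hb2⟩
  have hnear := V.bandwidth_near hs hv hn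
  have hn2 : (2 : ℝ) ≤ n := by exact_mod_cast hn
  have hn3 : 1 / (n : ℝ) ^ 3 ≤ P.bandwidth s n / 2 := by
    rw [div_le_iff₀ (by positivity)]
    have h3 : (1 : ℝ) ≤ n ^ 2 := one_le_pow₀ (by linarith)
    have h4 : (n : ℝ) ^ 3 = n * n ^ 2 := by ring
    rw [h4]
    nlinarith
  exact
    { one_lt := hn
      near := hv
      adm := fun h' h1 h2 => hadm h' (by linarith) (by linarith)
      small := by linarith
      large := hlarge
      log_ge := (hlog v hv).1
      log_le := (hlog v hv).2 }

/-- A heavy index is missed with small probability. -/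
lemma eventually_rounds_small :
    ∀ᶠ n : ℕ in atTop, ((3 / 4 : ℝ)) ^ ⌈20 * Real.log n⌉₊ ≤ 1 / 100 := by
  have h1 : Tendsto (fun n : ℕ => ⌈20 * Real.log n⌉₊) atTop atTop :=
    tendsto_nat_ceil_atTop.comp ((Real.tendsto_log_atTop.comp
      (tendsto_natCast_atTop_atTop (R := ℝ))).const_mul_atTop (by norm_num))
  exact ((tendsto_pow_atTop_nhds_zero_of_lt_one (by norm_num) (by norm_num)).comp
    h1).eventually_le_const (by norm_num)

end Params

/-! ### The rejection probability -/

namespace Params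
variable {P : Params} {Kmin Δ : ℝ}

/-- The data sets on which the variance estimate is inaccurate or the noise is large. -/
def badData (P : Params) (v : (n : ℕ) → (Fin n → ℝ) → ℝ) (σ : ℝ) (f : ℝ → ℝ) (n : ℕ) :
    Set (Fin n → ℝ) :=
  {y | 1 / 100 ≤ |v n y / σ ^ 2 - 1|} ∪ P.exceptional σ f n

lemma near_of_notMem {v : (n : ℕ) → (Fin n → ℝ) → ℝ} {σ : ℝ} (hσ : 0 < σ) {f : ℝ → ℝ} {n : ℕ}
    {y : Fin n → ℝ} (hy : y ∉ P.badData v σ f n) : Near (v n y) (σ ^ 2) := by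
  have h1 : ¬ 1 / 100 ≤ |v n y / σ ^ 2 - 1| := fun h => hy (Or.inl h)
  rw [not_le, abs_lt] at h1
  have hσ2 : 0 < σ ^ 2 := pow_pos hσ 2
  constructor
  · rw [← le_div_iff₀ hσ2]; linarith [h1.1]
  · rw [← div_le_iff₀ hσ2]; linarith [h1.2]

lemma measurableSet_badData {v : (n : ℕ) → (Fin n → ℝ) → ℝ} (hv : ∀ n, Measurable (v n))
    (σ : ℝ) (f : ℝ → ℝ) (n : ℕ) : MeasurableSet (P.badData v σ f n) := by
  refine MeasurableSet.union ?_ (measurableSet_largeNoise _ _ _ _ _ _ _ _)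
  have := hv n
  exact measurableSet_le measurable_const (by fun_prop)

lemma Valid.dataLaw_badData_le (V : P.Valid Kmin Δ) {v : (n : ℕ) → (Fin n → ℝ) → ℝ} {σ : ℝ}
    (hσ : 0 < σ) {F : Set (ℝ → ℝ)} {f : ℝ → ℝ} (hf : f ∈ F) {n : ℕ} (hn : 0 < n) :
    dataLaw f σ n (P.badData v σ f n)
      ≤ (⨆ f ∈ F, dataLaw f σ n {y | 1 / 100 ≤ |v n y / σ ^ 2 - 1|})
        + ENNReal.ofReal (18 / n) := by
  refine (measure_union_le _ _).trans (add_le_add ?_ ?_)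
  · exact le_iSup₂ (f := fun f (_ : f ∈ F) =>
      dataLaw f σ n {y | 1 / 100 ≤ |v n y / σ ^ 2 - 1|}) f hf
  · exact dataLaw_largeNoise_le hn V.lam_pos (order_le_one V.β_le) V.kernel V.L₂_ge hσ f

lemma Valid.rejectProb_le (V : P.Valid Kmin Δ) {v : (n : ℕ) → (Fin n → ℝ) → ℝ} {σ α : ℝ}
    (hσ : 0 < σ) {n : ℕ} (hn : 0 < n) (hR : ∀ w, Near w (σ ^ 2) → P.Regular (σ ^ 2) α n w)
    {f : ℝ → ℝ} (hf : f ∈ holderClass P.β P.L) (hmono : f ∈ monotoneClass) :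
    P.rejectProb v α σ n f ≤ dataLaw f σ n (P.badData v σ f n) := by
  have h1 : ∀ y, P.fomt (v n y) α n y true
      ≤ (P.badData v σ f n).indicator (1 : (Fin n → ℝ) → ℝ≥0∞) y := by
    intro y
    by_cases hy : y ∈ P.badData v σ f n
    · rw [indicator_of_mem hy]; exact PMF.coe_le_one _ _
    · have R := hR _ (near_of_notMem hσ hy)
      have hy' : y ∉ P.exceptional σ f n := fun h => hy (Or.inr h)
      rw [fomt, search_eq_zero hn fun i j _ hij hj =>
        R.localTest_eq_false V hσ hf hmono hy' hij hj]
      exact zero_le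
  exact (lintegral_mono h1).trans (lintegral_indicator_one_le _)

lemma Valid.le_rejectProb (V : P.Valid Kmin Δ) {v : (n : ℕ) → (Fin n → ℝ) → ℝ}
    (hv : ∀ n, Measurable (v n)) {σ α : ℝ}
    (hσ : 0 < σ) (hα : 0 < α) (hα1 : α < 1) {n : ℕ} (hn : 1 < n)
    (hR : ∀ w, Near w (σ ^ 2) → P.Regular (σ ^ 2) α n w)
    (hb1 : P.bandwidth (σ ^ 2) n ≤ 1 / 100) (hb2 : 100 ≤ n * P.bandwidth (σ ^ 2) n)
    (hκ : ((3 / 4 : ℝ)) ^ ⌈20 * Real.log n⌉₊ ≤ 1 / 100) {f : ℝ → ℝ}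
    (hf : f ∈ alternativeClass P.β P.L ((3 * P.Cβ (σ ^ 2) + 2 * P.L)
      * P.Ch (σ ^ 2) ^ (P.β - (⌈P.β⌉₊ : ℝ) + 1) * P.rate n)) :
    ENNReal.ofReal (1 - α / 2) * (1 - dataLaw f σ n (P.badData v σ f n))
      ≤ P.rejectProb v α σ n f := by
  have hmeas : MeasurableSet (P.badData v σ f n)ᶜ := (measurableSet_badData hv σ f n).compl
  rw [← prob_compl_eq_one_sub (measurableSet_badData hv σ f n),
    ← lintegral_indicator_const hmeas]
  refine lintegral_mono fun y => ?_
  by_cases hy : y ∈ P.badData v σ f n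
  · rw [indicator_of_notMem (by simpa using hy)]; exact zero_le
  · rw [indicator_of_mem (by simpa using hy), apply_true_eq]
    have hnear := near_of_notMem hσ hy
    have hy' : y ∉ P.exceptional σ f n := fun h => hy (Or.inr h)
    refine ENNReal.ofReal_le_ofReal (sub_le_sub_left ?_ 1)
    exact ((hR _ hnear).acceptProb_fomt_le V hσ (by linarith) hf hy').trans
      (V.accept_bound (pow_pos hσ 2) hα hα1 hn hnear hb1 hb2 (by positivity) hκ)

end Params

end Fomt

theorem mainTheorem3
    (K : ℝ → ℝ) (Kmin Kmax Δ LK : ℝ) (hK : Fomt.KernelAssumptions K Kmin Kmax Δ LK)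
    (β L : ℝ) (hβ : 0 < β) (hβ2 : β ≤ 2) (hL : 0 < L)
    (lam : ℝ) (hlam : Fomt.IsEigenvalueBound K (Fomt.order β) lam)
    (σ : ℝ) (hσ : 0 < σ)
    (v : (n : ℕ) → (Fin n → ℝ) → ℝ) (hv : ∀ n, Measurable (v n))
    (hcons : Fomt.UniformlyConsistent v σ (Fomt.boundedHolderClass β L))
    (α : ℝ) (hα : 0 < α) (hα1 : α < 1)
    (P : Fomt.Params)
    (hP : P = { β := β, L := L, K := K, Kmax := Kmax, LK := LK, lam := lam })
    (C : ℝ)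
    (hC : C = (3 * P.Cβ (σ ^ 2) + 2 * L) * P.Ch (σ ^ 2) ^ (β - (⌈β⌉₊ : ℝ) + 1)) :
    limsup (fun n => ⨆ f ∈ Fomt.boundedHolderClass β L ∩ Fomt.monotoneClass,
        P.rejectProb v α σ n f) atTop ≤ ENNReal.ofReal α ∧
      ENNReal.ofReal (1 - α) ≤
        liminf (fun n => ⨅ f ∈ Fomt.alternativeClass β L (C * P.rate n) ∩
            Fomt.boundedHolderClass β L,
          P.rejectProb v α σ n f) atTop := by
  have hPβ : P.β = β := by rw [hP]
  have hPL : P.L = L := by rw [hP]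
  have V : P.Valid Kmin Δ := by
    subst hP
    exact ⟨hK, hβ, hβ2, hL, hlam⟩
  subst hC
  clear hP
  subst hPβ hPL
  have hreg := V.eventually_regular (pow_pos hσ 2) hα hα1
  -- a uniform bound for the probability of the bad data sets
  set b : ℕ → ℝ≥0∞ := fun n => (⨆ f ∈ Fomt.boundedHolderClass P.β P.L,
    Fomt.dataLaw f σ n {y | 1 / 100 ≤ |v n y / σ ^ 2 - 1|}) + ENNReal.ofReal (18 / n) with hb
  have hb0 : Tendsto b atTop (𝓝 0) := by
    have h1 := hcons (1 / 100) (by norm_num)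
    have h2 : Tendsto (fun n : ℕ => ENNReal.ofReal (18 / n)) atTop (𝓝 0) := by
      have := ENNReal.tendsto_ofReal (tendsto_const_div_atTop_nhds_zero_nat (18 : ℝ))
      simpa using this
    have h3 := h1.add h2
    rw [add_zero] at h3
    exact h3
  constructor
  · refine limsup_le_of_le (by isBoundedDefault) ?_
    filter_upwards [hreg, hb0.eventually_le_const (ENNReal.ofReal_pos.2 hα),
      eventually_gt_atTop 0] with n hn hbn hn0
    refine iSup₂_le fun f hf => ?_
    exact (V.rejectProb_le hσ hn0 hn.1 hf.1.1 hf.2).trans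
      ((V.dataLaw_badData_le hσ hf.1 hn0).trans hbn)
  · have hlim : Tendsto (fun n => ENNReal.ofReal (1 - α / 2) * (1 - b n)) atTop
        (𝓝 (ENNReal.ofReal (1 - α / 2))) := by
      have h1 : Tendsto (fun n => 1 - b n) atTop (𝓝 (1 - 0)) :=
        ENNReal.Tendsto.sub tendsto_const_nhds hb0 (Or.inl ENNReal.one_ne_top)
      have h2 := ENNReal.Tendsto.const_mul (a := ENNReal.ofReal (1 - α / 2)) h1
        (Or.inl (by simp))
      simpa using h2
    have hlt : ENNReal.ofReal (1 - α) < ENNReal.ofReal (1 - α / 2) :=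
      (ENNReal.ofReal_lt_ofReal_iff (by linarith)).2 (by linarith)
    refine le_liminf_of_le (by isBoundedDefault) ?_
    filter_upwards [hreg, hlim.eventually_const_le hlt, Fomt.Params.eventually_rounds_small,
      eventually_gt_atTop 1] with n hn hbn hκ hn1
    refine le_iInf₂ fun f hf => hbn.trans ?_
    refine le_trans ?_ (V.le_rejectProb hv hσ hα hα1 hn1 hn.1 hn.2.1 hn.2.2 hκ hf.1)
    gcongr
    exact V.dataLaw_badData_le hσ hf.2 (by omega)
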